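/- Let $M$ be a finite-dimensional, Hausdorff, paracompact, connected $C^\infty$ manifold (without boundary), and let $\Omega$ be a real closed smooth $2$-form on $M$. Conventions. A connection $\nabla$ on a smooth complex line bundle $L\to M$ is described, with respect to a local nowhere-vanishing smooth section $s_l$ over an open set $U_l$, by the complex $1$-form $\omega^l$ with $\nabla s_l = 2\pi i\,\omega^l\otimes s_l$; its curvature form is the global $2$-form that equals $d\omega^l$ on $U_l$. It is hermitian with respect to a hermitian metric $h$ on $L$ if $X(h(s,s'))=h(\nabla_Xs,s')+h(s,\nabla_Xs')$ for all vector fields $X$ and sections $s,s'$. The first Chern class of $L$ is the image in $\check H^2(M,\mathbb Z)$ of the class in $\check H^1(M,\mathcal F^*)$ of the transition functions $c_{lj}=s_j/s_l$ under the connecting homomorphism of the exact sequence of sheaves $0\to\mathbb Z\to\mathcal F\xrightarrow{\,f\mapsto e^{2\pi i f}\,}\mathcal F^*\to 0$, where $\mathcal F$ (resp. $\mathcal F^*$) is the sheaf of complex-valued (resp. nowhere-vanishing complex-valued) smooth functions. The Čech class $\kappa\in\check H^2(M,\mathbb R)$ canonically associated with the de Rham class $[\Omega]$ is the class of the cocycle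 $f^{lj}+f^{jk}-f^{lk}$, where $\{U_l\}$ is a sufficiently fine open cover, $\Omega|_{U_l}=d\omega^l$ and $(\omega^j-\omega^l)|_{U_l\cap U_j}=df^{lj}$, with real $\omega^l$ and $f^{lj}$; it is well defined and depends only on $[\Omega]$. Let $\varepsilon^2:\check H^2(M,\mathbb Z)\to\check H^2(M,\mathbb R)$ be the morphism induced by the inclusion $\mathbb Z\hookrightarrow\mathbb R$. Theorem. There exist a smooth complex line bundle $L$ over $M$, a hermitian metric on $L$ and a connection on $L$, hermitian with respect to this metric, whose curvature form is $\Omega$, if and only if $\kappa$ belongs to the image of $\varepsilon^2$. Moreover, whenever $\Omega$ is the curvature form of a hermitian connection on a complex line bundle $L$ with hermitian metric, the first Chern class $c(L)\in\check H^2(M,\mathbb Z)$ (which is well defined) satisfies $\varepsilon^2(c(L))=\kappa$; that is, $\Omega$ represents the image of the first Chern class of $L$. -/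

import Mathlib

open scoped Manifold ContDiff Bundle
open TopologicalSpace (Opens)
open Bundle

universe u v w w'

noncomputable section

namespace LineBundles

/-! ### Čech cohomology of sheaves of functions -/

section Cech

/-- A presheaf of abelian groups on `M` whose sections over an open set `U` are `A`-valued
functions on `U` and whose restriction maps are the restrictions of functions. -/
structure FunctionPresheaf (M : Type u) [TopologicalSpace M] (A : Type v) [AddCommGroup A] where
  sec : ∀ U : Opens M, AddSubgroup (U → A)
  restrict_mem : ∀ {U V : Opens M} (h : V ≤ U) {f : U → A}, f ∈ sec U →
    (fun p : V => f ⟨p.1, h p.2⟩) ∈ sec V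

/-- An open cover of `M` indexed by the points of `M`, the member with index `x` containing `x`.
Every open cover is refined by such a cover, so that these covers may be used to compute the
direct limit over all open covers; a refinement of such a cover has a canonical refinement map,
namely the identity of the index set `M`. -/
structure PointedCover (M : Type u) [TopologicalSpace M] where
  toOpens : M → Opens M
  mem : ∀ x, x ∈ toOpens x

variable {M : Type u} [TopologicalSpace M]

/-- `U ≤ V` means that `V` is finer than `U`. -/
instance : Preorder (PointedCover M) where
  le U V := ∀ x, V.toOpens x ≤ U.toOpens x
  le_refl U x := le_refl _
  le_trans U V W hUV hVW x := (hVW x).trans (hUV x)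

namespace PointedCover

/-- The intersection of the members of the cover with indices `σ 0, …, σ n`. -/
def inter (U : PointedCover M) {n : ℕ} (σ : Fin (n + 1) → M) : Opens M :=
  ⟨⋂ i, (U.toOpens (σ i) : Set M), isOpen_iInter_of_finite fun i => (U.toOpens (σ i)).isOpen⟩

theorem mem_inter {U : PointedCover M} {n : ℕ} {σ : Fin (n + 1) → M} {p : M} :
    p ∈ U.inter σ ↔ ∀ i, p ∈ U.toOpens (σ i) := by
  simp [inter, ← SetLike.mem_coe]

theorem inter_mono {U V : PointedCover M} (h : U ≤ V) {n : ℕ} (σ : Fin (n + 1) → M) :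
    V.inter σ ≤ U.inter σ := by
  intro p hp
  rw [mem_inter] at hp ⊢
  exact fun i => h _ (hp i)

theorem inter_le_succAbove (U : PointedCover M) {n : ℕ} (σ : Fin (n + 1 + 1) → M)
    (i : Fin (n + 1 + 1)) : U.inter σ ≤ U.inter (σ ∘ i.succAbove) := by
  intro p hp
  rw [mem_inter] at hp ⊢
  exact fun j => hp _

end PointedCover

section

variable {A : Type v} [AddCommGroup A] {B : Type w} [AddCommGroup B]

/-- The restriction homomorphism of a presheaf of functions. -/
def FunctionPresheaf.res (F : FunctionPresheaf M A) {U V : Opens M} (h : V ≤ U) :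
    F.sec U →+ F.sec V where
  toFun f := ⟨fun p => f.1 ⟨p.1, h p.2⟩, F.restrict_mem h f.2⟩
  map_zero' := rfl
  map_add' _ _ := rfl

/-- A homomorphism of presheaves of functions given by composition with a homomorphism of the
groups of values. -/
structure FunctionPresheaf.Hom (F : FunctionPresheaf M A) (G : FunctionPresheaf M B) where
  toAddMonoidHom : A →+ B
  comp_mem : ∀ {U : Opens M} {f : U → A}, f ∈ F.sec U →
    (fun p => toAddMonoidHom (f p)) ∈ G.sec U

/-- The map on sections over `U`. -/
def FunctionPresheaf.Hom.onSec {F : FunctionPresheaf M A} {G : FunctionPresheaf M B}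
    (φ : F.Hom G) (U : Opens M) : F.sec U →+ G.sec U where
  toFun f := ⟨fun p => φ.toAddMonoidHom (f.1 p), φ.comp_mem f.2⟩
  map_zero' := by ext p; exact map_zero _
  map_add' f g := by ext p; exact map_add _ _ _

/-- Čech `n`-cochains of the cover `U` with values in `F`. -/
abbrev Cochain (F : FunctionPresheaf M A) (U : PointedCover M) (n : ℕ) : Type (max u v) :=
  ∀ σ : Fin (n + 1) → M, F.sec (U.inter σ)

/-- The Čech differential
`(δc)(x₀, …, xₙ₊₁) = ∑ᵢ (-1)ⁱ c(x₀, …, x̂ᵢ, …, xₙ₊₁)`. -/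
def cechD (F : FunctionPresheaf M A) (U : PointedCover M) (n : ℕ) :
    Cochain F U n →+ Cochain F U (n + 1) where
  toFun c σ := ∑ i : Fin (n + 1 + 1),
    ((-1 : ℤ) ^ (i : ℕ)) • F.res (U.inter_le_succAbove σ i) (c (σ ∘ i.succAbove))
  map_zero' := by ext σ; simp
  map_add' c d := by ext σ; simp [smul_add, Finset.sum_add_distrib]

/-- The subgroup of Čech coboundaries. -/
def coboundaries (F : FunctionPresheaf M A) (U : PointedCover M) :
    (n : ℕ) → AddSubgroup (Cochain F U n)
  | 0 => ⊥
  | n + 1 => (cechD F U n).range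

/-- The Čech cohomology group `Hⁿ(U, F)` of the cover `U`. -/
abbrev CoverH (F : FunctionPresheaf M A) (U : PointedCover M) (n : ℕ) : Type (max u v) :=
  (cechD F U n).ker ⧸ (coboundaries F U n).addSubgroupOf (cechD F U n).ker

/-- Restriction of cochains to a finer cover. -/
def refine (F : FunctionPresheaf M A) {U V : PointedCover M} (h : U ≤ V) (n : ℕ) :
    Cochain F U n →+ Cochain F V n where
  toFun c σ := F.res (PointedCover.inter_mono h σ) (c σ)
  map_zero' := rfl
  map_add' _ _ := rfl

theorem refine_cechD (F : FunctionPresheaf M A) {U V : PointedCover M} (h : U ≤ V) (n : ℕ)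
    (c : Cochain F U n) : refine F h (n + 1) (cechD F U n c) = cechD F V n (refine F h n c) := by
  funext σ
  change F.res (PointedCover.inter_mono h σ) (∑ i : Fin (n + 1 + 1),
    ((-1 : ℤ) ^ (i : ℕ)) • F.res (U.inter_le_succAbove σ i) (c (σ ∘ i.succAbove))) = _
  rw [map_sum]
  simp only [map_zsmul]
  rfl

theorem refine_mem_ker (F : FunctionPresheaf M A) {U V : PointedCover M} (h : U ≤ V) (n : ℕ)
    {c : Cochain F U n} (hc : c ∈ (cechD F U n).ker) : refine F h n c ∈ (cechD F V n).ker := by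
  rw [AddMonoidHom.mem_ker] at hc ⊢
  rw [← refine_cechD, hc, map_zero]

/-- Restriction of cocycles to a finer cover. -/
def refineCocycle (F : FunctionPresheaf M A) {U V : PointedCover M} (h : U ≤ V) (n : ℕ) :
    (cechD F U n).ker →+ (cechD F V n).ker :=
  ((refine F h n).comp (cechD F U n).ker.subtype).codRestrict _
    fun c => refine_mem_ker F h n c.2

/-- The map `Hⁿ(U, F) → Hⁿ(V, F)` for a cover `V` finer than `U`. -/
def refineH (F : FunctionPresheaf M A) {U V : PointedCover M} (h : U ≤ V) (n : ℕ) :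
    CoverH F U n →+ CoverH F V n :=
  QuotientAddGroup.map _ _ (refineCocycle F h n) (by
    rintro ⟨c, hc⟩ hb
    rw [AddSubgroup.mem_addSubgroupOf] at hb
    rw [AddSubgroup.mem_comap, AddSubgroup.mem_addSubgroupOf]
    cases n with
    | zero =>
      have hb' : c = 0 := hb
      subst hb'
      exact map_zero (refine F h 0)
    | succ n =>
      obtain ⟨b, hb⟩ := hb
      exact ⟨refine F h n b, by rw [← refine_cechD, hb]; rfl⟩)

open Classical in
/-- The Čech cohomology group `Ȟⁿ(M, F)`: the direct limit of the groups `Hⁿ(U, F)` over the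
open covers of `M`, directed by refinement. -/
abbrev CechH (F : FunctionPresheaf M A) (n : ℕ) : Type (max u v) :=
  AddCommGroup.DirectLimit (fun U : PointedCover M => CoverH F U n)
    (fun _ _ h => refineH F h n)

open Classical in
/-- The class in `Ȟⁿ(M, F)` of a Čech cocycle. -/
def CechH.mk {F : FunctionPresheaf M A} {n : ℕ} (U : PointedCover M) (c : (cechD F U n).ker) :
    CechH F n :=
  AddCommGroup.DirectLimit.of (fun U : PointedCover M => CoverH F U n)
    (fun _ _ h => refineH F h n) U (QuotientAddGroup.mk c)

namespace FunctionPresheaf.Hom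

variable {F : FunctionPresheaf M A} {G : FunctionPresheaf M B} (φ : F.Hom G)

/-- The map induced on cochains by a homomorphism of presheaves. -/
def onCochain (U : PointedCover M) (n : ℕ) : Cochain F U n →+ Cochain G U n where
  toFun c σ := φ.onSec _ (c σ)
  map_zero' := by funext σ; exact map_zero _
  map_add' c d := by funext σ; exact map_add _ _ _

theorem onCochain_cechD (U : PointedCover M) (n : ℕ) (c : Cochain F U n) :
    φ.onCochain U (n + 1) (cechD F U n c) = cechD G U n (φ.onCochain U n c) := by
  funext σ
  change φ.onSec _ (∑ i : Fin (n + 1 + 1),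
    ((-1 : ℤ) ^ (i : ℕ)) • F.res (U.inter_le_succAbove σ i) (c (σ ∘ i.succAbove))) = _
  rw [map_sum]
  simp only [map_zsmul]
  rfl

theorem onCochain_mem_ker (U : PointedCover M) (n : ℕ) {c : Cochain F U n}
    (hc : c ∈ (cechD F U n).ker) : φ.onCochain U n c ∈ (cechD G U n).ker := by
  rw [AddMonoidHom.mem_ker] at hc ⊢
  rw [← onCochain_cechD, hc, map_zero]

/-- The map induced on cocycles by a homomorphism of presheaves. -/
def onCocycle (U : PointedCover M) (n : ℕ) : (cechD F U n).ker →+ (cechD G U n).ker :=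
  ((φ.onCochain U n).comp (cechD F U n).ker.subtype).codRestrict _
    fun c => φ.onCochain_mem_ker U n c.2

/-- The map induced on the cohomology of a cover by a homomorphism of presheaves. -/
def onCoverH (U : PointedCover M) (n : ℕ) : CoverH F U n →+ CoverH G U n :=
  QuotientAddGroup.map _ _ (φ.onCocycle U n) (by
    rintro ⟨c, hc⟩ hb
    rw [AddSubgroup.mem_addSubgroupOf] at hb
    rw [AddSubgroup.mem_comap, AddSubgroup.mem_addSubgroupOf]
    cases n with
    | zero =>
      have hb' : c = 0 := hb
      subst hb'
      exact map_zero (φ.onCochain U 0)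
    | succ n =>
      obtain ⟨b, hb⟩ := hb
      exact ⟨φ.onCochain U n b, by rw [← onCochain_cechD, hb]; rfl⟩)

open Classical in
/-- The map `Ȟⁿ(M, F) → Ȟⁿ(M, G)` induced by a homomorphism of presheaves. -/
def onCechH (n : ℕ) : CechH F n →+ CechH G n :=
  AddCommGroup.DirectLimit.map (fun U => φ.onCoverH U n) (by
    intro U V h
    ext c
    rfl)

end FunctionPresheaf.Hom

/-- The graph of the connecting homomorphism `Ȟⁿ(M, K) → Ȟⁿ⁺¹(M, F)` of a short exact sequence
`0 → F → G → K → 0`: after passing to a fine enough cover, the class `z` is represented by a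
cocycle which lifts to a `G`-valued cochain `c`, and the coboundary of `c` is (the image of) a
cocycle `b` with values in `F`, which represents `k`. -/
def IsConnecting {C : Type w'} [AddCommGroup C] {F : FunctionPresheaf M A}
    {G : FunctionPresheaf M B} {K : FunctionPresheaf M C} (i : F.Hom G) (e : G.Hom K) {n : ℕ}
    (z : CechH K n) (k : CechH F (n + 1)) : Prop :=
  ∃ (U : PointedCover M) (c : Cochain G U n) (hc : e.onCochain U n c ∈ (cechD K U n).ker)
    (b : (cechD F U (n + 1)).ker),
    CechH.mk U ⟨e.onCochain U n c, hc⟩ = z ∧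
    i.onCochain U (n + 1) b.1 = cechD G U n c ∧
    CechH.mk U b = k

end

/-- The constant sheaf with value `A`: locally constant `A`-valued functions. -/
def constSheaf (M : Type u) [TopologicalSpace M] (A : Type v) [AddCommGroup A] :
    FunctionPresheaf M A where
  sec _ :=
    { carrier := {f | IsLocallyConstant f}
      zero_mem' := IsLocallyConstant.const 0
      add_mem' := fun hf hg => hf.add hg
      neg_mem' := fun hf => hf.neg }
  restrict_mem h _ hf := hf.comp_continuous (continuous_inclusion h)

/-- The homomorphism of constant sheaves induced by the inclusion `ℤ ↪ ℝ`. -/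
def intToReal (M : Type u) [TopologicalSpace M] : (constSheaf M ℤ).Hom (constSheaf M ℝ) where
  toAddMonoidHom := Int.castAddHom ℝ
  comp_mem hf := hf.comp _

/-- The morphism `ε² : Ȟ²(M, ℤ) → Ȟ²(M, ℝ)` induced by the inclusion `ℤ ↪ ℝ`. -/
def cechEpsilon (M : Type u) [TopologicalSpace M] :
    CechH (constSheaf M ℤ) 2 →+ CechH (constSheaf M ℝ) 2 :=
  (intToReal M).onCechH 2

end Cech

/-! ### Smooth manifolds, differential forms and de Rham cohomology

The manifold `M` is modelled on the finite-dimensional real normed space `E` (no boundary). -/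

section Manifold

variable (E : Type v) [NormedAddCommGroup E] [NormedSpace ℝ E]
  (M : Type u) [TopologicalSpace M] [ChartedSpace E M]

/-- The sheaf of complex-valued smooth functions. -/
def smoothSheafC : FunctionPresheaf M ℂ where
  sec _ :=
    { carrier := {f | ContMDiff 𝓘(ℝ, E) 𝓘(ℝ, ℂ) ∞ f}
      zero_mem' := contMDiff_const
      add_mem' := fun hf hg => ContMDiff.add hf hg
      neg_mem' := fun hf => ContMDiff.neg hf }
  restrict_mem h _ hf := ContMDiff.comp hf (contMDiff_inclusion h)

/-- The sheaf of nowhere-vanishing complex-valued smooth functions, a sheaf of groups under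
multiplication (written additively). -/
def smoothSheafCStar : FunctionPresheaf M (Additive ℂˣ) where
  sec U :=
    { carrier := {f | ContMDiff 𝓘(ℝ, E) 𝓘(ℝ, ℂ) ∞ (fun p => ((f p).toMul : ℂ))}
      zero_mem' := contMDiff_const
      add_mem' := fun hf hg => by
        intro p
        exact ContDiffAt.comp_contMDiffAt (g := fun q : ℂ × ℂ => q.1 * q.2)
          contDiff_mul.contDiffAt ((hf p).prodMk_space (hg p))
      neg_mem' := fun {f} hf => by
        have h : ContMDiff 𝓘(ℝ, E) 𝓘(ℝ, ℂ) ∞ (fun p => ((f p).toMul : ℂ)⁻¹) := by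
          intro p
          exact ContDiffAt.comp_contMDiffAt (contDiffAt_inv ℝ (Units.ne_zero _)) (hf p)
        simpa using h }
  restrict_mem h f hf := ContMDiff.comp (g := fun p => ((f p).toMul : ℂ)) hf
    (contMDiff_inclusion h)

/-- The inclusion of the constant sheaf `ℤ` into the sheaf of complex smooth functions. -/
def intToSmooth : (constSheaf M ℤ).Hom (smoothSheafC E M) where
  toAddMonoidHom := Int.castAddHom ℂ
  comp_mem := fun {_ f} hf => by
    intro p
    have h : (fun q => (Int.castAddHom ℂ) (f q)) =ᶠ[nhds p] fun _ => ((f p : ℤ) : ℂ) := by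
      filter_upwards [(hf.isOpen_fiber (f p)).mem_nhds rfl] with q hq
      have hq' : f q = f p := hq
      simp [hq']
    exact contMDiffAt_const.congr_of_eventuallyEq h

/-- The homomorphism `e(f) = exp(2πif)` from smooth functions to nowhere-vanishing ones. -/
def expHom : (smoothSheafC E M).Hom (smoothSheafCStar E M) where
  toAddMonoidHom :=
    { toFun := fun z => Additive.ofMul
        (Units.mk0 (Complex.exp (2 * Real.pi * Complex.I * z)) (Complex.exp_ne_zero _))
      map_zero' := by
        apply Additive.toMul.injective
        ext
        simp
      map_add' := fun z w => by
        apply Additive.toMul.injective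
        ext
        simp [mul_add, Complex.exp_add] }
  comp_mem := fun {_ _} hf => by
    have hexp : ContDiff ℝ ∞ (fun z : ℂ => Complex.exp (2 * Real.pi * Complex.I * z)) :=
      (contDiff_const.mul contDiff_id).cexp
    exact hexp.contMDiff.comp hf

variable (F : Type w) [NormedAddCommGroup F] [NormedSpace ℝ F]

/-- (Not necessarily smooth) `F`-valued differential `k`-forms on `M`. -/
abbrev Form (k : ℕ) : Type (max u v w) :=
  ∀ x : M, TangentSpace 𝓘(ℝ, E) x [⋀^Fin k]→L[ℝ] F

variable {E M F}

namespace Form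

variable {k : ℕ}

/-- The expression of a form in the preferred chart at `x₀`, i.e. its pull-back under the inverse
of that chart. -/
def inChart (α : Form E M F k) (x₀ : M) : E → E [⋀^Fin k]→L[ℝ] F := fun y =>
  (α ((extChartAt 𝓘(ℝ, E) x₀).symm y)).compContinuousLinearMap
    (mfderiv 𝓘(ℝ, E) 𝓘(ℝ, E) (extChartAt 𝓘(ℝ, E) x₀).symm y)

/-- The form is smooth at the point `x`. -/
def SmoothAt (α : Form E M F k) (x : M) : Prop :=
  ContDiffAt ℝ ∞ (α.inChart x) (extChartAt 𝓘(ℝ, E) x x)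

/-- The exterior derivative: the exterior derivative of the expression in the chart at `x`, pulled
back to the tangent space at `x` by that chart. -/
def d (α : Form E M F k) : Form E M F (k + 1) := fun x =>
  (extDeriv (α.inChart x) (extChartAt 𝓘(ℝ, E) x x)).compContinuousLinearMap
    (mfderiv 𝓘(ℝ, E) 𝓘(ℝ, E) (extChartAt 𝓘(ℝ, E) x) x)

/-- A real form regarded as a complex one. -/
def toComplex (α : Form E M ℝ k) : Form E M ℂ k := fun x =>
  Complex.ofRealCLM.compContinuousAlternatingMap (α x)

theorem inChart_add (α η : Form E M F k) (x₀ : M) :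
    (α + η).inChart x₀ = α.inChart x₀ + η.inChart x₀ := rfl

theorem inChart_smul (a : ℝ) (α : Form E M F k) (x₀ : M) :
    (a • α).inChart x₀ = a • α.inChart x₀ := rfl

theorem SmoothAt.zero (x : M) : (0 : Form E M F k).SmoothAt x := by
  have h : (0 : Form E M F k).inChart x = fun _ => 0 := rfl
  unfold SmoothAt
  rw [h]
  exact contDiffAt_const

theorem SmoothAt.add {α η : Form E M F k} {x : M} (hα : α.SmoothAt x) (hη : η.SmoothAt x) :
    (α + η).SmoothAt x := ContDiffAt.add hα hη

theorem SmoothAt.smul (a : ℝ) {α : Form E M F k} {x : M} (hα : α.SmoothAt x) :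
    (a • α).SmoothAt x := ContDiffAt.const_smul a hα

theorem SmoothAt.differentiableAt {α : Form E M F k} {x : M} (hα : α.SmoothAt x) :
    DifferentiableAt ℝ (α.inChart x) (extChartAt 𝓘(ℝ, E) x x) :=
  ContDiffAt.differentiableAt hα (by simp)

theorem d_add {α η : Form E M F k} {x : M} (hα : α.SmoothAt x) (hη : η.SmoothAt x) :
    (α + η).d x = α.d x + η.d x := by
  unfold d
  rw [inChart_add, extDeriv_add hα.differentiableAt hη.differentiableAt]
  rfl

theorem d_smul (a : ℝ) (α : Form E M F k) (x : M) : (a • α).d x = a • α.d x := by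
  unfold d
  rw [inChart_smul, extDeriv_smul]
  rfl

theorem d_zero (x : M) : (0 : Form E M F k).d x = 0 := by
  have h := d_smul (0 : ℝ) (0 : Form E M F k) x
  simpa using h

end Form

variable (E M)

/-- The space of closed smooth real `k`-forms. -/
def closedForms (k : ℕ) : Submodule ℝ (Form E M ℝ k) where
  carrier := {α | ∀ x, α.SmoothAt x ∧ α.d x = 0}
  zero_mem' x := ⟨Form.SmoothAt.zero x, Form.d_zero x⟩
  add_mem' {α η} hα hη x := ⟨(hα x).1.add (hη x).1, by
    rw [Form.d_add (hα x).1 (hη x).1, (hα x).2, (hη x).2, add_zero]⟩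
  smul_mem' a α hα x := ⟨(hα x).1.smul a, by rw [Form.d_smul, (hα x).2, smul_zero]⟩

/-- The space of exact real `k + 1`-forms: the differentials of smooth `k`-forms. -/
def exactForms (k : ℕ) : Submodule ℝ (Form E M ℝ (k + 1)) where
  carrier := {α | ∃ η : Form E M ℝ k, (∀ x, η.SmoothAt x) ∧ α = η.d}
  zero_mem' := ⟨0, fun x => Form.SmoothAt.zero x, by
    funext x; exact (Form.d_zero x).symm⟩
  add_mem' := by
    rintro _ _ ⟨η, hη, rfl⟩ ⟨θ, hθ, rfl⟩
    exact ⟨η + θ, fun x => (hη x).add (hθ x), by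
      funext x; exact (Form.d_add (hη x) (hθ x)).symm⟩
  smul_mem' := by
    rintro a _ ⟨η, hη, rfl⟩
    exact ⟨a • η, fun x => (hη x).smul a, by funext x; exact (Form.d_smul a η x).symm⟩

/-- The de Rham cohomology space `H²(M, ℝ)`. -/
abbrev DeRhamH2 : Type (max u v) :=
  closedForms E M 2 ⧸ (exactForms E M 1).submoduleOf (closedForms E M 2)

variable {E M}

/-- The de Rham class of a closed 2-form. -/
def DeRhamH2.mk (Ω : closedForms E M 2) : DeRhamH2 E M := Submodule.Quotient.mk Ω

/-- The graph of the canonical map from de Rham to Čech cohomology in degree two: if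
`Ω = dαₓ` on `Uₓ`, `α_y - αₓ = df_{xy}` on `Uₓ ∩ U_y`, then the class of `Ω` is sent to the class
of the cocycle of the locally constant functions `f_{yz} - f_{xz} + f_{xy}` on
`Uₓ ∩ U_y ∩ U_z`. -/
def IsCechClassOf (κ : CechH (constSheaf M ℝ) 2) (c : DeRhamH2 E M) : Prop :=
  ∃ (Ω : closedForms E M 2) (U : PointedCover M) (α : M → Form E M ℝ 1) (f : M → M → M → ℝ)
    (a : (cechD (constSheaf M ℝ) U 2).ker),
    DeRhamH2.mk Ω = c ∧
    (∀ x, ∀ p ∈ U.toOpens x, (α x).SmoothAt p ∧ (α x).d p = Ω.1 p) ∧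
    (∀ x y, ContMDiffOn 𝓘(ℝ, E) 𝓘(ℝ, ℝ) ∞ (f x y) (U.toOpens x ∩ U.toOpens y : Set M)) ∧
    (∀ x y, ∀ p ∈ U.toOpens x, p ∈ U.toOpens y → ∀ v : TangentSpace 𝓘(ℝ, E) p,
      α y p (fun _ => v) - α x p (fun _ => v) = mvfderiv 𝓘(ℝ, E) (f x y) p v) ∧
    (∀ x y z, ∀ p : U.inter ![x, y, z],
      (a.1 ![x, y, z]).1 p = f y z p - f x z p + f x y p) ∧
    CechH.mk U a = κ

end Manifold

/-! ### Complex line bundles, hermitian metrics and connections -/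

section Bundle

/-- A smooth complex line bundle on the manifold `M`: a smooth (real) vector bundle with model
fibre `ℂ` whose fibres are complex vector spaces and whose local trivializations are
complex-linear on the fibres. -/
structure ComplexLineBundle (E : Type v) [NormedAddCommGroup E] [NormedSpace ℝ E]
    (M : Type u) [TopologicalSpace M] [ChartedSpace E M] where
  Fiber : M → Type w
  [addCommGroup : ∀ x, AddCommGroup (Fiber x)]
  [module : ∀ x, Module ℂ (Fiber x)]
  [fiberTopology : ∀ x, TopologicalSpace (Fiber x)]
  [isTopologicalAddGroup : ∀ x, IsTopologicalAddGroup (Fiber x)]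
  [continuousSMul : ∀ x, ContinuousSMul ℂ (Fiber x)]
  [continuousSMulReal : ∀ x, ContinuousSMul ℝ (Fiber x)]
  [totalTopology : TopologicalSpace (TotalSpace ℂ Fiber)]
  [fiberBundle : FiberBundle ℂ Fiber]
  [vectorBundle : VectorBundle ℂ ℂ Fiber]
  [vectorBundleReal : VectorBundle ℝ ℂ Fiber]
  [contMDiffVectorBundle : ContMDiffVectorBundle ∞ ℂ Fiber 𝓘(ℝ, E)]

attribute [instance] ComplexLineBundle.addCommGroup ComplexLineBundle.module
  ComplexLineBundle.fiberTopology ComplexLineBundle.isTopologicalAddGroup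
  ComplexLineBundle.continuousSMul ComplexLineBundle.continuousSMulReal
  ComplexLineBundle.totalTopology ComplexLineBundle.fiberBundle ComplexLineBundle.vectorBundle
  ComplexLineBundle.vectorBundleReal ComplexLineBundle.contMDiffVectorBundle

variable {E : Type v} [NormedAddCommGroup E] [NormedSpace ℝ E]
  {M : Type u} [TopologicalSpace M] [ChartedSpace E M]

namespace ComplexLineBundle

variable (L : ComplexLineBundle.{u, v, w} E M)

/-- The total space of the bundle. -/
abbrev Total : Type (max u w) := TotalSpace ℂ L.Fiber

variable {L}

/-- A section, regarded as a map into the total space. -/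
def toTotal (s : ∀ x, L.Fiber x) : M → L.Total := fun x => TotalSpace.mk' ℂ x (s x)

/-- `s` is a smooth nowhere-vanishing section over the open set `U` (its values outside `U` are
irrelevant). -/
def IsFrameOn (s : ∀ x, L.Fiber x) (U : Opens M) : Prop :=
  ContMDiffOn 𝓘(ℝ, E) (𝓘(ℝ, E).prod 𝓘(ℝ, ℂ)) ∞ (toTotal s) U ∧ ∀ p ∈ U, s p ≠ 0

variable (L)

/-- `z ∈ Ȟ¹(M, 𝓕*)` is the class of the cocycle of transition functions `c_{xy} = s_y / sₓ` of a
trivialization `(Uₓ, sₓ)` of `L`. -/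
def IsTransitionClass (z : CechH (smoothSheafCStar E M) 1) : Prop :=
  ∃ (U : PointedCover M) (s : M → ∀ p, L.Fiber p) (c : (cechD (smoothSheafCStar E M) U 1).ker),
    (∀ x, IsFrameOn (s x) (U.toOpens x)) ∧
    (∀ x y, ∀ p : U.inter ![x, y], s y p = (((c.1 ![x, y]).1 p).toMul : ℂ) • s x p) ∧
    CechH.mk U c = z

/-- `k ∈ Ȟ²(M, ℤ)` is the first Chern class of `L`: the image of the class of the transition
functions of `L` under the connecting homomorphism `Ȟ¹(M, 𝓕*) → Ȟ²(M, ℤ)` of the exponential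
sequence `0 → ℤ → 𝓕 → 𝓕* → 0`. -/
def IsFirstChernClass (k : CechH (constSheaf M ℤ) 2) : Prop :=
  ∃ z : CechH (smoothSheafCStar E M) 1,
    L.IsTransitionClass z ∧ IsConnecting (intToSmooth E M) (expHom E M) z k

/-- A hermitian metric on `L`: smoothly varying positive definite hermitian forms on the fibres,
linear in the first and conjugate-linear in the second argument. -/
structure HermitianMetric where
  toFun : ∀ x, L.Fiber x →ₗ[ℂ] L.Fiber x →ₗ⋆[ℂ] ℂ
  conj_symm : ∀ x (v w : L.Fiber x), toFun x v w = starRingEnd ℂ (toFun x w v)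
  pos : ∀ x (v : L.Fiber x), v ≠ 0 → 0 < (toFun x v v).re
  smooth : ∀ (s t : ∀ x, L.Fiber x) (x : M),
    ContMDiffAt 𝓘(ℝ, E) (𝓘(ℝ, E).prod 𝓘(ℝ, ℂ)) ∞ (toTotal s) x →
    ContMDiffAt 𝓘(ℝ, E) (𝓘(ℝ, E).prod 𝓘(ℝ, ℂ)) ∞ (toTotal t) x →
    ContMDiffAt 𝓘(ℝ, E) 𝓘(ℝ, ℂ) ∞ (fun y => toFun y (s y) (t y)) x

variable [IsManifold 𝓘(ℝ, E) ∞ M]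

/-- A smooth connection on `L`: a covariant derivative that satisfies the Leibniz rule for
complex-valued functions. Here `∇ s x v` is the covariant derivative of `s` at `x` in the
direction `v`. -/
structure Connection where
  toCovariantDerivative : CovariantDerivative 𝓘(ℝ, E) ℂ L.Fiber
  smooth : CovariantDerivative.ContMDiffCovariantDerivative toCovariantDerivative ∞
  leibniz : ∀ (s : ∀ x, L.Fiber x) (g : M → ℂ) (x : M),
    MDifferentiableAt 𝓘(ℝ, E) (𝓘(ℝ, E).prod 𝓘(ℝ, ℂ)) (toTotal s) x →
    MDifferentiableAt 𝓘(ℝ, E) 𝓘(ℝ, ℂ) g x →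
    ∀ v : TangentSpace 𝓘(ℝ, E) x,
      toCovariantDerivative (fun y => g y • s y) x v =
        mvfderiv 𝓘(ℝ, E) g x v • s x + g x • toCovariantDerivative s x v

variable {L}

/-- The complex 2-form `Ω` is the curvature form of the connection: locally there are a frame `s`
and a complex 1-form `α` with `∇s = 2πi α ⊗ s` and `dα = Ω`. -/
def Connection.IsCurvatureForm (D : L.Connection) (Ω : Form E M ℂ 2) : Prop :=
  ∀ x₀ : M, ∃ (U : Opens M) (s : ∀ x, L.Fiber x) (α : Form E M ℂ 1),
    x₀ ∈ U ∧ IsFrameOn s U ∧ (∀ x ∈ U, α.SmoothAt x) ∧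
    (∀ x ∈ U, ∀ v : TangentSpace 𝓘(ℝ, E) x,
      D.toCovariantDerivative s x v = (2 * Real.pi * Complex.I * α x (fun _ => v)) • s x) ∧
    ∀ x ∈ U, α.d x = Ω x

/-- The connection is hermitian with respect to the metric `h`:
`X (h(s, t)) = h(∇_X s, t) + h(s, ∇_X t)`. -/
def Connection.IsHermitian (D : L.Connection) (h : L.HermitianMetric) : Prop :=
  ∀ (s t : ∀ x, L.Fiber x) (x : M),
    MDifferentiableAt 𝓘(ℝ, E) (𝓘(ℝ, E).prod 𝓘(ℝ, ℂ)) (toTotal s) x →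
    MDifferentiableAt 𝓘(ℝ, E) (𝓘(ℝ, E).prod 𝓘(ℝ, ℂ)) (toTotal t) x →
    ∀ v : TangentSpace 𝓘(ℝ, E) x,
      mvfderiv 𝓘(ℝ, E) (fun y => h.toFun y (s y) (t y)) x v =
        h.toFun x (D.toCovariantDerivative s x v) (t x) +
          h.toFun x (s x) (D.toCovariantDerivative t x v)

variable (L)

/-- `Ω` is the curvature form of some hermitian connection on `L`, for some hermitian metric. -/
def HasHermitianConnectionWithCurvature (Ω : Form E M ℝ 2) : Prop :=
  ∃ (h : L.HermitianMetric) (D : L.Connection), D.IsHermitian h ∧ D.IsCurvatureForm Ω.toComplex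

end ComplexLineBundle

end Bundle

end LineBundles

end

open LineBundles

/-! Write e(t) = exp(2πit) and δ for the Čech differential. On a fine enough cover the Poincaré
lemma gives real potentials with Ω = dα_x and real functions with α_y − α_x = df_{xy}. The cochain
δf has vanishing differential, so it is locally constant, and it represents κ. The theorem comes
from comparing δf with the transition functions e(f_{xy}).

If δf is integral, then e(f_{xy}) is a multiplicative cocycle and glues a line bundle
(`IntegralCocycle.lineBundle`). Since f is real, the transition functions have modulus one and the
standard metric of ℂ glues; since df_{xy} = α_y − α_x, the local connections d + 2πi α_x glue. The
result is hermitian because α_x is real, and its curvature form is Ω. If κ merely lies in the image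
of ε², then on a finer cover δf differs from an integral cocycle by δt with t real and locally
constant. Replacing f by f − t changes no differential and makes δf integral
(`Potentials.exists_integralCocycle`).

Conversely, a connection with curvature form Ω provides local frames with connection forms A_x and
dA_x = Ω. The ratio c of two frames satisfies dc = 2πi(A_y − A_x)c, so on a chart-convex set c =
e(F) with dF = A_y − A_x (`Connection.exists_transition_eq_exp`). The cocycle relation for c makes
δF integral. By the definition of the connecting homomorphism δF represents the first Chern class,
and since Re A and Re F are potentials for Ω it also represents κ
(`exists_isFirstChernClass_and_potentials`). This yields both the necessity of integrality and
ε²(c(L)) = κ.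

Two things support these arguments. First, no cover with contractible intersections is needed: in
the cover given by `PointedCover.exists_barycentric`, a member W_y that meets W_x lies in the domain
of the local data attached to x, so the comparison is made on the chart-convex set W_y and not on
W_x ∩ W_y. Second, the classes involved do not depend on choices: `Potentials.mk_eq_mk` for κ,
`IsTransitionClass.eq` and `IsConnecting.eq` for the Chern class. -/

noncomputable section

namespace LineBundles

/-! ### Values of cochains -/

section CochainValues

variable {M : Type u} [TopologicalSpace M] {A : Type v} [AddCommGroup A] {B : Type w}
  [AddCommGroup B] {F : FunctionPresheaf M A} {G : FunctionPresheaf M B}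
  {U V : PointedCover M} {n : ℕ}

open Classical in
/-- The value of a cochain at a point, extended by zero to all of `M`. -/
def Cochain.val (c : Cochain F U n) (σ : Fin (n + 1) → M) (p : M) : A :=
  if h : p ∈ U.inter σ then (c σ).1 ⟨p, h⟩ else 0

theorem Cochain.val_of_mem (c : Cochain F U n) {σ : Fin (n + 1) → M} {p : M}
    (h : p ∈ U.inter σ) : Cochain.val c σ p = (c σ).1 ⟨p, h⟩ := dif_pos h

/-- Only values over the relevant intersection count. Working with total functions on `M` makes
restriction maps disappear, so that Čech identities become pointwise identities in `A`. -/
theorem Cochain.ext_val {c d : Cochain F U n}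
    (h : ∀ σ p, p ∈ U.inter σ → Cochain.val c σ p = Cochain.val d σ p) : c = d := by
  funext σ
  apply Subtype.ext
  funext p
  have := h σ p.1 p.2
  rwa [Cochain.val_of_mem c p.2, Cochain.val_of_mem d p.2] at this

/-- The cochain with prescribed values. -/
def Cochain.ofFun (F : FunctionPresheaf M A) (U : PointedCover M)
    (φ : (Fin (n + 1) → M) → M → A)
    (hφ : ∀ σ, (fun p : U.inter σ => φ σ p) ∈ F.sec (U.inter σ)) : Cochain F U n :=
  fun σ => ⟨_, hφ σ⟩

theorem Cochain.val_ofFun {φ : (Fin (n + 1) → M) → M → A}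
    (hφ : ∀ σ, (fun p : U.inter σ => φ σ p) ∈ F.sec (U.inter σ)) {σ : Fin (n + 1) → M} {p : M}
    (h : p ∈ U.inter σ) : Cochain.val (Cochain.ofFun F U φ hφ) σ p = φ σ p :=
  Cochain.val_of_mem _ h

theorem Cochain.val_mem_sec (c : Cochain F U n) (σ : Fin (n + 1) → M) :
    (fun p : U.inter σ => Cochain.val c σ p) ∈ F.sec (U.inter σ) := by
  have : (fun p : U.inter σ => Cochain.val c σ p) = (c σ).1 := by
    funext p
    exact Cochain.val_of_mem c p.2
  rw [this]
  exact (c σ).2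

theorem Cochain.val_sub (c d : Cochain F U n) {σ : Fin (n + 1) → M} {p : M}
    (h : p ∈ U.inter σ) :
    Cochain.val (c - d) σ p = Cochain.val c σ p - Cochain.val d σ p := by
  simp only [Cochain.val_of_mem _ h]
  rfl

theorem Cochain.val_zero {σ : Fin (n + 1) → M} {p : M} :
    Cochain.val (0 : Cochain F U n) σ p = 0 := by
  unfold Cochain.val
  split_ifs <;> rfl

theorem Cochain.val_refine (h : U ≤ V) (c : Cochain F U n) {σ : Fin (n + 1) → M} {p : M}
    (hp : p ∈ V.inter σ) : Cochain.val (refine F h n c) σ p = Cochain.val c σ p := by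
  rw [Cochain.val_of_mem _ hp, Cochain.val_of_mem _ (PointedCover.inter_mono h σ hp)]
  rfl

theorem Cochain.val_onCochain (φ : F.Hom G) (c : Cochain F U n) {σ : Fin (n + 1) → M} {p : M}
    (hp : p ∈ U.inter σ) :
    Cochain.val (φ.onCochain U n c) σ p = φ.toAddMonoidHom (Cochain.val c σ p) := by
  rw [Cochain.val_of_mem _ hp, Cochain.val_of_mem _ hp]
  rfl

theorem Cochain.val_cechD (c : Cochain F U n) {σ : Fin (n + 1 + 1) → M} {p : M}
    (hp : p ∈ U.inter σ) :
    Cochain.val (cechD F U n c) σ p =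
      ∑ i : Fin (n + 1 + 1), ((-1 : ℤ) ^ (i : ℕ)) • Cochain.val c (σ ∘ i.succAbove) p := by
  rw [Cochain.val_of_mem _ hp]
  change ((∑ i : Fin (n + 1 + 1), ((-1 : ℤ) ^ (i : ℕ)) •
    F.res (U.inter_le_succAbove σ i) (c (σ ∘ i.succAbove)) : F.sec (U.inter σ)) :
      U.inter σ → A) ⟨p, hp⟩ = _
  rw [AddSubgroup.val_finsetSum, Finset.sum_apply]
  refine Finset.sum_congr rfl fun i _ => ?_
  rw [Cochain.val_of_mem _ (U.inter_le_succAbove σ i hp)]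
  rfl

theorem Cochain.val_cechD_zero (c : Cochain F U 0) {σ : Fin 2 → M} {p : M}
    (hp : p ∈ U.inter σ) :
    Cochain.val (cechD F U 0 c) σ p =
      Cochain.val c ![σ 1] p - Cochain.val c ![σ 0] p := by
  have h0 : σ ∘ Fin.succAbove 0 = ![σ 1] := by ext i; fin_cases i; rfl
  have h1 : σ ∘ Fin.succAbove 1 = ![σ 0] := by ext i; fin_cases i; rfl
  rw [Cochain.val_cechD c hp, Fin.sum_univ_two, h0, h1]
  simp [sub_eq_add_neg]

theorem Cochain.val_cechD_one (c : Cochain F U 1) {σ : Fin 3 → M} {p : M}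
    (hp : p ∈ U.inter σ) :
    Cochain.val (cechD F U 1 c) σ p =
      Cochain.val c ![σ 1, σ 2] p - Cochain.val c ![σ 0, σ 2] p +
        Cochain.val c ![σ 0, σ 1] p := by
  have h0 : σ ∘ Fin.succAbove 0 = ![σ 1, σ 2] := by ext i; fin_cases i <;> rfl
  have h1 : σ ∘ Fin.succAbove 1 = ![σ 0, σ 2] := by ext i; fin_cases i <;> rfl
  have h2 : σ ∘ Fin.succAbove 2 = ![σ 0, σ 1] := by ext i; fin_cases i <;> rfl
  rw [Cochain.val_cechD c hp, Fin.sum_univ_three, h0, h1, h2]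
  simp [sub_eq_add_neg]

theorem Cochain.val_cechD_two (c : Cochain F U 2) {σ : Fin 4 → M} {p : M}
    (hp : p ∈ U.inter σ) :
    Cochain.val (cechD F U 2 c) σ p =
      Cochain.val c ![σ 1, σ 2, σ 3] p - Cochain.val c ![σ 0, σ 2, σ 3] p +
        Cochain.val c ![σ 0, σ 1, σ 3] p - Cochain.val c ![σ 0, σ 1, σ 2] p := by
  have h0 : σ ∘ Fin.succAbove 0 = ![σ 1, σ 2, σ 3] := by ext i; fin_cases i <;> rfl
  have h1 : σ ∘ Fin.succAbove 1 = ![σ 0, σ 2, σ 3] := by ext i; fin_cases i <;> rfl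
  have h2 : σ ∘ Fin.succAbove 2 = ![σ 0, σ 1, σ 3] := by ext i; fin_cases i <;> rfl
  have h3 : σ ∘ Fin.succAbove 3 = ![σ 0, σ 1, σ 2] := by ext i; fin_cases i <;> rfl
  rw [Cochain.val_cechD c hp, Fin.sum_univ_four, h0, h1, h2, h3]
  simp [sub_eq_add_neg, pow_succ]

end CochainValues

/-! ### Classes of cocycles in the direct limit -/

section Classes

variable {M : Type u} [TopologicalSpace M] {A : Type v} [AddCommGroup A] {B : Type w}
  [AddCommGroup B] {F : FunctionPresheaf M A} {G : FunctionPresheaf M B}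
  {U V : PointedCover M} {n : ℕ}

/-- The cover by the intersections of the members of two covers. -/
def PointedCover.inf (U V : PointedCover M) : PointedCover M :=
  ⟨fun x => U.toOpens x ⊓ V.toOpens x, fun x => ⟨U.mem x, V.mem x⟩⟩

theorem PointedCover.le_inf_left (U V : PointedCover M) : U ≤ U.inf V :=
  fun _ _ hp => hp.1

theorem PointedCover.le_inf_right (U V : PointedCover M) : V ≤ U.inf V :=
  fun _ _ hp => hp.2

instance : IsDirectedOrder (PointedCover M) :=
  ⟨fun U V => ⟨U.inf V, U.le_inf_left V, U.le_inf_right V⟩⟩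

instance : Nonempty (PointedCover M) := ⟨⟨fun _ => ⊤, fun _ => trivial⟩⟩

instance : DirectedSystem (fun U : PointedCover M => CoverH F U n)
    fun _ _ h => refineH F h n where
  map_self U x := by
    induction x using QuotientAddGroup.induction_on
    rfl
  map_map U V W h h' x := by
    induction x using QuotientAddGroup.induction_on
    rfl

theorem CechH.mk_refineCocycle (h : U ≤ V) (c : (cechD F U n).ker) :
    CechH.mk V (refineCocycle F h n c) = CechH.mk U c := by
  classical
  exact AddCommGroup.DirectLimit.of_f (G := fun U : PointedCover M => CoverH F U n)
    (f := fun _ _ h => refineH F h n) h (QuotientAddGroup.mk c)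

theorem CechH.exists_mk (z : CechH F n) :
    ∃ (U : PointedCover M) (c : (cechD F U n).ker), CechH.mk U c = z := by
  classical
  induction z using AddCommGroup.DirectLimit.induction_on with
  | ih U x =>
    induction x using QuotientAddGroup.induction_on with
    | H c => exact ⟨U, c, rfl⟩

theorem CechH.mk_sub (c d : (cechD F U n).ker) :
    CechH.mk U (c - d) = CechH.mk U c - CechH.mk U d := by
  unfold CechH.mk
  rw [QuotientAddGroup.mk_sub, map_sub]

theorem CechH.mk_eq_zero_of_mem {c : (cechD F U n).ker} (hc : c.1 ∈ coboundaries F U n) :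
    CechH.mk U c = 0 := by
  unfold CechH.mk
  rw [(QuotientAddGroup.eq_zero_iff c).2 (AddSubgroup.mem_addSubgroupOf.2 hc), map_zero]

/-- In a direct limit over a directed set, an element that becomes zero is already zero at some
later stage; here that stage is a finer cover. -/
theorem CechH.exists_of_mk_eq_zero {c : (cechD F U n).ker} (hc : CechH.mk U c = 0) :
    ∃ (W : PointedCover M) (h : U ≤ W), refine F h n c.1 ∈ coboundaries F W n := by
  classical
  obtain ⟨W, h, hW⟩ := AddCommGroup.DirectLimit.of.zero_exact
    (G := fun U : PointedCover M => CoverH F U n)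
    (f := fun _ _ h => refineH F h n) U (QuotientAddGroup.mk c) hc
  refine ⟨W, h, ?_⟩
  have h2 : (QuotientAddGroup.mk (refineCocycle F h n c) : CoverH F W n) = 0 := hW
  rw [QuotientAddGroup.eq_zero_iff, AddSubgroup.mem_addSubgroupOf] at h2
  exact h2

/-- Two cocycles represent the same class if they become cohomologous on a common refinement. -/
theorem CechH.mk_eq_mk {c : (cechD F U n).ker} {d : (cechD F V n).ker} {W : PointedCover M}
    (hU : U ≤ W) (hV : V ≤ W) (h : refine F hU n c.1 - refine F hV n d.1 ∈ coboundaries F W n) :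
    CechH.mk U c = CechH.mk V d := by
  rw [← CechH.mk_refineCocycle hU, ← CechH.mk_refineCocycle hV, ← sub_eq_zero, ← CechH.mk_sub]
  exact CechH.mk_eq_zero_of_mem h

/-- Two cocycles which represent the same class become cohomologous on a common refinement. -/
theorem CechH.exists_of_mk_eq_mk {c : (cechD F U n).ker} {d : (cechD F V n).ker}
    (h : CechH.mk U c = CechH.mk V d) :
    ∃ (W : PointedCover M) (hU : U ≤ W) (hV : V ≤ W),
      refine F hU n c.1 - refine F hV n d.1 ∈ coboundaries F W n := by
  have h' := h
  rw [← CechH.mk_refineCocycle (U.le_inf_left V), ← CechH.mk_refineCocycle (U.le_inf_right V),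
    ← sub_eq_zero, ← CechH.mk_sub] at h'
  obtain ⟨W, hW, hc⟩ := CechH.exists_of_mk_eq_zero h'
  exact ⟨W, (U.le_inf_left V).trans hW, (U.le_inf_right V).trans hW, hc⟩

theorem FunctionPresheaf.Hom.onCechH_mk (φ : F.Hom G) (c : (cechD F U n).ker) :
    φ.onCechH n (CechH.mk U c) = CechH.mk U (φ.onCocycle U n c) := by
  classical
  exact AddCommGroup.DirectLimit.map_apply_of _ _ _

end Classes

/-! ### Barycentric refinements -/

section Refinement

variable {M : Type u} [TopologicalSpace M]

/-- If every point has arbitrarily small open neighbourhoods with the property `P`, then every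
pointed cover is refined by one whose members have the property `P`. -/
theorem PointedCover.exists_le_forall {P : Opens M → Prop}
    (hP : ∀ (x : M) (O : Opens M), x ∈ O → ∃ B : Opens M, x ∈ B ∧ B ≤ O ∧ P B)
    (U : PointedCover M) : ∃ W : PointedCover M, U ≤ W ∧ ∀ x, P (W.toOpens x) := by
  choose B hxB hBO hB using fun x => hP x (U.toOpens x) (U.mem x)
  exact ⟨⟨B, hxB⟩, hBO, hB⟩

/-- Every open cover of a paracompact Hausdorff space has an open barycentric refinement, whose
members may be taken in a given class of sets which contains arbitrarily small neighbourhoods of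
every point. -/
theorem PointedCover.exists_barycentric [T2Space M] [ParacompactSpace M] {P : Opens M → Prop}
    (hP : ∀ (x : M) (O : Opens M), x ∈ O → ∃ B : Opens M, x ∈ B ∧ B ≤ O ∧ P B)
    (D : PointedCover M) :
    ∃ (W : PointedCover M) (j : M → M), (∀ x, W.toOpens x ≤ D.toOpens (j x)) ∧
      (∀ x y p, p ∈ W.toOpens x → p ∈ W.toOpens y → W.toOpens y ≤ D.toOpens (j x)) ∧
      ∀ x, P (W.toOpens x) := by
  obtain ⟨v, vo, vc, vf, vD⟩ := precise_refinement (fun x => (D.toOpens x : Set M))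
    (fun x => (D.toOpens x).isOpen) (Set.iUnion_eq_univ_iff.2 fun x => ⟨x, D.mem x⟩)
  -- Shrink the locally finite refinement `v` to a cover `v'` with closures inside `v`. Each `j x`
  -- below selects a member of `v'` that contains `x`.
  obtain ⟨v', vc', vo', hv'⟩ := exists_iUnion_eq_closure_subset vo
    (fun x => vf.point_finite x) vc
  have hj : ∀ x, ∃ i, x ∈ v' i := fun x => Set.mem_iUnion.1 (vc'.symm ▸ Set.mem_univ x)
  choose j hj using hj
  have vf' : LocallyFinite fun i => closure (v' i) := vf.subset hv'
  -- Around `x` every index `i` is decided: either `x` is in the closure of `v' i`, and `B` stays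
  -- inside `v i`, or it is not, and `B` misses `v' i`. Local finiteness makes the finite
  -- intersection open and the union of the excluded closures closed.
  have key : ∀ x, ∃ B : Opens M, x ∈ B ∧ (B : Set M) ⊆ v' (j x) ∧
      (∀ i, x ∈ closure (v' i) → (B : Set M) ⊆ v i) ∧
      (∀ i, x ∉ closure (v' i) → Disjoint (B : Set M) (v' i)) ∧ P B := by
    intro x
    have hfin := vf.point_finite x
    have hclosed : IsClosed (⋃ i : {i // x ∉ closure (v' i)}, closure (v' i.1)) :=
      (vf'.comp_injective Subtype.val_injective).isClosed_iUnion fun i => isClosed_closure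
    let O : Opens M := ⟨v' (j x) ∩ (⋂ i ∈ {i | x ∈ v i}, v i) ∩
      (⋃ i : {i // x ∉ closure (v' i)}, closure (v' i.1))ᶜ,
      ((vo' _).inter (hfin.isOpen_biInter fun i _ => vo i)).inter hclosed.isOpen_compl⟩
    have hxO : x ∈ O := by
      refine ⟨⟨hj x, Set.mem_iInter₂.2 fun i hi => hi⟩, ?_⟩
      rw [Set.mem_compl_iff, Set.mem_iUnion]
      rintro ⟨i, hi⟩
      exact i.2 hi
    obtain ⟨B, hxB, hBO, hB⟩ := hP x O hxO
    refine ⟨B, hxB, fun p hp => (hBO hp).1.1, fun i hi p hp => ?_, fun i hi => ?_, hB⟩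
    · exact Set.mem_iInter₂.1 (hBO hp).1.2 i (hv' i hi)
    · rw [Set.disjoint_left]
      exact fun p hp hpi => (hBO hp).2 (Set.mem_iUnion.2 ⟨⟨i, hi⟩, subset_closure hpi⟩)
  choose B hxB hBv hB1 hB2 hBP using key
  refine ⟨⟨B, hxB⟩, j, fun x p hp => vD _ (hv' _ (subset_closure (hBv x hp))), ?_, hBP⟩
  intro x y p hpx hpy q hq
  -- The common point `p` lies in `v' (j x)`, so the member at `y` does not miss `v' (j x)`; by the
  -- dichotomy it is contained in `v (j x)`.
  have hy : y ∈ closure (v' (j x)) := by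
    by_contra hy
    exact Set.disjoint_left.1 (hB2 y _ hy) hpy (hBv x hpx)
  exact vD _ (hB1 y _ hy hq)

end Refinement

/-! ### Smoothness of pull-backs and of parametric integrals -/

section Calculus

open ContinuousAlternatingMap

/-- This is the inductive step of the next lemma. There `curry` is the currying of alternating maps
and `alt` a multiple of alternatization, but only their being fixed continuous linear maps matters.
-/
theorem contDiff_comp_compL_comp_flip {D E₁ E₂ X Y P Q : Type*} [NormedAddCommGroup D]
    [NormedSpace ℝ D] [NormedAddCommGroup E₁] [NormedSpace ℝ E₁] [NormedAddCommGroup E₂]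
    [NormedSpace ℝ E₂] [NormedAddCommGroup X] [NormedSpace ℝ X] [NormedAddCommGroup Y]
    [NormedSpace ℝ Y] [NormedAddCommGroup P] [NormedSpace ℝ P] [NormedAddCommGroup Q]
    [NormedSpace ℝ Q] {m : WithTop ℕ∞} (curry : P →L[ℝ] E₂ →L[ℝ] X)
    (alt : (E₁ →L[ℝ] Y) →L[ℝ] Q) {B : D → X →L[ℝ] Y} {A : D → E₁ →L[ℝ] E₂}
    (hB : ContDiff ℝ m B) (hA : ContDiff ℝ m A) :
    ContDiff ℝ m fun d => alt ∘L (ContinuousLinearMap.compL ℝ E₁ X Y (B d)) ∘L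
      ((ContinuousLinearMap.compL ℝ E₁ E₂ X).flip (A d)) ∘L curry :=
  contDiff_const.clm_comp (((ContinuousLinearMap.contDiff _).comp hB).clm_comp
    (((ContinuousLinearMap.contDiff _).comp hA).clm_comp contDiff_const))

set_option synthInstance.maxHeartbeats 200000 in
-- Alternatizing a curried form of degree k + 1 returns k + 1 times the form. Hence pull-back in
-- degree k + 1 is built from fixed linear maps, the pull-back in degree k and one more factor `A`,
-- and induction applies. In degree zero pull-back does not depend on `A`.
theorem contDiff_compContinuousLinearMapCLM {E₁ E₂ G : Type*} [NormedAddCommGroup E₁]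
    [NormedSpace ℝ E₁] [NormedAddCommGroup E₂] [NormedSpace ℝ E₂] [NormedAddCommGroup G]
    [NormedSpace ℝ G] {m : WithTop ℕ∞} (k : ℕ) :
    ContDiff ℝ m (fun A : E₁ →L[ℝ] E₂ =>
      (compContinuousLinearMapCLM A : (E₂ [⋀^Fin k]→L[ℝ] G) →L[ℝ] (E₁ [⋀^Fin k]→L[ℝ] G))) := by
  induction k with
  | zero =>
    have : (fun A : E₁ →L[ℝ] E₂ =>
        (compContinuousLinearMapCLM A : (E₂ [⋀^Fin 0]→L[ℝ] G) →L[ℝ] (E₁ [⋀^Fin 0]→L[ℝ] G))) =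
        fun _ => compContinuousLinearMapCLM 0 := by
      funext A
      ext β v
      change β _ = β _
      congr 1
      exact Subsingleton.elim _ _
    rw [this]
    exact contDiff_const
  | succ k ih =>
    let curry : (E₂ [⋀^Fin (k + 1)]→L[ℝ] G) →L[ℝ] (E₂ →L[ℝ] E₂ [⋀^Fin k]→L[ℝ] G) :=
      curryLeftLI.toContinuousLinearMap
    let alt : (E₁ →L[ℝ] E₁ [⋀^Fin k]→L[ℝ] G) →L[ℝ] (E₁ [⋀^Fin (k + 1)]→L[ℝ] G) :=
      ((k + 1 : ℕ) : ℝ)⁻¹ • alternatizeUncurryFinCLM ℝ E₁ G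
    have key : (fun A : E₁ →L[ℝ] E₂ =>
        (compContinuousLinearMapCLM A :
          (E₂ [⋀^Fin (k + 1)]→L[ℝ] G) →L[ℝ] (E₁ [⋀^Fin (k + 1)]→L[ℝ] G))) =
        fun A => alt ∘L
          ((ContinuousLinearMap.compL ℝ E₁ (E₂ [⋀^Fin k]→L[ℝ] G) (E₁ [⋀^Fin k]→L[ℝ] G)
            (compContinuousLinearMapCLM A)) ∘L
          ((ContinuousLinearMap.compL ℝ E₁ E₂ (E₂ [⋀^Fin k]→L[ℝ] G)).flip A) ∘L curry) := by
      funext A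
      ext1 β
      have h1 : (β.compContinuousLinearMap A).curryLeft =
          (compContinuousLinearMapCLM A) ∘L (β.curryLeft ∘L A) := by
        ext1 x
        exact curryLeft_compContinuousLinearMap β A x
      change β.compContinuousLinearMap A = ((k + 1 : ℕ) : ℝ)⁻¹ • alternatizeUncurryFin
        ((compContinuousLinearMapCLM A) ∘L (β.curryLeft ∘L A))
      rw [← h1, alternatizeUncurryFin_curryLeft, ← Nat.cast_smul_eq_nsmul ℝ, smul_smul,
        inv_mul_cancel₀ (by positivity), one_smul]
    rw [key]
    exact contDiff_comp_compL_comp_flip curry alt ih contDiff_id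

theorem _root_.ContDiffAt.compContinuousLinearMap {D E₁ E₂ G : Type*} [NormedAddCommGroup D]
    [NormedSpace ℝ D] [NormedAddCommGroup E₁]
    [NormedSpace ℝ E₁] [NormedAddCommGroup E₂] [NormedSpace ℝ E₂] [NormedAddCommGroup G]
    [NormedSpace ℝ G] {m : WithTop ℕ∞} {k : ℕ} {β : D → E₂ [⋀^Fin k]→L[ℝ] G}
    {A : D → E₁ →L[ℝ] E₂} {y : D} (hβ : ContDiffAt ℝ m β y) (hA : ContDiffAt ℝ m A y) :
    ContDiffAt ℝ m (fun z => (β z).compContinuousLinearMap (A z)) y :=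
  ContDiffAt.clm_apply
    ((contDiff_compContinuousLinearMapCLM (G := G) k).contDiffAt.comp y hA) hβ

variable {E : Type v} [NormedAddCommGroup E] [NormedSpace ℝ E] [FiniteDimensional ℝ E]

/-- The partial derivative is bounded on the compact product of a small closed ball with [0, 1], so
differentiation under the integral is dominated by a constant. -/
theorem hasFDerivAt_integral_of_continuousOn {G : Type*} [NormedAddCommGroup G]
    [NormedSpace ℝ G] {F : E → ℝ → G} {F' : E → ℝ → E →L[ℝ] G} {S : Set E} (hS : IsOpen S)
    (hF : ContinuousOn (Function.uncurry F) (S ×ˢ Set.Icc 0 1))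
    (hF' : ContinuousOn (Function.uncurry F') (S ×ˢ Set.Icc 0 1))
    (hd : ∀ x ∈ S, ∀ t ∈ Set.Icc (0 : ℝ) 1, HasFDerivAt (fun y => F y t) (F' x t) x)
    {x : E} (hx : x ∈ S) :
    HasFDerivAt (fun y => ∫ t in (0 : ℝ)..1, F y t) (∫ t in (0 : ℝ)..1, F' x t) x := by
  have : ProperSpace E := FiniteDimensional.proper ℝ E
  have hsub : Set.uIoc (0 : ℝ) 1 ⊆ Set.Icc 0 1 := by
    rw [Set.uIoc_of_le zero_le_one]; exact Set.Ioc_subset_Icc_self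
  have slice : ∀ y ∈ S, ContinuousOn (F y) (Set.Icc 0 1) := fun y hy =>
    hF.comp (f := fun t : ℝ => (y, t)) (by fun_prop) fun t (ht : t ∈ Set.Icc 0 1) => Set.mk_mem_prod hy ht
  have slice' : ∀ y ∈ S, ContinuousOn (F' y) (Set.Icc 0 1) := fun y hy =>
    hF'.comp (f := fun t : ℝ => (y, t)) (by fun_prop) fun t (ht : t ∈ Set.Icc 0 1) => Set.mk_mem_prod hy ht
  obtain ⟨r, hr, hrS⟩ := Metric.nhds_basis_closedBall.mem_iff.1 (hS.mem_nhds hx)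
  obtain ⟨C, hC⟩ := ((isCompact_closedBall x r).prod isCompact_Icc).exists_bound_of_continuousOn
    (hF'.mono (Set.prod_mono hrS le_rfl))
  refine intervalIntegral.hasFDerivAt_integral_of_dominated_of_fderiv_le (bound := fun _ => C)
    (Metric.closedBall_mem_nhds x hr) ?_ ?_ ?_ ?_ ?_ ?_
  · filter_upwards [hS.mem_nhds hx] with y hy
    exact ((slice y hy).mono hsub).aestronglyMeasurable measurableSet_uIoc
  · refine ContinuousOn.intervalIntegrable ?_
    rw [Set.uIcc_of_le zero_le_one]
    exact slice x hx
  · exact ((slice' x hx).mono hsub).aestronglyMeasurable measurableSet_uIoc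
  · exact Filter.Eventually.of_forall fun t ht y hy => hC (y, t) ⟨hy, hsub ht⟩
  · simp
  · exact Filter.Eventually.of_forall fun t ht y hy => hd y (hrS hy) t (hsub ht)

/-- The derivative of the integral is the integral of the partial derivative, which is one order
less smooth, so induction on `m` applies. The target changes to `E →L[ℝ] G` at each step; hence `G`
is quantified inside the induction and lives in the universe of `E`. -/
theorem contDiffOn_integral_nat {W : Set (E × ℝ)} (hW : IsOpen W) {S : Set E} (hS : IsOpen S)
    (hSW : S ×ˢ Set.Icc (0 : ℝ) 1 ⊆ W) (m : ℕ) :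
    ∀ {G : Type v} [NormedAddCommGroup G] [NormedSpace ℝ G] {F : E → ℝ → G},
      ContDiffOn ℝ m (Function.uncurry F) W →
      ContDiffOn ℝ m (fun y => ∫ t in (0 : ℝ)..1, F y t) S := by
  induction m with
  | zero =>
    intro G _ _ F hF
    have : ProperSpace E := FiniteDimensional.proper ℝ E
    simp only [Nat.cast_zero, contDiffOn_zero] at hF ⊢
    have hF1 := hF.mono hSW
    intro x hx
    apply ContinuousAt.continuousWithinAt
    obtain ⟨r, hr, hrS⟩ := Metric.nhds_basis_closedBall.mem_iff.1 (hS.mem_nhds hx)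
    obtain ⟨C, hC⟩ := ((isCompact_closedBall x r).prod isCompact_Icc).exists_bound_of_continuousOn
      (hF1.mono (Set.prod_mono hrS le_rfl))
    have hsub : Set.uIoc (0 : ℝ) 1 ⊆ Set.Icc 0 1 := by
      rw [Set.uIoc_of_le zero_le_one]; exact Set.Ioc_subset_Icc_self
    refine intervalIntegral.continuousAt_of_dominated_interval (bound := fun _ => C) ?_ ?_ ?_ ?_
    · filter_upwards [hS.mem_nhds hx] with y hy
      refine (ContinuousOn.mono ?_ hsub).aestronglyMeasurable measurableSet_uIoc
      exact hF1.comp (f := fun t : ℝ => (y, t)) (by fun_prop) fun t (ht : t ∈ Set.Icc 0 1) => Set.mk_mem_prod hy ht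
    · filter_upwards [Metric.closedBall_mem_nhds x hr] with y hy
      exact Filter.Eventually.of_forall fun t ht => hC (y, t) ⟨hy, hsub ht⟩
    · simp
    · refine Filter.Eventually.of_forall fun t ht => ?_
      exact ContinuousAt.comp (f := fun y : E => (y, t))
        (hF.continuousAt (hW.mem_nhds (hSW ⟨hx, hsub ht⟩))) (by fun_prop)
  | succ m ih =>
    intro G _ _ F hF
    have hF0 : ContinuousOn (Function.uncurry F) W := hF.continuousOn
    rw [Nat.cast_add, Nat.cast_one, contDiffOn_succ_iff_fderiv_of_isOpen hW] at hF
    let F' : E → ℝ → E →L[ℝ] G := fun y t =>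
      fderiv ℝ (Function.uncurry F) (y, t) ∘L ContinuousLinearMap.inl ℝ E ℝ
    have hF' : ContDiffOn ℝ m (Function.uncurry F') W := hF.2.2.clm_comp contDiffOn_const
    have hd : ∀ x ∈ S, HasFDerivAt (fun y => ∫ t in (0 : ℝ)..1, F y t)
        (∫ t in (0 : ℝ)..1, F' x t) x := fun x hx =>
      hasFDerivAt_integral_of_continuousOn hS (hF0.mono hSW) (hF'.continuousOn.mono hSW)
        (fun y hy t ht => by
          have h1 := (hF.1.differentiableAt (hW.mem_nhds
            (hSW (show (y, t) ∈ S ×ˢ Set.Icc (0 : ℝ) 1 from ⟨hy, ht⟩)))).hasFDerivAt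
          exact h1.comp (f := fun y => (y, t)) y ((hasFDerivAt_id y).prodMk (hasFDerivAt_const t y))) hx
    rw [Nat.cast_add, Nat.cast_one, contDiffOn_succ_iff_fderiv_of_isOpen hS]
    refine ⟨fun x hx => (hd x hx).differentiableAt.differentiableWithinAt, by simp, ?_⟩
    exact (ih hF').congr fun x hx => (hd x hx).fderiv

/-- A parametric integral of a smooth function is smooth. -/
theorem contDiffOn_integral {G : Type v} [NormedAddCommGroup G] [NormedSpace ℝ G]
    {W : Set (E × ℝ)} (hW : IsOpen W) {S : Set E} (hS : IsOpen S)
    (hSW : S ×ˢ Set.Icc (0 : ℝ) 1 ⊆ W) {F : E → ℝ → G}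
    (hF : ContDiffOn ℝ ∞ (Function.uncurry F) W) :
    ContDiffOn ℝ ∞ (fun y => ∫ t in (0 : ℝ)..1, F y t) S := by
  rw [contDiffOn_infty] at hF ⊢
  exact fun m => contDiffOn_integral_nat hW hS hSW m (hF m)

end Calculus

/-! ### The Poincaré lemma -/

section Poincare

open ContinuousAlternatingMap

variable {E : Type v} [NormedAddCommGroup E] [NormedSpace ℝ E]

/-- Evaluate the alternatization of `T` on (x, v): the first term is `T x v`, and the others sum to
minus the alternatization of `T` with `x` in the first slot of its values. For `T` the derivative of
a closed form Ω this is Cartan's formula d(ι_x Ω) = D_x Ω for a constant vector `x`. -/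
theorem alternatizeUncurryFin_flip_of_eq_zero {k : ℕ} {G : Type*} [NormedAddCommGroup G]
    [NormedSpace ℝ G] {T : E →L[ℝ] E [⋀^Fin (k + 1)]→L[ℝ] G} (hT : alternatizeUncurryFin T = 0)
    (x : E) :
    alternatizeUncurryFin (((curryLeftLI.toContinuousLinearMap :
      (E [⋀^Fin (k + 1)]→L[ℝ] G) →L[ℝ] _) ∘L T).flip x) = T x := by
  ext v
  have h : alternatizeUncurryFin T (Matrix.vecCons x v) = 0 := by rw [hT]; rfl
  rw [alternatizeUncurryFin_apply, Fin.sum_univ_succ] at h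
  have h0 : Fin.removeNth 0 (Matrix.vecCons x v) = v := by
    funext i; simp [Fin.removeNth]
  have h1 : ∀ i : Fin (k + 1), Fin.removeNth i.succ (Matrix.vecCons x v) =
      Matrix.vecCons x (Fin.removeNth i v) := by
    intro i
    funext j
    refine Fin.cases ?_ (fun j => ?_) j <;> simp [Fin.removeNth]
  rw [h0] at h
  rw [alternatizeUncurryFin_apply]
  simp only [h1, Matrix.cons_val_succ, Fin.val_zero, pow_zero, one_smul, Matrix.cons_val_zero,
    Fin.val_succ, pow_succ, mul_neg, mul_one, neg_smul, Finset.sum_neg_distrib] at h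
  rw [add_neg_eq_zero] at h
  exact h.symm

/-- The Poincaré lemma for 1-forms: on a convex open set, every closed smooth 1-form is the
differential of a smooth function. -/
theorem exists_fderiv_eq_of_convex {G : Type*} [NormedAddCommGroup G] [NormedSpace ℝ G]
    [CompleteSpace G] {C : Set E} (hC : IsOpen C) (hconv : Convex ℝ C)
    {β : E → E [⋀^Fin 1]→L[ℝ] G} (hβ : ContDiffOn ℝ ∞ β C)
    (hclosed : ∀ y ∈ C, extDeriv β y = 0) :
    ∃ f : E → G, ContDiffOn ℝ ∞ f C ∧ ∀ y ∈ C, ∀ v, fderiv ℝ f y v = β y fun _ => v := by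
  let e := (ofSubsingletonLIE (𝕜 := ℝ) (E := E) (F := G) (0 : Fin 1)).symm
  let θ : E → E →L[ℝ] G := fun y => e (β y)
  have hθa : ∀ y v, θ y v = β y fun _ => v := fun y v => rfl
  have hθ : ContDiffOn ℝ ∞ θ C := e.contDiff.comp_contDiffOn hβ
  have hd : DifferentiableOn ℝ θ C := hθ.differentiableOn (by simp)
  -- Evaluated on `![u, v]`, closedness says exactly that the derivative of the covector field `θ`
  -- is symmetric, which is the integrability condition on a convex set.
  obtain ⟨f, hf⟩ := hconv.exists_forall_hasFDerivAt_of_fderiv_symmetric hC hd (by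
    intro y hy u v
    have hβd : DifferentiableAt ℝ β y := (hβ.contDiffAt (hC.mem_nhds hy)).differentiableAt (by simp)
    have h1 : ∀ u v, fderiv ℝ θ y u v = fderiv ℝ β y u fun _ => v := by
      intro u v
      have : fderiv ℝ θ y = (e : (E [⋀^Fin 1]→L[ℝ] G) →L[ℝ] (E →L[ℝ] G)) ∘L fderiv ℝ β y :=
        (((e : (E [⋀^Fin 1]→L[ℝ] G) →L[ℝ] (E →L[ℝ] G)).hasFDerivAt).comp y
          hβd.hasFDerivAt).fderiv
      rw [this]
      rfl
    have h2 : extDeriv β y ![u, v] = 0 := by rw [hclosed y hy]; rfl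
    rw [extDeriv, alternatizeUncurryFin_apply, Fin.sum_univ_two] at h2
    have e0 : Fin.removeNth 0 ![u, v] = fun _ => v := by
      funext i; fin_cases i; rfl
    have e1 : Fin.removeNth 1 ![u, v] = fun _ => u := by
      funext i; fin_cases i; rfl
    rw [e0, e1] at h2
    rw [h1, h1]
    simpa [add_neg_eq_zero] using h2)
  refine ⟨f, ?_, fun y hy v => by rw [(hf y hy).fderiv]; rfl⟩
  rw [contDiffOn_infty_iff_fderiv_of_isOpen hC]
  exact ⟨fun y hy => (hf y hy).differentiableAt.differentiableWithinAt,
    hθ.congr fun y hy => (hf y hy).fderiv⟩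

variable [FiniteDimensional ℝ E]

/-- The homotopy operator of the Poincaré lemma, for an abstract exterior derivative
`α ↦ alt (Dα)` and an abstract contraction `curry`. -/
theorem exists_alternatization_eq_of_convex {k : ℕ} {X : Type*} {Y : Type v}
    [NormedAddCommGroup X] [NormedSpace ℝ X] [CompleteSpace X] [NormedAddCommGroup Y]
    [NormedSpace ℝ Y] [CompleteSpace Y] (curry : X →L[ℝ] E →L[ℝ] Y) (alt : (E →L[ℝ] Y) →L[ℝ] X)
    (halt : ∀ x, alt (curry x) = ((k + 1 : ℕ) : ℝ) • x)
    {C : Set E} (hC : IsOpen C) (hconv : Convex ℝ C) {Ω : E → X} (hΩ : ContDiffOn ℝ ∞ Ω C)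
    (hclosed : ∀ y ∈ C, ∀ v, alt ((curry ∘L fderiv ℝ Ω y).flip v) = fderiv ℝ Ω y v) :
    ∃ α : E → Y, ContDiffOn ℝ ∞ α C ∧ ∀ y ∈ C, alt (fderiv ℝ α y) = Ω y := by
  rcases C.eq_empty_or_nonempty with rfl | ⟨a, ha⟩
  · exact ⟨0, contDiffOn_empty, by simp⟩
  let z : E → ℝ → E := fun y t => a + t • (y - a)
  have hz : ContDiff ℝ ∞ (Function.uncurry z) := by
    change ContDiff ℝ ∞ fun q : E × ℝ => a + q.2 • (q.1 - a)
    fun_prop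
  let W : Set (E × ℝ) := Function.uncurry z ⁻¹' C
  have hW : IsOpen W := hC.preimage hz.continuous
  have hCW : C ×ˢ Set.Icc (0 : ℝ) 1 ⊆ W := by
    rintro ⟨y, t⟩ ⟨hy, ht⟩
    exact hconv.add_smul_sub_mem ha hy ht
  -- The integrand of the homotopy operator: contract Ω with y − a at the point `z y t` of the
  -- segment from `a` to `y`. The factor `t ^ k` comes from pulling back the remaining k arguments
  -- along the contraction towards `a`.
  let F : E → ℝ → Y := fun y t => t ^ k • curry (Ω (z y t)) (y - a)
  have hΩz : ContDiffOn ℝ ∞ (fun q : E × ℝ => Ω (Function.uncurry z q)) W :=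
    hΩ.comp hz.contDiffOn fun q hq => hq
  have hF : ContDiffOn ℝ ∞ (Function.uncurry F) W := by
    change ContDiffOn ℝ ∞ (fun q : E × ℝ =>
      q.2 ^ k • curry (Ω (Function.uncurry z q)) (q.1 - a)) W
    have h1 : ContDiff ℝ ∞ fun q : E × ℝ => q.2 ^ k := by fun_prop
    have h2 : ContDiff ℝ ∞ fun q : E × ℝ => q.1 - a := by fun_prop
    exact h1.contDiffOn.smul ((curry.contDiff.comp_contDiffOn hΩz).clm_apply h2.contDiffOn)
  let F' : E → ℝ → E →L[ℝ] Y := fun y t =>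
    fderiv ℝ (Function.uncurry F) (y, t) ∘L ContinuousLinearMap.inl ℝ E ℝ
  have hF'c : ContinuousOn (Function.uncurry F') W :=
    (hF.continuousOn_fderiv_of_isOpen hW (by simp)).clm_comp continuousOn_const
  have hFd : ∀ y ∈ C, ∀ t ∈ Set.Icc (0 : ℝ) 1, HasFDerivAt (fun y => F y t) (F' y t) y := by
    intro y hy t ht
    have h1 := (hF.contDiffAt (hW.mem_nhds (hCW
      (show (y, t) ∈ C ×ˢ Set.Icc (0 : ℝ) 1 from ⟨hy, ht⟩)))).differentiableAt (by simp)
    exact h1.hasFDerivAt.comp (f := fun y => (y, t)) y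
      ((hasFDerivAt_id y).prodMk (hasFDerivAt_const t y))
  have hα : ∀ y ∈ C, HasFDerivAt (fun y => ∫ t in (0 : ℝ)..1, F y t)
      (∫ t in (0 : ℝ)..1, F' y t) y := fun y hy =>
    hasFDerivAt_integral_of_continuousOn hC (hF.continuousOn.mono hCW) (hF'c.mono hCW) hFd hy
  refine ⟨fun y => ∫ t in (0 : ℝ)..1, F y t, contDiffOn_integral hW hC hCW hF, fun y hy => ?_⟩
  have hzC : ∀ t ∈ Set.Icc (0 : ℝ) 1, z y t ∈ C := fun t ht =>
    hconv.add_smul_sub_mem ha hy ht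
  have hslice : ContinuousOn (F' y) (Set.uIcc 0 1) := by
    rw [Set.uIcc_of_le zero_le_one]
    exact (hF'c.mono hCW).comp (f := fun t : ℝ => (y, t)) (by fun_prop)
      fun t (ht : t ∈ Set.Icc 0 1) => Set.mk_mem_prod hy ht
  -- The abstract exterior derivative of the integrand is a total t-derivative: `halt` produces (k +
  -- 1) t^k Ω and `hclosed` produces t^(k+1) D_{y−a}Ω. The integral over [0, 1] is then Ω(y) − 0.
  have hF'eq : ∀ t ∈ Set.uIcc (0 : ℝ) 1, HasDerivAt (fun t : ℝ => t ^ (k + 1) • Ω (z y t))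
      (alt (F' y t)) t := by
    intro t ht
    rw [Set.uIcc_of_le zero_le_one] at ht
    have hΩd : HasFDerivAt Ω (fderiv ℝ Ω (z y t)) (z y t) :=
      ((hΩ.contDiffAt (hC.mem_nhds (hzC t ht))).differentiableAt (by simp)).hasFDerivAt
    have hzy : HasFDerivAt (fun y => z y t) (t • ContinuousLinearMap.id ℝ E) y :=
      (((hasFDerivAt_id y).sub_const a).const_smul t).const_add a
    -- Product rule in `y`: one term differentiates the vector y − a, the other the point `z y t`,
    -- whose derivative is `t` times the identity.
    have hF2 : F' y t = t ^ k • (curry (Ω (z y t)) +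
        t • (curry ∘L fderiv ℝ Ω (z y t)).flip (y - a)) := by
      refine (hFd y hy t ht).unique ?_
      have h1 : HasFDerivAt (fun y => curry (Ω (z y t)))
          (curry ∘L (fderiv ℝ Ω (z y t) ∘L (t • ContinuousLinearMap.id ℝ E))) y :=
        curry.hasFDerivAt.comp y (hΩd.comp (f := fun y => z y t) y hzy)
      have h2 := (h1.clm_apply ((hasFDerivAt_id y).sub_const a)).const_smul (t ^ k)
      refine h2.congr_fderiv ?_
      ext u
      simp
    have hzt : HasDerivAt (fun t => z y t) (y - a) t := by
      have h0 : HasDerivAt (fun t => z y t) ((1 : ℝ) • (y - a)) t :=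
        ((hasDerivAt_id t).smul_const (y - a)).const_add a
      rwa [one_smul] at h0
    have h3 : HasDerivAt (fun t => Ω (z y t)) (fderiv ℝ Ω (z y t) (y - a)) t :=
      hΩd.comp_hasDerivAt t hzt
    have h4 := (hasDerivAt_pow (k + 1) t).smul h3
    have h5 : alt (F' y t) = t ^ (k + 1) • fderiv ℝ Ω (z y t) (y - a) +
        (((k + 1 : ℕ) : ℝ) * t ^ (k + 1 - 1)) • Ω (z y t) := by
      rw [hF2, map_smul, map_add, map_smul, halt, hclosed _ (hzC t ht), smul_add, smul_smul,
        smul_smul, ← pow_succ, add_comm, mul_comm (t ^ k)]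
      simp
    rw [h5]
    exact h4
  rw [(hα y hy).fderiv, ← alt.intervalIntegral_comp_comm hslice.intervalIntegrable,
    intervalIntegral.integral_eq_sub_of_hasDerivAt hF'eq]
  · simp [z]
  · exact (alt.continuous.comp_continuousOn hslice).intervalIntegrable

/-- The Poincaré lemma: on a convex open set, every closed smooth form of positive degree is the
exterior derivative of a smooth form. -/
theorem exists_extDeriv_eq_of_convex {k : ℕ} {C : Set E} (hC : IsOpen C) (hconv : Convex ℝ C)
    {Ω : E → E [⋀^Fin (k + 1)]→L[ℝ] ℝ} (hΩ : ContDiffOn ℝ ∞ Ω C)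
    (hclosed : ∀ y ∈ C, extDeriv Ω y = 0) :
    ∃ α : E → E [⋀^Fin k]→L[ℝ] ℝ, ContDiffOn ℝ ∞ α C ∧ ∀ y ∈ C, extDeriv α y = Ω y := by
  have h1 : ∀ x : E [⋀^Fin (k + 1)]→L[ℝ] ℝ, alternatizeUncurryFinCLM ℝ E ℝ
      ((curryLeftLI.toContinuousLinearMap :
        (E [⋀^Fin (k + 1)]→L[ℝ] ℝ) →L[ℝ] _) x) = ((k + 1 : ℕ) : ℝ) • x := fun x =>
    (alternatizeUncurryFin_curryLeft x).trans (Nat.cast_smul_eq_nsmul ℝ _ _).symm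
  have h2 : ∀ y ∈ C, ∀ v, alternatizeUncurryFinCLM ℝ E ℝ
      (((curryLeftLI.toContinuousLinearMap :
        (E [⋀^Fin (k + 1)]→L[ℝ] ℝ) →L[ℝ] _) ∘L fderiv ℝ Ω y).flip v) = fderiv ℝ Ω y v :=
    fun y hy v => alternatizeUncurryFin_flip_of_eq_zero (hclosed y hy) v
  exact exists_alternatization_eq_of_convex (k := k) _ (alternatizeUncurryFinCLM ℝ E ℝ) h1
    hC hconv hΩ h2

end Poincare

/-! ### Expressions of differential forms in different charts -/

section Manifold

variable {E : Type v} [NormedAddCommGroup E] [NormedSpace ℝ E]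
  {M : Type u} [TopologicalSpace M] [ChartedSpace E M]
  {F : Type w} [NormedAddCommGroup F] [NormedSpace ℝ F] {k : ℕ}

theorem contMDiffAt_extChartAt_symm [IsManifold 𝓘(ℝ, E) ∞ M] {x₀ : M} {y : E}
    (hy : y ∈ (extChartAt 𝓘(ℝ, E) x₀).target) :
    ContMDiffAt 𝓘(ℝ, E) 𝓘(ℝ, E) ∞ (extChartAt 𝓘(ℝ, E) x₀).symm y :=
  (contMDiffOn_extChartAt_symm x₀).contMDiffAt ((isOpen_extChartAt_target x₀).mem_nhds hy)

theorem contMDiffAt_extChartAt_of_mem [IsManifold 𝓘(ℝ, E) ∞ M] {x₀ p : M}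
    (hp : p ∈ (extChartAt 𝓘(ℝ, E) x₀).source) :
    ContMDiffAt 𝓘(ℝ, E) 𝓘(ℝ, E) ∞ (extChartAt 𝓘(ℝ, E) x₀) p :=
  contMDiffAt_extChartAt' (by rwa [← extChartAt_source 𝓘(ℝ, E)])

theorem mfderiv_extChartAt_comp_symm [IsManifold 𝓘(ℝ, E) ∞ M] {x₀ : M} {y : E}
    (hy : y ∈ (extChartAt 𝓘(ℝ, E) x₀).target) (v : E) :
    mfderiv 𝓘(ℝ, E) 𝓘(ℝ, E) (extChartAt 𝓘(ℝ, E) x₀) ((extChartAt 𝓘(ℝ, E) x₀).symm y)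
      (mfderiv 𝓘(ℝ, E) 𝓘(ℝ, E) (extChartAt 𝓘(ℝ, E) x₀).symm y v) = v := by
  have h := mfderiv_extChartAt_comp_mfderivWithin_extChartAt_symm (I := 𝓘(ℝ, E)) hy
  simp only [modelWithCornersSelf_coe, Set.range_id, mfderivWithin_univ] at h
  exact DFunLike.congr_fun h v

theorem mfderiv_extChartAt_comp_symm_of_mem [IsManifold 𝓘(ℝ, E) ∞ M] {x₀ p : M}
    (hp : p ∈ (extChartAt 𝓘(ℝ, E) x₀).source) (v : E) :
    mfderiv 𝓘(ℝ, E) 𝓘(ℝ, E) (extChartAt 𝓘(ℝ, E) x₀) p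
      (mfderiv 𝓘(ℝ, E) 𝓘(ℝ, E) (extChartAt 𝓘(ℝ, E) x₀).symm (extChartAt 𝓘(ℝ, E) x₀ p) v) = v := by
  have h := mfderiv_extChartAt_comp_mfderivWithin_extChartAt_symm' (I := 𝓘(ℝ, E)) hp
  simp only [modelWithCornersSelf_coe, Set.range_id, mfderivWithin_univ] at h
  exact DFunLike.congr_fun h v

theorem mfderiv_symm_comp_extChartAt [IsManifold 𝓘(ℝ, E) ∞ M] {x₀ p : M}
    (hp : p ∈ (extChartAt 𝓘(ℝ, E) x₀).source) (v : TangentSpace 𝓘(ℝ, E) p) :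
    mfderiv 𝓘(ℝ, E) 𝓘(ℝ, E) (extChartAt 𝓘(ℝ, E) x₀).symm (extChartAt 𝓘(ℝ, E) x₀ p)
      (mfderiv 𝓘(ℝ, E) 𝓘(ℝ, E) (extChartAt 𝓘(ℝ, E) x₀) p v) = v := by
  have h := mfderivWithin_extChartAt_symm_comp_mfderiv_extChartAt' (I := 𝓘(ℝ, E)) hp
  simp only [modelWithCornersSelf_coe, Set.range_id, mfderivWithin_univ] at h
  exact DFunLike.congr_fun h v

namespace Form

theorem inChart_apply (α : Form E M F k) (x₀ : M) (y : E) (v : Fin k → E) :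
    α.inChart x₀ y v = α ((extChartAt 𝓘(ℝ, E) x₀).symm y) (fun i =>
      mfderiv 𝓘(ℝ, E) 𝓘(ℝ, E) (extChartAt 𝓘(ℝ, E) x₀).symm y (v i)) := rfl

/-- All tangent spaces are `E` by definition, so values at equal points can be taken on the same
vectors. This takes the place of transport along `p = q` when a chart is composed with its inverse.
-/
theorem eq_of_point_eq (α : Form E M F k) {p q : M} (h : p = q) (v : Fin k → E) :
    (α p : E [⋀^Fin k]→L[ℝ] F) v = (α q : E [⋀^Fin k]→L[ℝ] F) v := by
  subst h; rfl

theorem SmoothAt.sub {α η : Form E M F k} {x : M} (hα : α.SmoothAt x) (hη : η.SmoothAt x) :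
    (α - η).SmoothAt x := ContDiffAt.sub hα hη

theorem d_sub {α η : Form E M F k} {x : M} (hα : α.SmoothAt x) (hη : η.SmoothAt x) :
    (α - η).d x = α.d x - η.d x := by
  have h := d_add (α := α) (η := (-1 : ℝ) • η) hα (hη.smul _)
  rw [d_smul] at h
  have e : α - η = α + (-1 : ℝ) • η := by rw [neg_one_smul, sub_eq_add_neg]
  rw [e, h, neg_one_smul, sub_eq_add_neg]

/-- The composition of the values of a form with a linear map. -/
def postcomp {F' : Type*} [NormedAddCommGroup F'] [NormedSpace ℝ F'] (L : F →L[ℝ] F')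
    (α : Form E M F k) : Form E M F' k := fun x => L.compContinuousAlternatingMap (α x)

section Postcomp

variable {F' : Type*} [NormedAddCommGroup F'] [NormedSpace ℝ F'] (L : F →L[ℝ] F')

theorem SmoothAt.postcomp {α : Form E M F k} {x : M} (hα : α.SmoothAt x) :
    (postcomp L α).SmoothAt x :=
  (ContinuousLinearMap.contDiff
    (ContinuousLinearMap.compContinuousAlternatingMapCLM ℝ E F F' (Fin k) L)).contDiffAt.comp _ hα

/-- A fixed linear map of the values commutes with differentiation and with alternating sums. It is
applied to the inclusion of ℝ in ℂ and to the real part. -/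
theorem d_postcomp {α : Form E M F k} {x : M} (hα : α.SmoothAt x) :
    (Form.postcomp L α).d x = L.compContinuousAlternatingMap (α.d x) := by
  unfold d
  ext v
  have h := hα.differentiableAt
  have h' : fderiv ℝ ((Form.postcomp L α).inChart x) (extChartAt 𝓘(ℝ, E) x x) =
      (ContinuousLinearMap.compContinuousAlternatingMapCLM ℝ E F F' (Fin k) L).comp
        (fderiv ℝ (α.inChart x) (extChartAt 𝓘(ℝ, E) x x)) :=
    ((ContinuousLinearMap.hasFDerivAt
      (ContinuousLinearMap.compContinuousAlternatingMapCLM ℝ E F F' (Fin k) L)).comp _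
        h.hasFDerivAt).fderiv
  change extDeriv _ _ _ = L (extDeriv _ _ _)
  rw [extDeriv, extDeriv, h', ContinuousAlternatingMap.alternatizeUncurryFin_apply,
    ContinuousAlternatingMap.alternatizeUncurryFin_apply, map_sum]
  refine Finset.sum_congr rfl fun i _ => ?_
  rw [map_zsmul]
  rfl

end Postcomp

variable [IsManifold 𝓘(ℝ, E) ∞ M]

/-- A form is recovered from its expression in a chart. -/
theorem apply_eq_inChart (α : Form E M F k) {x₀ p : M} (hp : p ∈ (extChartAt 𝓘(ℝ, E) x₀).source)
    (v : Fin k → TangentSpace 𝓘(ℝ, E) p) :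
    α p v = α.inChart x₀ (extChartAt 𝓘(ℝ, E) x₀ p) (fun i =>
      mfderiv 𝓘(ℝ, E) 𝓘(ℝ, E) (extChartAt 𝓘(ℝ, E) x₀) p (v i)) := by
  refine Eq.trans ?_ (eq_of_point_eq α ((extChartAt 𝓘(ℝ, E) x₀).left_inv hp).symm _)
  refine congrArg (α p) (funext fun i => ?_)
  exact (mfderiv_symm_comp_extChartAt hp (v i)).symm

/-- The expression of a form in a chart determines the form. -/
theorem eq_of_inChart_eq {α η : Form E M F k} {x₀ p : M}
    (hp : p ∈ (extChartAt 𝓘(ℝ, E) x₀).source)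
    (h : α.inChart x₀ (extChartAt 𝓘(ℝ, E) x₀ p) = η.inChart x₀ (extChartAt 𝓘(ℝ, E) x₀ p)) :
    α p = η p := by
  ext v
  rw [apply_eq_inChart α hp, apply_eq_inChart η hp, h]

/-- The transition map between two preferred charts. -/
def transition (x₀ x₁ : M) : E → E :=
  extChartAt 𝓘(ℝ, E) x₁ ∘ (extChartAt 𝓘(ℝ, E) x₀).symm

theorem contDiffAt_transition {x₀ x₁ : M} {y : E} (hy : y ∈ (extChartAt 𝓘(ℝ, E) x₀).target)
    (hy' : (extChartAt 𝓘(ℝ, E) x₀).symm y ∈ (extChartAt 𝓘(ℝ, E) x₁).source) :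
    ContDiffAt ℝ ∞ (transition (E := E) x₀ x₁) y :=
  contMDiffAt_iff_contDiffAt.1
    ((contMDiffAt_extChartAt_of_mem hy').comp y (contMDiffAt_extChartAt_symm hy))

theorem eventually_mem_source {x₀ x₁ : M} {y : E} (hy : y ∈ (extChartAt 𝓘(ℝ, E) x₀).target)
    (hy' : (extChartAt 𝓘(ℝ, E) x₀).symm y ∈ (extChartAt 𝓘(ℝ, E) x₁).source) :
    ∀ᶠ z in nhds y, z ∈ (extChartAt 𝓘(ℝ, E) x₀).target ∧
      (extChartAt 𝓘(ℝ, E) x₀).symm z ∈ (extChartAt 𝓘(ℝ, E) x₁).source :=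
  Filter.inter_mem ((isOpen_extChartAt_target x₀).mem_nhds hy)
    ((contMDiffAt_extChartAt_symm hy).continuousAt.preimage_mem_nhds
      ((isOpen_extChartAt_source x₁).mem_nhds hy'))

/-- Near `y` the inverse chart at `x₀` is the inverse chart at `x₁` composed with the transition
map, and the chain rule applies. -/
theorem mfderiv_symm_eq {x₀ x₁ : M} {y : E} (hy : y ∈ (extChartAt 𝓘(ℝ, E) x₀).target)
    (hy' : (extChartAt 𝓘(ℝ, E) x₀).symm y ∈ (extChartAt 𝓘(ℝ, E) x₁).source) (v : E) :
    mfderiv 𝓘(ℝ, E) 𝓘(ℝ, E) (extChartAt 𝓘(ℝ, E) x₀).symm y v =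
      mfderiv 𝓘(ℝ, E) 𝓘(ℝ, E) (extChartAt 𝓘(ℝ, E) x₁).symm (transition x₀ x₁ y)
        (fderiv ℝ (transition x₀ x₁) y v) := by
  have h1 : (extChartAt 𝓘(ℝ, E) x₀).symm =ᶠ[nhds y]
      (extChartAt 𝓘(ℝ, E) x₁).symm ∘ transition x₀ x₁ := by
    filter_upwards [eventually_mem_source hy hy'] with z hz
    exact ((extChartAt 𝓘(ℝ, E) x₁).left_inv hz.2).symm
  have hτ : MDifferentiableAt 𝓘(ℝ, E) 𝓘(ℝ, E) (transition (E := E) x₀ x₁) y :=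
    ((contDiffAt_transition hy hy').differentiableAt (by simp)).mdifferentiableAt
  have h2 := mfderiv_comp (I' := 𝓘(ℝ, E)) y
    ((contMDiffAt_extChartAt_symm
      ((extChartAt 𝓘(ℝ, E) x₁).map_source hy')).mdifferentiableAt (by simp)) hτ
  rw [h1.mfderiv_eq, ← mfderiv_eq_fderiv]
  exact DFunLike.congr_fun h2 v

/-- The expressions of a form in two charts are related by pull-back under the transition map. -/
theorem inChart_eq_pullback (α : Form E M F k) {x₀ x₁ : M} {y : E}
    (hy : y ∈ (extChartAt 𝓘(ℝ, E) x₀).target)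
    (hy' : (extChartAt 𝓘(ℝ, E) x₀).symm y ∈ (extChartAt 𝓘(ℝ, E) x₁).source) :
    α.inChart x₀ y = (α.inChart x₁ (transition x₀ x₁ y)).compContinuousLinearMap
      (fderiv ℝ (transition x₀ x₁) y) := by
  ext v
  rw [inChart_apply, ContinuousAlternatingMap.compContinuousLinearMap_apply, inChart_apply]
  refine Eq.trans ?_ (eq_of_point_eq α ((extChartAt 𝓘(ℝ, E) x₁).left_inv hy').symm _)
  exact congrArg (α _) (funext fun i => mfderiv_symm_eq hy hy' (v i))

theorem eventually_inChart_eq_pullback (α : Form E M F k) {x₀ x₁ : M} {y : E}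
    (hy : y ∈ (extChartAt 𝓘(ℝ, E) x₀).target)
    (hy' : (extChartAt 𝓘(ℝ, E) x₀).symm y ∈ (extChartAt 𝓘(ℝ, E) x₁).source) :
    α.inChart x₀ =ᶠ[nhds y] fun z =>
      (α.inChart x₁ (transition x₀ x₁ z)).compContinuousLinearMap
        (fderiv ℝ (transition x₀ x₁) z) := by
  filter_upwards [eventually_mem_source hy hy'] with z hz
  exact inChart_eq_pullback α hz.1 hz.2

theorem contDiffAt_inChart_change {α : Form E M F k} {x₀ x₁ : M} {y : E}
    (hy : y ∈ (extChartAt 𝓘(ℝ, E) x₀).target)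
    (hy' : (extChartAt 𝓘(ℝ, E) x₀).symm y ∈ (extChartAt 𝓘(ℝ, E) x₁).source)
    (h : ContDiffAt ℝ ∞ (α.inChart x₁) (transition x₀ x₁ y)) :
    ContDiffAt ℝ ∞ (α.inChart x₀) y := by
  refine ContDiffAt.congr_of_eventuallyEq ?_ (eventually_inChart_eq_pullback α hy hy')
  have hτ := contDiffAt_transition hy hy'
  exact ContDiffAt.compContinuousLinearMap (h.comp y hτ) (hτ.fderiv_right (by simp))

/-- Smoothness of a form may be tested in any chart. -/
theorem smoothAt_iff {α : Form E M F k} {x₀ p : M} (hp : p ∈ (extChartAt 𝓘(ℝ, E) x₀).source) :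
    α.SmoothAt p ↔ ContDiffAt ℝ ∞ (α.inChart x₀) (extChartAt 𝓘(ℝ, E) x₀ p) := by
  have hp' := mem_extChartAt_source (I := 𝓘(ℝ, E)) p
  have l0 := (extChartAt 𝓘(ℝ, E) x₀).left_inv hp
  have l1 := (extChartAt 𝓘(ℝ, E) p).left_inv hp'
  constructor
  · intro h
    refine contDiffAt_inChart_change (x₁ := p) ((extChartAt 𝓘(ℝ, E) x₀).map_source hp)
      (by rwa [l0]) ?_
    have e : transition (E := E) x₀ p (extChartAt 𝓘(ℝ, E) x₀ p) = extChartAt 𝓘(ℝ, E) p p := by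
      simp only [transition, Function.comp, l0]
    rw [e]
    exact h
  · intro h
    refine contDiffAt_inChart_change (x₁ := x₀) ((extChartAt 𝓘(ℝ, E) p).map_source hp')
      (by rwa [l1]) ?_
    simpa only [transition, Function.comp, l1] using h

/-- The exterior derivative may be computed in any chart. -/
theorem d_inChart {α : Form E M F k} {x₀ : M} {y : E} (hy : y ∈ (extChartAt 𝓘(ℝ, E) x₀).target)
    (h : α.SmoothAt ((extChartAt 𝓘(ℝ, E) x₀).symm y)) :
    (d α).inChart x₀ y = extDeriv (α.inChart x₀) y := by
  set p := (extChartAt 𝓘(ℝ, E) x₀).symm y with hp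
  have hp' := mem_extChartAt_source (I := 𝓘(ℝ, E)) p
  have hτ := contDiffAt_transition (x₁ := p) hy hp'
  -- `d` is defined at `p` through the chart at `p` itself. Naturality of the exterior derivative
  -- under the transition from the chart at `x₀` to that chart reduces the claim to a chain rule for
  -- the vectors.
  rw [(eventually_inChart_eq_pullback α hy hp').extDeriv_eq,
    extDeriv_pullback (f := transition x₀ p) (show DifferentiableAt ℝ (α.inChart p)
      (transition x₀ p y) from h.differentiableAt) hτ
      (by simpa using ENat.LEInfty.out)]
  ext v
  have hpy : transition (E := E) x₀ p y = extChartAt 𝓘(ℝ, E) p p := rfl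
  rw [inChart_apply, ContinuousAlternatingMap.compContinuousLinearMap_apply, hpy]
  change extDeriv (α.inChart p) (extChartAt 𝓘(ℝ, E) p p) (fun i =>
    mfderiv 𝓘(ℝ, E) 𝓘(ℝ, E) (extChartAt 𝓘(ℝ, E) p) p
      (mfderiv 𝓘(ℝ, E) 𝓘(ℝ, E) (extChartAt 𝓘(ℝ, E) x₀).symm y (v i))) = _
  congr 1
  funext i
  rw [mfderiv_symm_eq hy hp']
  exact mfderiv_extChartAt_comp_symm_of_mem hp' _

/-- The form on `M` with a given expression in the preferred chart at `x₀`. -/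
def ofChart (x₀ : M) (β : E → E [⋀^Fin k]→L[ℝ] F) : Form E M F k := fun p =>
  (β (extChartAt 𝓘(ℝ, E) x₀ p)).compContinuousLinearMap
    (mfderiv 𝓘(ℝ, E) 𝓘(ℝ, E) (extChartAt 𝓘(ℝ, E) x₀) p)

theorem inChart_ofChart {x₀ : M} {β : E → E [⋀^Fin k]→L[ℝ] F} {y : E}
    (hy : y ∈ (extChartAt 𝓘(ℝ, E) x₀).target) : (ofChart x₀ β).inChart x₀ y = β y := by
  ext v
  rw [inChart_apply]
  change β (extChartAt 𝓘(ℝ, E) x₀ ((extChartAt 𝓘(ℝ, E) x₀).symm y)) (fun i => _) = _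
  rw [(extChartAt 𝓘(ℝ, E) x₀).right_inv hy]
  congr 1
  funext i
  exact mfderiv_extChartAt_comp_symm hy (v i)

end Form

end Manifold

/-! ### Differentials of functions and local exactness on chart-convex sets -/

section Manifold

variable {E : Type v} [NormedAddCommGroup E] [NormedSpace ℝ E]
  {M : Type u} [TopologicalSpace M] [ChartedSpace E M]
  {G : Type w} [NormedAddCommGroup G] [NormedSpace ℝ G]

theorem mvfderiv_comp_apply_mfderiv {E' : Type*} [NormedAddCommGroup E'] [NormedSpace ℝ E']
    {N : Type*} [TopologicalSpace N] [ChartedSpace E' N] {g : M → G} {f : N → M} {x : N}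
    (hg : MDifferentiableAt 𝓘(ℝ, E) 𝓘(ℝ, G) g (f x))
    (hf : MDifferentiableAt 𝓘(ℝ, E') 𝓘(ℝ, E) f x) (v : TangentSpace 𝓘(ℝ, E') x) :
    mvfderiv 𝓘(ℝ, E') (fun y => g (f y)) x v =
      mvfderiv 𝓘(ℝ, E) g (f x) (mfderiv 𝓘(ℝ, E') 𝓘(ℝ, E) f x v) :=
  mfderiv_comp_apply x hg hf v

theorem mvfderiv_comp_hasFDerivAt {G' : Type*} [NormedAddCommGroup G'] [NormedSpace ℝ G']
    {g : M → G} {φ : G → G'} {φ' : G →L[ℝ] G'} {p : M} (hφ : HasFDerivAt φ φ' (g p))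
    (hg : MDifferentiableAt 𝓘(ℝ, E) 𝓘(ℝ, G) g p) (v : TangentSpace 𝓘(ℝ, E) p) :
    mvfderiv 𝓘(ℝ, E) (fun q => φ (g q)) p v = φ' (mvfderiv 𝓘(ℝ, E) g p v) := by
  have h := mfderiv_comp_apply (I' := 𝓘(ℝ, G)) (I'' := 𝓘(ℝ, G')) p
    hφ.differentiableAt.mdifferentiableAt hg v
  rw [mfderiv_eq_fderiv, hφ.fderiv] at h
  exact h

theorem mvfderiv_vectorSpace {f : E → G} {y : E} (v : E) :
    mvfderiv 𝓘(ℝ, E) f y v = fderiv ℝ f y v := by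
  rw [← mfderiv_eq_fderiv]
  rfl

theorem _root_.Filter.EventuallyEq.mvfderiv_eq {f g : M → G} {p : M} (h : f =ᶠ[nhds p] g)
    (v : TangentSpace 𝓘(ℝ, E) p) : mvfderiv 𝓘(ℝ, E) f p v = mvfderiv 𝓘(ℝ, E) g p v := by
  have h1 : mfderiv 𝓘(ℝ, E) 𝓘(ℝ, G) f p = mfderiv 𝓘(ℝ, E) 𝓘(ℝ, G) g p := h.mfderiv_eq
  exact DFunLike.congr_fun h1 v

variable (E) in
/-- The open sets which correspond to convex sets in a chart. -/
def IsChartConvex (B : Opens M) : Prop :=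
  ∃ (x₀ : M) (C : Set E), IsOpen C ∧ Convex ℝ C ∧ C ⊆ (extChartAt 𝓘(ℝ, E) x₀).target ∧
    (B : Set M) = (extChartAt 𝓘(ℝ, E) x₀).source ∩ extChartAt 𝓘(ℝ, E) x₀ ⁻¹' C

theorem exists_isChartConvex (x : M) (O : Opens M) (hx : x ∈ O) :
    ∃ B : Opens M, x ∈ B ∧ B ≤ O ∧ IsChartConvex E B := by
  set φ := extChartAt 𝓘(ℝ, E) x
  have hxs : x ∈ φ.source := mem_extChartAt_source x
  have h1 : φ.target ∩ φ.symm ⁻¹' O ∈ nhds (φ x) := by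
    refine Filter.inter_mem ((isOpen_extChartAt_target x).mem_nhds (φ.map_source hxs)) ?_
    have hc : ContinuousAt φ.symm (φ x) := continuousAt_extChartAt_symm x
    refine hc.preimage_mem_nhds ?_
    rw [φ.left_inv hxs]
    exact O.isOpen.mem_nhds hx
  obtain ⟨r, hr, hB⟩ := Metric.mem_nhds_iff.1 h1
  refine ⟨⟨φ.source ∩ φ ⁻¹' Metric.ball (φ x) r,
    (continuousOn_extChartAt x).isOpen_inter_preimage (isOpen_extChartAt_source x)
      Metric.isOpen_ball⟩, ⟨hxs, Metric.mem_ball_self hr⟩, ?_, x, Metric.ball (φ x) r,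
    Metric.isOpen_ball, convex_ball _ _, fun y hy => (hB hy).1, rfl⟩
  rintro p ⟨hp, hpb⟩
  have := (hB hpb).2
  rwa [Set.mem_preimage, φ.left_inv hp] at this

theorem exists_isChartConvex_cover (U : PointedCover M) :
    ∃ W : PointedCover M, U ≤ W ∧ ∀ x, IsChartConvex E (W.toOpens x) :=
  U.exists_le_forall exists_isChartConvex

theorem IsChartConvex.isPreconnected {B : Opens M} (hB : IsChartConvex E B) :
    IsPreconnected (B : Set M) := by
  obtain ⟨x₀, C, -, hconv, hCt, hBC⟩ := hB
  set φ := extChartAt 𝓘(ℝ, E) x₀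
  have h : (B : Set M) = φ.symm '' C := by
    rw [hBC]
    ext p
    constructor
    · rintro ⟨hp, hpC⟩
      exact ⟨φ p, hpC, φ.left_inv hp⟩
    · rintro ⟨y, hy, rfl⟩
      refine ⟨φ.map_target (hCt hy), ?_⟩
      rwa [Set.mem_preimage, φ.right_inv (hCt hy)]
  rw [h]
  exact hconv.isPreconnected.image _ ((continuousOn_extChartAt_symm x₀).mono hCt)

variable [IsManifold 𝓘(ℝ, E) ∞ M]

/-- On a chart-convex open set every closed 1-form is the differential of a function. -/
theorem IsChartConvex.exists_mvfderiv_eq [CompleteSpace G] {B : Opens M}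
    (hB : IsChartConvex E B) {β : Form E M G 1} (hβ : ∀ p ∈ B, β.SmoothAt p)
    (hd : ∀ p ∈ B, β.d p = 0) :
    ∃ f : M → G, ContMDiffOn 𝓘(ℝ, E) 𝓘(ℝ, G) ∞ f B ∧
      ∀ p ∈ B, ∀ v : TangentSpace 𝓘(ℝ, E) p, mvfderiv 𝓘(ℝ, E) f p v = β p fun _ => v := by
  obtain ⟨x₀, C, hC, hconv, hCt, hBC⟩ := hB
  set φ := extChartAt 𝓘(ℝ, E) x₀
  have hmem : ∀ y ∈ C, φ.symm y ∈ B := by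
    intro y hy
    rw [← SetLike.mem_coe, hBC]
    exact ⟨φ.map_target (hCt hy), by rwa [Set.mem_preimage, φ.right_inv (hCt hy)]⟩
  obtain ⟨f, hf, hfβ⟩ := exists_fderiv_eq_of_convex (β := β.inChart x₀) hC hconv
    (by
      intro y hy
      have h := (Form.smoothAt_iff (x₀ := x₀) (φ.map_target (hCt hy))).1 (hβ _ (hmem y hy))
      rw [show extChartAt 𝓘(ℝ, E) x₀ (φ.symm y) = y from φ.right_inv (hCt hy)] at h
      exact h.contDiffWithinAt)
    (by
      intro y hy
      rw [← Form.d_inChart (hCt hy) (hβ _ (hmem y hy))]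
      ext v
      rw [Form.inChart_apply, hd _ (hmem y hy)]
      rfl)
  have hfs : ∀ p ∈ B, ContDiffAt ℝ ∞ f (φ p) := fun p hp => by
    rw [← SetLike.mem_coe, hBC] at hp
    exact (hf _ hp.2).contDiffAt (hC.mem_nhds hp.2)
  have hφ : ∀ p ∈ B, ContMDiffAt 𝓘(ℝ, E) 𝓘(ℝ, E) ∞ φ p := fun p hp => by
    rw [← SetLike.mem_coe, hBC] at hp
    exact contMDiffAt_extChartAt_of_mem hp.1
  refine ⟨fun p => f (φ p), fun p hp => ((hfs p hp).contMDiffAt.comp p (hφ p hp)).contMDiffWithinAt,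
    fun p hp v => ?_⟩
  refine (mvfderiv_comp_apply_mfderiv (E := E) (g := f) (f := φ)
    (((hfs p hp).differentiableAt (by simp)).mdifferentiableAt)
    ((hφ p hp).mdifferentiableAt (by simp)) v).trans ((mvfderiv_vectorSpace _).trans ?_)
  rw [← SetLike.mem_coe, hBC] at hp
  exact (hfβ _ hp.2 _).trans (Form.apply_eq_inChart β hp.1 _).symm

/-- A function with vanishing differential is locally constant. -/
theorem isLocallyConstant_of_mvfderiv_eq_zero {O : Opens M} {f : M → G}
    (hf : ContMDiffOn 𝓘(ℝ, E) 𝓘(ℝ, G) ∞ f O)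
    (h0 : ∀ p ∈ O, ∀ v : TangentSpace 𝓘(ℝ, E) p, mvfderiv 𝓘(ℝ, E) f p v = 0) :
    IsLocallyConstant fun p : O => f p := by
  rw [IsLocallyConstant.iff_eventually_eq]
  intro p
  obtain ⟨B, hpB, hBO, x₀, C, hC, hconv, hCt, hBC⟩ := exists_isChartConvex (E := E) p.1 O p.2
  set φ := extChartAt 𝓘(ℝ, E) x₀
  have hmem : ∀ y ∈ C, φ.symm y ∈ O := by
    intro y hy
    refine hBO ?_
    rw [← SetLike.mem_coe, hBC]
    exact ⟨φ.map_target (hCt hy), by rwa [Set.mem_preimage, φ.right_inv (hCt hy)]⟩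
  have hd : ∀ y ∈ C, MDifferentiableAt 𝓘(ℝ, E) 𝓘(ℝ, G) f (φ.symm y) := fun y hy =>
    (hf.contMDiffAt (O.isOpen.mem_nhds (hmem y hy))).mdifferentiableAt (by simp)
  have hs : ∀ y ∈ C, MDifferentiableAt 𝓘(ℝ, E) 𝓘(ℝ, E) φ.symm y := fun y hy =>
    (contMDiffAt_extChartAt_symm (hCt hy)).mdifferentiableAt (by simp)
  have key : ∀ y ∈ C, ∀ z ∈ C, f (φ.symm y) = f (φ.symm z) := by
    intro y hy z hz
    refine hC.is_const_of_fderiv_eq_zero (𝕜 := ℝ) (f := fun y => f (φ.symm y))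
      hconv.isPreconnected ?_ ?_ hy hz
    · intro y hy
      exact ((hd y hy).comp y (hs y hy)).differentiableAt.differentiableWithinAt
    · intro y hy
      ext v
      exact ((mvfderiv_vectorSpace v).symm.trans
        (mvfderiv_comp_apply_mfderiv (hd y hy) (hs y hy) v)).trans (h0 _ (hmem y hy) _)
  have hB' : ∀ q ∈ B, q ∈ φ.source ∧ φ q ∈ C := fun q hq => by
    rw [← SetLike.mem_coe, hBC] at hq
    exact hq
  filter_upwards [(B.isOpen.preimage continuous_subtype_val).mem_nhds hpB] with q hq
  have h := key _ (hB' _ hq).2 _ (hB' _ hpB).2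
  rwa [φ.left_inv (hB' _ hq).1, φ.left_inv (hB' _ hpB).1] at h

/-- On a chart-convex open set every closed form of positive degree is exact. -/
theorem IsChartConvex.exists_d_eq [FiniteDimensional ℝ E] {k : ℕ} {B : Opens M}
    (hB : IsChartConvex E B) {Ω : Form E M ℝ (k + 1)} (hΩ : ∀ p ∈ B, Ω.SmoothAt p)
    (hd : ∀ p ∈ B, Ω.d p = 0) :
    ∃ α : Form E M ℝ k, ∀ p ∈ B, α.SmoothAt p ∧ α.d p = Ω p := by
  obtain ⟨x₀, C, hC, hconv, hCt, hBC⟩ := hB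
  set φ := extChartAt 𝓘(ℝ, E) x₀
  have hmem : ∀ y ∈ C, φ.symm y ∈ B := by
    intro y hy
    rw [← SetLike.mem_coe, hBC]
    exact ⟨φ.map_target (hCt hy), by rwa [Set.mem_preimage, φ.right_inv (hCt hy)]⟩
  obtain ⟨α, hα, hαΩ⟩ := exists_extDeriv_eq_of_convex (Ω := Ω.inChart x₀) hC hconv
    (by
      intro y hy
      have h := (Form.smoothAt_iff (x₀ := x₀) (φ.map_target (hCt hy))).1 (hΩ _ (hmem y hy))
      rw [show extChartAt 𝓘(ℝ, E) x₀ (φ.symm y) = y from φ.right_inv (hCt hy)] at h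
      exact h.contDiffWithinAt)
    (by
      intro y hy
      rw [← Form.d_inChart (hCt hy) (hΩ _ (hmem y hy))]
      ext v
      rw [Form.inChart_apply, hd _ (hmem y hy)]
      rfl)
  -- The primitive found in the vector space is carried back by the chart. Its chart expression
  -- agrees with `α` throughout the chart's target, hence near `φ p`, which suffices for smoothness
  -- and for the exterior derivative.
  refine ⟨Form.ofChart x₀ α, fun p hp => ?_⟩
  rw [← SetLike.mem_coe, hBC] at hp
  have hev : (Form.ofChart x₀ α : Form E M ℝ k).inChart x₀ =ᶠ[nhds (φ p)] α := by
    filter_upwards [(isOpen_extChartAt_target x₀).mem_nhds (φ.map_source hp.1)] with y hy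
    exact Form.inChart_ofChart hy
  have hs : (Form.ofChart x₀ α : Form E M ℝ k).SmoothAt p :=
    (Form.smoothAt_iff hp.1).2 (((hα _ hp.2).contDiffAt (hC.mem_nhds hp.2)).congr_of_eventuallyEq hev)
  refine ⟨hs, Form.eq_of_inChart_eq hp.1 ?_⟩
  have hs' : (Form.ofChart x₀ α : Form E M ℝ k).SmoothAt (φ.symm (φ p)) := by
    rwa [φ.left_inv hp.1]
  rw [Form.d_inChart (φ.map_source hp.1) hs', hev.extDeriv_eq]
  exact hαΩ _ hp.2

end Manifold

/-! ### Local potentials and the Čech class of a closed 2-form -/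

section Manifold

variable {E : Type v} [NormedAddCommGroup E] [NormedSpace ℝ E]
  {M : Type u} [TopologicalSpace M] [ChartedSpace E M]

/-- Local potentials `αₓ` of the 2-form `Ω` and primitives `f_{xy}` of their differences. -/
structure Potentials (Ω : Form E M ℝ 2) (U : PointedCover M) (α : M → Form E M ℝ 1)
    (f : M → M → M → ℝ) : Prop where
  smoothAt : ∀ x, ∀ p ∈ U.toOpens x, (α x).SmoothAt p
  d_eq : ∀ x, ∀ p ∈ U.toOpens x, (α x).d p = Ω p
  contMDiffOn : ∀ x y,
    ContMDiffOn 𝓘(ℝ, E) 𝓘(ℝ, ℝ) ∞ (f x y) (U.toOpens x ∩ U.toOpens y : Set M)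
  mvfderiv_eq : ∀ x y, ∀ p ∈ U.toOpens x, p ∈ U.toOpens y → ∀ v : TangentSpace 𝓘(ℝ, E) p,
    α y p (fun _ => v) - α x p (fun _ => v) = mvfderiv 𝓘(ℝ, E) (f x y) p v

namespace Potentials

variable {Ω : Form E M ℝ 2} {U : PointedCover M} {α : M → Form E M ℝ 1} {f : M → M → M → ℝ}

theorem mono (h : Potentials Ω U α f) {W : PointedCover M} (hUW : U ≤ W) :
    Potentials Ω W α f where
  smoothAt x p hp := h.smoothAt x p (hUW x hp)
  d_eq x p hp := h.d_eq x p (hUW x hp)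
  contMDiffOn x y := (h.contMDiffOn x y).mono fun _ hp => ⟨hUW x hp.1, hUW y hp.2⟩
  mvfderiv_eq x y p hx hy v := h.mvfderiv_eq x y p (hUW x hx) (hUW y hy) v

theorem contMDiffAt (h : Potentials Ω U α f) {x y p : M} (hx : p ∈ U.toOpens x)
    (hy : p ∈ U.toOpens y) : ContMDiffAt 𝓘(ℝ, E) 𝓘(ℝ, ℝ) ∞ (f x y) p :=
  (h.contMDiffOn x y).contMDiffAt
    (((U.toOpens x).isOpen.inter (U.toOpens y).isOpen).mem_nhds ⟨hx, hy⟩)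

theorem mdifferentiableAt (h : Potentials Ω U α f) {x y p : M} (hx : p ∈ U.toOpens x)
    (hy : p ∈ U.toOpens y) : MDifferentiableAt 𝓘(ℝ, E) 𝓘(ℝ, ℝ) (f x y) p :=
  (h.contMDiffAt hx hy).mdifferentiableAt (by simp)

variable [IsManifold 𝓘(ℝ, E) ∞ M]

/-- The differential is (α_z − α_y) − (α_z − α_x) + (α_y − α_x) = 0. -/
theorem isLocallyConstant (h : Potentials Ω U α f) (σ : Fin 3 → M) :
    IsLocallyConstant fun p : U.inter σ =>
      (f (σ 1) (σ 2) - f (σ 0) (σ 2) + f (σ 0) (σ 1)) p := by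
  have hm : ∀ p ∈ U.inter σ, ∀ i, p ∈ U.toOpens (σ i) := fun p hp => PointedCover.mem_inter.1 hp
  refine isLocallyConstant_of_mvfderiv_eq_zero (E := E) (fun p hp => ?_) fun p hp v => ?_
  · exact (((h.contMDiffAt (hm p hp 1) (hm p hp 2)).sub (h.contMDiffAt (hm p hp 0) (hm p hp 2))).add
      (h.contMDiffAt (hm p hp 0) (hm p hp 1))).contMDiffWithinAt
  · have h12 := h.mdifferentiableAt (hm p hp 1) (hm p hp 2)
    have h02 := h.mdifferentiableAt (hm p hp 0) (hm p hp 2)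
    have h01 := h.mdifferentiableAt (hm p hp 0) (hm p hp 1)
    rw [mvfderiv_add (h12.sub h02) h01, mvfderiv_sub h12 h02]
    change mvfderiv 𝓘(ℝ, E) (f (σ 1) (σ 2)) p v - mvfderiv 𝓘(ℝ, E) (f (σ 0) (σ 2)) p v +
      mvfderiv 𝓘(ℝ, E) (f (σ 0) (σ 1)) p v = 0
    rw [← h.mvfderiv_eq _ _ p (hm p hp 1) (hm p hp 2), ← h.mvfderiv_eq _ _ p (hm p hp 0) (hm p hp 2),
      ← h.mvfderiv_eq _ _ p (hm p hp 0) (hm p hp 1)]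
    abel

/-- The 2-cocycle `f_{yz} - f_{xz} + f_{xy}`. -/
def cochain (h : Potentials Ω U α f) : Cochain (constSheaf M ℝ) U 2 :=
  Cochain.ofFun _ U (fun σ => f (σ 1) (σ 2) - f (σ 0) (σ 2) + f (σ 0) (σ 1)) h.isLocallyConstant

theorem val_cochain (h : Potentials Ω U α f) {σ : Fin 3 → M} {p : M} (hp : p ∈ U.inter σ) :
    Cochain.val h.cochain σ p = f (σ 1) (σ 2) p - f (σ 0) (σ 2) p + f (σ 0) (σ 1) p :=
  Cochain.val_ofFun _ hp

/-- The cocycle which represents the Čech class of `Ω`. -/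
def cocycle (h : Potentials Ω U α f) : (cechD (constSheaf M ℝ) U 2).ker :=
  ⟨h.cochain, by
    rw [AddMonoidHom.mem_ker]
    refine Cochain.ext_val fun σ p hp => ?_
    have hm := PointedCover.mem_inter.1 hp
    have hτ : ∀ i j k, p ∈ U.inter ![σ i, σ j, σ k] := fun i j k =>
      PointedCover.mem_inter.2 fun l => by fin_cases l <;> exact hm _
    rw [Cochain.val_cechD_two _ hp, h.val_cochain (hτ _ _ _), h.val_cochain (hτ _ _ _),
      h.val_cochain (hτ _ _ _), h.val_cochain (hτ _ _ _), Cochain.val_zero]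
    simp only [Matrix.cons_val]
    abel⟩

/-- On a common chart-convex refinement the forms α_x − α'_x − η are closed, hence equal to dg_x.
Then f − f' − δg has zero differential and is a locally constant real 1-cochain; since δδg = 0, its
coboundary is the difference of the two cocycles. -/
theorem mk_eq_mk {Ω' : Form E M ℝ 2} {U' : PointedCover M} {α' : M → Form E M ℝ 1}
    {f' : M → M → M → ℝ} (h : Potentials Ω U α f) (h' : Potentials Ω' U' α' f')
    {η : Form E M ℝ 1} (hη : ∀ p, η.SmoothAt p) (hηΩ : ∀ p, Ω p - Ω' p = η.d p) :
    CechH.mk U h.cocycle = CechH.mk U' h'.cocycle := by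
  obtain ⟨W, hUW, hW⟩ := exists_isChartConvex_cover (E := E) (U.inf U')
  have hU : U ≤ W := (U.le_inf_left U').trans hUW
  have hU' : U' ≤ W := (U.le_inf_right U').trans hUW
  have hs : ∀ x, ∀ p ∈ W.toOpens x, (α x - α' x - η).SmoothAt p := fun x p hp =>
    ((h.smoothAt x p (hU x hp)).sub (h'.smoothAt x p (hU' x hp))).sub (hη p)
  have hd : ∀ x, ∀ p ∈ W.toOpens x, (α x - α' x - η).d p = 0 := fun x p hp => by
    have h1 := h.smoothAt x p (hU x hp)
    have h2 := h'.smoothAt x p (hU' x hp)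
    rw [Form.d_sub (h1.sub h2) (hη p), Form.d_sub h1 h2, h.d_eq x p (hU x hp),
      h'.d_eq x p (hU' x hp), hηΩ, sub_self]
  choose g hg hgd using fun x => (hW x).exists_mvfderiv_eq (hs x) (hd x)
  have hgs : ∀ x, ∀ p ∈ W.toOpens x, ContMDiffAt 𝓘(ℝ, E) 𝓘(ℝ, ℝ) ∞ (g x) p := fun x p hp =>
    (hg x).contMDiffAt ((W.toOpens x).isOpen.mem_nhds hp)
  have hgm : ∀ x, ∀ p ∈ W.toOpens x, MDifferentiableAt 𝓘(ℝ, E) 𝓘(ℝ, ℝ) (g x) p := fun x p hp =>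
    (hgs x p hp).mdifferentiableAt (by simp)
  have hlc : ∀ σ : Fin 2 → M, IsLocallyConstant fun p : W.inter σ =>
      (f (σ 0) (σ 1) - f' (σ 0) (σ 1) - (g (σ 1) - g (σ 0))) p := by
    intro σ
    have hm : ∀ p ∈ W.inter σ, ∀ i, p ∈ W.toOpens (σ i) := fun p hp => PointedCover.mem_inter.1 hp
    refine isLocallyConstant_of_mvfderiv_eq_zero (E := E) (fun p hp => ?_) fun p hp v => ?_
    · exact (((h.contMDiffAt (hU _ (hm p hp 0)) (hU _ (hm p hp 1))).sub
        (h'.contMDiffAt (hU' _ (hm p hp 0)) (hU' _ (hm p hp 1)))).sub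
        ((hgs _ p (hm p hp 1)).sub (hgs _ p (hm p hp 0)))).contMDiffWithinAt
    · have h1 := h.mdifferentiableAt (hU _ (hm p hp 0)) (hU _ (hm p hp 1))
      have h2 := h'.mdifferentiableAt (hU' _ (hm p hp 0)) (hU' _ (hm p hp 1))
      have h3 := hgm _ p (hm p hp 1)
      have h4 := hgm _ p (hm p hp 0)
      rw [mvfderiv_sub (h1.sub h2) (h3.sub h4), mvfderiv_sub h1 h2, mvfderiv_sub h3 h4]
      change mvfderiv 𝓘(ℝ, E) (f (σ 0) (σ 1)) p v - mvfderiv 𝓘(ℝ, E) (f' (σ 0) (σ 1)) p v -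
        (mvfderiv 𝓘(ℝ, E) (g (σ 1)) p v - mvfderiv 𝓘(ℝ, E) (g (σ 0)) p v) = 0
      rw [← h.mvfderiv_eq _ _ p (hU _ (hm p hp 0)) (hU _ (hm p hp 1)),
        ← h'.mvfderiv_eq _ _ p (hU' _ (hm p hp 0)) (hU' _ (hm p hp 1)),
        hgd _ p (hm p hp 1), hgd _ p (hm p hp 0)]
      change _ - (α (σ 1) p (fun _ => v) - α' (σ 1) p (fun _ => v) - η p (fun _ => v) -
        (α (σ 0) p (fun _ => v) - α' (σ 0) p (fun _ => v) - η p (fun _ => v))) = 0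
      abel
  let t : Cochain (constSheaf M ℝ) W 1 := Cochain.ofFun _ W
    (fun σ => f (σ 0) (σ 1) - f' (σ 0) (σ 1) - (g (σ 1) - g (σ 0))) hlc
  refine CechH.mk_eq_mk hU hU' ⟨t, Cochain.ext_val fun σ p hp => ?_⟩
  have hm := PointedCover.mem_inter.1 hp
  have hτ : ∀ i j, p ∈ W.inter ![σ i, σ j] := fun i j =>
    PointedCover.mem_inter.2 fun l => by fin_cases l <;> exact hm _
  have ht : ∀ i j, Cochain.val t ![σ i, σ j] p = f (σ i) (σ j) p - f' (σ i) (σ j) p -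
      (g (σ j) p - g (σ i) p) := fun i j => Cochain.val_ofFun _ (hτ i j)
  rw [Cochain.val_cechD_one _ hp, ht, ht, ht, Cochain.val_sub _ _ hp, Cochain.val_refine _ _ hp,
    Cochain.val_refine _ _ hp]
  have e : Cochain.val h.cocycle.1 σ p = _ := h.val_cochain (PointedCover.inter_mono hU σ hp)
  have e' : Cochain.val h'.cocycle.1 σ p = _ := h'.val_cochain (PointedCover.inter_mono hU' σ hp)
  rw [e, e']
  abel

end Potentials

/-- The cocycle in `IsCechClassOf` is determined by the functions `f`, so it can always be taken to
be `Potentials.cocycle`. -/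
theorem isCechClassOf_iff [IsManifold 𝓘(ℝ, E) ∞ M] {κ : CechH (constSheaf M ℝ) 2}
    {c : DeRhamH2 E M} :
    IsCechClassOf κ c ↔ ∃ (Ω : closedForms E M 2) (U : PointedCover M) (α : M → Form E M ℝ 1)
      (f : M → M → M → ℝ) (h : Potentials Ω.1 U α f),
      DeRhamH2.mk Ω = c ∧ CechH.mk U h.cocycle = κ := by
  constructor
  · rintro ⟨Ω, U, α, f, a, hc, h1, h2, h3, h4, hκ⟩
    have h : Potentials Ω.1 U α f :=
      ⟨fun x p hp => (h1 x p hp).1, fun x p hp => (h1 x p hp).2, h2, h3⟩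
    refine ⟨Ω, U, α, f, h, hc, ?_⟩
    rw [← hκ]
    congr 1
    refine Subtype.ext (Cochain.ext_val fun σ p hp => (h.val_cochain hp).trans ?_)
    have hσ : σ = ![σ 0, σ 1, σ 2] := by ext i; fin_cases i <;> rfl
    rw [Cochain.val_of_mem _ hp]
    generalize σ 0 = x, σ 1 = y, σ 2 = z at hσ ⊢
    subst hσ
    exact (h4 x y z ⟨p, hp⟩).symm
  · rintro ⟨Ω, U, α, f, h, hc, hκ⟩
    exact ⟨Ω, U, α, f, h.cocycle, hc, fun x p hp => ⟨h.smoothAt x p hp, h.d_eq x p hp⟩,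
      h.contMDiffOn, h.mvfderiv_eq, fun x y z p => rfl, hκ⟩

theorem IsCechClassOf.eq [IsManifold 𝓘(ℝ, E) ∞ M] {κ κ' : CechH (constSheaf M ℝ) 2}
    {c : DeRhamH2 E M} (hκ : IsCechClassOf κ c) (hκ' : IsCechClassOf κ' c) : κ = κ' := by
  obtain ⟨Ω, U, α, f, h, hc, rfl⟩ := isCechClassOf_iff.1 hκ
  obtain ⟨Ω', U', α', f', h', hc', rfl⟩ := isCechClassOf_iff.1 hκ'
  have e : DeRhamH2.mk Ω = DeRhamH2.mk Ω' := hc.trans hc'.symm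
  obtain ⟨η, hη, he⟩ := (Submodule.Quotient.eq _).1 e
  exact h.mk_eq_mk h' hη fun p => congrFun he p

variable [IsManifold 𝓘(ℝ, E) ∞ M] [FiniteDimensional ℝ E] [T2Space M] [ParacompactSpace M]

/-- An intersection of chart-convex sets need not be chart-convex, so the primitive `f` is not
sought on W_x ∩ W_y. When W_x and W_y meet, the barycentric property places W_y in the domains of
both potentials, and the closed form α_{j y} − α_{j x} is integrated on the chart-convex set W_y. -/
theorem exists_potentials (Ω : closedForms E M 2) :
    ∃ (U : PointedCover M) (α : M → Form E M ℝ 1) (f : M → M → M → ℝ),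
      Potentials Ω.1 U α f := by
  classical
  obtain ⟨D, -, hD⟩ := exists_isChartConvex_cover (E := E) (⟨fun _ => ⊤, fun _ => trivial⟩ :
    PointedCover M)
  choose α hα using fun x => (hD x).exists_d_eq (Ω := Ω.1) (fun p _ => (Ω.2 p).1)
    (fun p _ => (Ω.2 p).2)
  obtain ⟨W, j, hWj, hW, hWc⟩ := PointedCover.exists_barycentric (exists_isChartConvex (E := E)) D
  have key : ∀ x y, ∃ f : M → ℝ,
      ContMDiffOn 𝓘(ℝ, E) 𝓘(ℝ, ℝ) ∞ f (W.toOpens x ∩ W.toOpens y : Set M) ∧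
      ∀ p ∈ W.toOpens x, p ∈ W.toOpens y → ∀ v : TangentSpace 𝓘(ℝ, E) p,
        α (j y) p (fun _ => v) - α (j x) p (fun _ => v) = mvfderiv 𝓘(ℝ, E) f p v := by
    intro x y
    by_cases hxy : ∃ q, q ∈ W.toOpens x ∧ q ∈ W.toOpens y
    · obtain ⟨q, hqx, hqy⟩ := hxy
      have h1 : ∀ p ∈ W.toOpens y, _ := fun p hp => hα (j y) p (hWj y hp)
      have h2 : ∀ p ∈ W.toOpens y, _ := fun p hp => hα (j x) p (hW x y q hqx hqy hp)
      obtain ⟨f, hf, hfd⟩ := (hWc y).exists_mvfderiv_eq (β := α (j y) - α (j x))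
        (fun p hp => (h1 p hp).1.sub (h2 p hp).1) (fun p hp => by
          rw [Form.d_sub (h1 p hp).1 (h2 p hp).1, (h1 p hp).2, (h2 p hp).2, sub_self])
      exact ⟨f, hf.mono Set.inter_subset_right, fun p _ hp v => (hfd p hp v).symm⟩
    · push Not at hxy
      exact ⟨fun _ => 0, contMDiffOn_const, fun p hx hy => absurd hy (hxy p hx)⟩
  choose f hf hfd using key
  exact ⟨W, fun x => α (j x), f, fun x p hp => (hα (j x) p (hWj x hp)).1,
    fun x p hp => (hα (j x) p (hWj x hp)).2, hf, hfd⟩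

end Manifold

/-! ### Exponentials and logarithms of complex-valued functions -/

section ComplexFunctions

variable {E : Type v} [NormedAddCommGroup E] [NormedSpace ℝ E]
  {M : Type u} [TopologicalSpace M] [ChartedSpace E M]

theorem _root_.ContMDiffAt.complex_mul {f g : M → ℂ} {p : M}
    (hf : ContMDiffAt 𝓘(ℝ, E) 𝓘(ℝ, ℂ) ∞ f p) (hg : ContMDiffAt 𝓘(ℝ, E) 𝓘(ℝ, ℂ) ∞ g p) :
    ContMDiffAt 𝓘(ℝ, E) 𝓘(ℝ, ℂ) ∞ (fun q => f q * g q) p :=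
  ContDiffAt.comp_contMDiffAt (g := fun q : ℂ × ℂ => q.1 * q.2)
    contDiff_mul.contDiffAt (hf.prodMk_space hg)

theorem _root_.ContMDiffAt.complex_inv {f : M → ℂ} {p : M}
    (hf : ContMDiffAt 𝓘(ℝ, E) 𝓘(ℝ, ℂ) ∞ f p) (h0 : f p ≠ 0) :
    ContMDiffAt 𝓘(ℝ, E) 𝓘(ℝ, ℂ) ∞ (fun q => (f q)⁻¹) p :=
  ContDiffAt.comp_contMDiffAt (contDiffAt_inv ℝ h0) hf

theorem contDiff_cexp_two_pi_I :
    ContDiff ℝ ∞ (fun z : ℂ => Complex.exp (2 * Real.pi * Complex.I * z)) :=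
  (contDiff_const.mul contDiff_id).cexp

theorem _root_.ContMDiffAt.cexp_two_pi_I {f : M → ℂ} {p : M}
    (hf : ContMDiffAt 𝓘(ℝ, E) 𝓘(ℝ, ℂ) ∞ f p) :
    ContMDiffAt 𝓘(ℝ, E) 𝓘(ℝ, ℂ) ∞ (fun q => Complex.exp (2 * Real.pi * Complex.I * f q)) p :=
  ContDiffAt.comp_contMDiffAt
    (g := fun z : ℂ => Complex.exp (2 * Real.pi * Complex.I * z)) contDiff_cexp_two_pi_I.contDiffAt hf

theorem mvfderiv_complex_mul {f g : M → ℂ} {p : M}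
    (hf : MDifferentiableAt 𝓘(ℝ, E) 𝓘(ℝ, ℂ) f p) (hg : MDifferentiableAt 𝓘(ℝ, E) 𝓘(ℝ, ℂ) g p)
    (v : TangentSpace 𝓘(ℝ, E) p) :
    mvfderiv 𝓘(ℝ, E) (fun q => f q * g q) p v =
      f p * mvfderiv 𝓘(ℝ, E) g p v + g p * mvfderiv 𝓘(ℝ, E) f p v := by
  have h := (HasMFDerivAt.mul (F' := ℂ) hf.hasMFDerivAt hg.hasMFDerivAt).mfderiv
  exact DFunLike.congr_fun h v

theorem mvfderiv_cexp_two_pi_I {f : M → ℂ} {p : M}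
    (hf : MDifferentiableAt 𝓘(ℝ, E) 𝓘(ℝ, ℂ) f p) (v : TangentSpace 𝓘(ℝ, E) p) :
    mvfderiv 𝓘(ℝ, E) (fun q => Complex.exp (2 * Real.pi * Complex.I * f q)) p v =
      2 * Real.pi * Complex.I * mvfderiv 𝓘(ℝ, E) f p v *
        Complex.exp (2 * Real.pi * Complex.I * f p) := by
  have h : HasDerivAt (fun z : ℂ => Complex.exp (2 * Real.pi * Complex.I * z))
      (Complex.exp (2 * Real.pi * Complex.I * f p) * (2 * Real.pi * Complex.I * 1)) (f p) :=
    ((hasDerivAt_id (f p)).const_mul _).cexp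
  refine (mvfderiv_comp_hasFDerivAt (h.hasFDerivAt.restrictScalars ℝ) hf v).trans ?_
  change mvfderiv 𝓘(ℝ, E) f p v * _ = _
  ring

theorem IsChartConvex.exists_forall_eq [IsManifold 𝓘(ℝ, E) ∞ M] {B : Opens M}
    (hB : IsChartConvex E B) {f : M → ℂ} (hf : ContMDiffOn 𝓘(ℝ, E) 𝓘(ℝ, ℂ) ∞ f B)
    (h0 : ∀ p ∈ B, ∀ v : TangentSpace 𝓘(ℝ, E) p, mvfderiv 𝓘(ℝ, E) f p v = 0) {p q : M}
    (hp : p ∈ B) (hq : q ∈ B) : f p = f q := by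
  have : PreconnectedSpace B := isPreconnected_iff_preconnectedSpace.1 hB.isPreconnected
  exact (isLocallyConstant_of_mvfderiv_eq_zero hf h0).apply_eq_of_preconnectedSpace
    ⟨p, hp⟩ ⟨q, hq⟩

/-- A nowhere-vanishing function on a chart-convex open set whose logarithmic differential is
`2πi df` is the exponential of `2πi f`, up to a constant. -/
theorem IsChartConvex.exists_eq_exp [IsManifold 𝓘(ℝ, E) ∞ M] {B : Opens M}
    (hB : IsChartConvex E B) {c f : M → ℂ} (hc : ContMDiffOn 𝓘(ℝ, E) 𝓘(ℝ, ℂ) ∞ c B)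
    (hf : ContMDiffOn 𝓘(ℝ, E) 𝓘(ℝ, ℂ) ∞ f B) (hc0 : ∀ p ∈ B, c p ≠ 0)
    (h : ∀ p ∈ B, ∀ v : TangentSpace 𝓘(ℝ, E) p, mvfderiv 𝓘(ℝ, E) c p v =
      2 * Real.pi * Complex.I * mvfderiv 𝓘(ℝ, E) f p v * c p) :
    ∃ a : ℂ, ∀ p ∈ B, c p = Complex.exp (2 * Real.pi * Complex.I * (f p + a)) := by
  by_cases hne : ∃ q, q ∈ B
  swap
  · exact ⟨0, fun p hp => absurd ⟨p, hp⟩ hne⟩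
  obtain ⟨q, hq⟩ := hne
  have hnf : ContMDiffOn 𝓘(ℝ, E) 𝓘(ℝ, ℂ) ∞ (fun p => -f p) B := hf.neg
  have hca : ∀ p ∈ B, ContMDiffAt 𝓘(ℝ, E) 𝓘(ℝ, ℂ) ∞ c p := fun p hp =>
    hc.contMDiffAt (B.isOpen.mem_nhds hp)
  have hfa : ∀ p ∈ B, ContMDiffAt 𝓘(ℝ, E) 𝓘(ℝ, ℂ) ∞ (fun p => -f p) p := fun p hp =>
    hnf.contMDiffAt (B.isOpen.mem_nhds hp)
  -- The quotient of `c` by exp(2πi f) has zero differential, so it equals its value `K` at `q` on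
  -- the connected set `B`; the constant sought is log K / 2πi.
  have hK := fun p (hp : p ∈ B) => hB.exists_forall_eq
    (f := fun p => c p * Complex.exp (2 * Real.pi * Complex.I * -f p))
    (fun p hp => ((hca p hp).complex_mul (hfa p hp).cexp_two_pi_I).contMDiffWithinAt)
    (fun p hp v => by
      have h1 := mvfderiv_complex_mul ((hca p hp).mdifferentiableAt (by simp))
        ((hfa p hp).cexp_two_pi_I.mdifferentiableAt (by simp)) v
      have h2 := mvfderiv_cexp_two_pi_I ((hfa p hp).mdifferentiableAt (by simp)) v
      have h3 : mvfderiv 𝓘(ℝ, E) (fun p => -f p) p v = - mvfderiv 𝓘(ℝ, E) f p v :=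
        DFunLike.congr_fun (mvfderiv_neg (g := f) (x := p)) v
      refine h1.trans ?_
      rw [h2, h3, h p hp v]
      ring) hp hq
  set K := c q * Complex.exp (2 * Real.pi * Complex.I * -f q) with hKdef
  have hK0 : K ≠ 0 := mul_ne_zero (hc0 q hq) (Complex.exp_ne_zero _)
  have hpi : (2 * Real.pi * Complex.I : ℂ) ≠ 0 := Complex.two_pi_I_ne_zero
  refine ⟨Complex.log K / (2 * Real.pi * Complex.I), fun p hp => ?_⟩
  rw [mul_add, mul_div_cancel₀ _ hpi, Complex.exp_add, Complex.exp_log hK0, ← hK p hp,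
    mul_comm, mul_assoc, ← Complex.exp_add]
  simp

/-- Nowhere-vanishing smooth functions have local logarithms. -/
theorem exists_log_nhds {f : M → ℂ} {O : Opens M} (hf : ContMDiffOn 𝓘(ℝ, E) 𝓘(ℝ, ℂ) ∞ f O) {x : M}
    (hx : x ∈ O) (h0 : f x ≠ 0) :
    ∃ (B : Opens M) (g : M → ℂ), x ∈ B ∧ B ≤ O ∧ ContMDiffOn 𝓘(ℝ, E) 𝓘(ℝ, ℂ) ∞ g B ∧
      ∀ p ∈ B, f p = Complex.exp (2 * Real.pi * Complex.I * g p) := by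
  have hpi : (2 * Real.pi * Complex.I : ℂ) ≠ 0 := Complex.two_pi_I_ne_zero
  have hcont : ContinuousOn (fun p => f p / f x) O := hf.continuousOn.div_const _
  -- Dividing by `f x` moves the value at `x` to 1, away from the branch cut. The principal
  -- logarithm is smooth there, and log (f x) is added back.
  refine ⟨⟨O ∩ (fun p => f p / f x) ⁻¹' Complex.slitPlane,
    hcont.isOpen_inter_preimage O.isOpen Complex.isOpen_slitPlane⟩,
    fun p => (Complex.log (f p / f x) + Complex.log (f x)) / (2 * Real.pi * Complex.I),
    ⟨hx, by simp [h0]⟩, fun p hp => hp.1, ?_, ?_⟩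
  · rintro p ⟨hp, hps⟩
    have hfp : ContMDiffAt 𝓘(ℝ, E) 𝓘(ℝ, ℂ) ∞ f p := hf.contMDiffAt (O.isOpen.mem_nhds hp)
    have hφ : ContDiffAt ℝ ∞ (fun z : ℂ =>
        (Complex.log (z / f x) + Complex.log (f x)) / (2 * Real.pi * Complex.I)) (f p) := by
      have h1 : ContDiffAt ℂ ∞ (fun z : ℂ =>
          (Complex.log (z / f x) + Complex.log (f x)) / (2 * Real.pi * Complex.I)) (f p) :=
        (((Complex.contDiffAt_log hps).comp (f p) (contDiffAt_id.div_const (f x))).add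
          contDiffAt_const).div_const _
      exact h1.restrict_scalars ℝ
    exact (ContDiffAt.comp_contMDiffAt hφ hfp).contMDiffWithinAt
  · rintro p ⟨hp, hps⟩
    have hne : f p / f x ≠ 0 := Complex.slitPlane_ne_zero hps
    rw [mul_div_cancel₀ _ hpi, Complex.exp_add, Complex.exp_log hne, Complex.exp_log h0,
      div_mul_cancel₀ _ h0]

/-- A continuous function whose exponential `exp(2πif)` is trivial is a locally constant
integer. -/
theorem exists_int_of_exp_eq_one {X : Type*} [TopologicalSpace X] {f : X → ℂ} (hf : Continuous f)
    (h : ∀ p, Complex.exp (2 * Real.pi * Complex.I * f p) = 1) :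
    ∃ n : X → ℤ, IsLocallyConstant n ∧ ∀ p, f p = n p := by
  have hpi : (2 * Real.pi * Complex.I : ℂ) ≠ 0 := Complex.two_pi_I_ne_zero
  have h1 : ∀ p, ∃ n : ℤ, f p = n := fun p => by
    obtain ⟨n, hn⟩ := Complex.exp_eq_one_iff.1 (h p)
    refine ⟨n, mul_left_cancel₀ hpi (hn.trans (mul_comm _ _))⟩
  choose n hn using h1
  refine ⟨n, ?_, hn⟩
  rw [IsLocallyConstant.iff_continuous]
  -- As a real function `n` is the real part of `f`, and ℤ carries the topology induced from ℝ.
  -- Continuity into the discrete space ℤ is local constancy.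
  have : Continuous (fun p => ((n p : ℤ) : ℝ)) := by
    have e : (fun p => ((n p : ℤ) : ℝ)) = fun p => (f p).re := by
      funext p; rw [hn p]; simp
    rw [e]
    exact Complex.continuous_re.comp hf
  exact Int.isClosedEmbedding_coe_real.isInducing.continuous_iff.2 this

end ComplexFunctions

/-! ### Ratios of sections and differences of connection forms -/

section Sections

variable {E : Type v} [NormedAddCommGroup E] [NormedSpace ℝ E]
  {M : Type u} [TopologicalSpace M] [ChartedSpace E M]

namespace ComplexLineBundle

variable {L : ComplexLineBundle.{u, v, w} E M}

theorem exists_smul_eq {p : M} {a : L.Fiber p} (ha : a ≠ 0) (b : L.Fiber p) :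
    ∃ c : ℂ, b = c • a := by
  let e := (trivializationAt ℂ L.Fiber p).continuousLinearEquivAt ℂ p
    (FiberBundle.mem_baseSet_trivializationAt' p)
  have he : e a ≠ 0 := fun h => ha (e.map_eq_zero_iff.1 h)
  refine ⟨e b / e a, e.injective ?_⟩
  rw [map_smul, smul_eq_mul, div_mul_cancel₀ _ he]

theorem trivialization_smul {p q : M} (hq : q ∈ (trivializationAt ℂ L.Fiber p).baseSet) (c : ℂ)
    (a : L.Fiber q) : ((trivializationAt ℂ L.Fiber p) ⟨q, c • a⟩).2 =
      c * ((trivializationAt ℂ L.Fiber p) ⟨q, a⟩).2 :=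
  ((trivializationAt ℂ L.Fiber p).linear ℂ hq).map_smul c a

theorem trivialization_ne_zero {p q : M} (hq : q ∈ (trivializationAt ℂ L.Fiber p).baseSet)
    {a : L.Fiber q} (ha : a ≠ 0) : ((trivializationAt ℂ L.Fiber p) ⟨q, a⟩).2 ≠ 0 := by
  let e := (trivializationAt ℂ L.Fiber p).continuousLinearEquivAt ℂ q hq
  intro h
  exact ha (e.map_eq_zero_iff.1 h)

/-- The ratio of two smooth sections is smooth where the denominator does not vanish. -/
theorem contMDiffAt_of_eq_smul {s t : ∀ x, L.Fiber x} {g : M → ℂ} {p : M}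
    (hs : ContMDiffAt 𝓘(ℝ, E) (𝓘(ℝ, E).prod 𝓘(ℝ, ℂ)) ∞ (toTotal s) p)
    (ht : ContMDiffAt 𝓘(ℝ, E) (𝓘(ℝ, E).prod 𝓘(ℝ, ℂ)) ∞ (toTotal t) p) (h0 : s p ≠ 0)
    (h : ∀ᶠ q in nhds p, t q = g q • s q) : ContMDiffAt 𝓘(ℝ, E) 𝓘(ℝ, ℂ) ∞ g p := by
  have hs' := (contMDiffAt_section p).1 hs
  have ht' := (contMDiffAt_section p).1 ht
  have hp := FiberBundle.mem_baseSet_trivializationAt' (F := ℂ) (E := L.Fiber) p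
  have hne := trivialization_ne_zero hp h0
  refine (ht'.complex_mul (hs'.complex_inv hne)).congr_of_eventuallyEq ?_
  filter_upwards [h, (trivializationAt ℂ L.Fiber p).open_baseSet.mem_nhds hp,
    hs'.continuousAt.eventually_ne hne] with q hq hqb hqn
  rw [hq, trivialization_smul hqb, mul_inv_cancel_right₀ hqn]

variable [IsManifold 𝓘(ℝ, E) ∞ M]

/-- The logarithmic differential of a transition function is the difference of the connection
forms. -/
theorem Connection.mvfderiv_transition (D : L.Connection) {s t : ∀ x, L.Fiber x} {g : M → ℂ}
    {p : M} {β θ : ℂ} {v : TangentSpace 𝓘(ℝ, E) p}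
    (hs : ContMDiffAt 𝓘(ℝ, E) (𝓘(ℝ, E).prod 𝓘(ℝ, ℂ)) ∞ (toTotal s) p)
    (ht : ContMDiffAt 𝓘(ℝ, E) (𝓘(ℝ, E).prod 𝓘(ℝ, ℂ)) ∞ (toTotal t) p) (h0 : s p ≠ 0)
    (h : ∀ᶠ q in nhds p, t q = g q • s q)
    (hDs : D.toCovariantDerivative s p v = (2 * Real.pi * Complex.I * β) • s p)
    (hDt : D.toCovariantDerivative t p v = (2 * Real.pi * Complex.I * θ) • t p) :
    mvfderiv 𝓘(ℝ, E) g p v = 2 * Real.pi * Complex.I * (θ - β) * g p := by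
  have hg := contMDiffAt_of_eq_smul hs ht h0 h
  have hsd := hs.mdifferentiableAt (by simp)
  have htd := ht.mdifferentiableAt (by simp)
  have he : toTotal (fun y => g y • s y) =ᶠ[nhds p] toTotal t := by
    filter_upwards [h] with q hq
    simp only [toTotal, hq]
  have hgs : MDifferentiableAt 𝓘(ℝ, E) (𝓘(ℝ, E).prod 𝓘(ℝ, ℂ)) (toTotal fun y => g y • s y) p :=
    htd.congr_of_eventuallyEq he
  -- The sections `t` and `g • s` agree only near `p`; locality of the covariant derivative
  -- identifies their derivatives at `p`. The Leibniz rule and comparison of the coefficients of `s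
  -- p` give 2πi θ g = dg + 2πi β g.
  have h1 := D.toCovariantDerivative.isCovariantDerivativeOnUniv.congr_of_eventuallyEq
    htd hgs Filter.univ_mem h
  have h2 := D.leibniz s g p hsd (hg.mdifferentiableAt (by simp)) v
  rw [← h1, hDt, hDs, h.self_of_nhds, smul_smul, smul_smul, ← add_smul] at h2
  have h3 := smul_left_injective ℂ h0 h2
  linear_combination -h3

end ComplexLineBundle

end Sections

/-! ### Independence of the first Chern class from choices -/

section Manifold

variable {E : Type v} [NormedAddCommGroup E] [NormedSpace ℝ E]
  {M : Type u} [TopologicalSpace M] [ChartedSpace E M]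

theorem _root_.ContMDiffOn.contMDiff_restrict {G : Type*} [NormedAddCommGroup G] [NormedSpace ℝ G]
    {f : M → G} {O : Opens M} (hf : ContMDiffOn 𝓘(ℝ, E) 𝓘(ℝ, G) ∞ f O) :
    ContMDiff 𝓘(ℝ, E) 𝓘(ℝ, G) ∞ fun p : O => f p := fun p =>
  contMDiffAt_subtype_iff.2 (hf.contMDiffAt (O.isOpen.mem_nhds p.2))

theorem contMDiffOn_of_restrict {G : Type*} [NormedAddCommGroup G] [NormedSpace ℝ G]
    {f : M → G} {O : Opens M} (hf : ContMDiff 𝓘(ℝ, E) 𝓘(ℝ, G) ∞ fun p : O => f p) :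
    ContMDiffOn 𝓘(ℝ, E) 𝓘(ℝ, G) ∞ f O := fun p hp =>
  (contMDiffAt_subtype_iff (x := ⟨p, hp⟩).1 (hf ⟨p, hp⟩)).contMDiffWithinAt

open Classical in
/-- A non-zero complex number as an element of the additive version of `ℂˣ` (zero if the number
vanishes). -/
def unitOf (z : ℂ) : Additive ℂˣ := if h : z = 0 then 0 else Additive.ofMul (Units.mk0 z h)

theorem toMul_unitOf {z : ℂ} (h : z ≠ 0) : ((unitOf z).toMul : ℂ) = z := by
  rw [unitOf, dif_neg h]
  rfl

theorem unitOf_mem_sec {f : M → ℂ} {O : Opens M} (hf : ContMDiffOn 𝓘(ℝ, E) 𝓘(ℝ, ℂ) ∞ f O)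
    (h0 : ∀ p ∈ O, f p ≠ 0) :
    (fun p : O => unitOf (f p)) ∈ (smoothSheafCStar E M).sec O := by
  change ContMDiff 𝓘(ℝ, E) 𝓘(ℝ, ℂ) ∞ fun p : O => ((unitOf (f p)).toMul : ℂ)
  have h : (fun p : O => ((unitOf (f p)).toMul : ℂ)) = fun p : O => f p := by
    funext p
    exact toMul_unitOf (h0 p p.2)
  rw [h]
  exact hf.contMDiff_restrict

theorem sub_eq_sub_of_toMul {a b c d : Additive ℂˣ}
    (h : (a.toMul : ℂ) * d.toMul = (c.toMul : ℂ) * b.toMul) : a - b = c - d := by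
  rw [sub_eq_sub_iff_add_eq_add]
  exact Additive.toMul.injective (Units.ext h)

variable (E M) in
theorem toMul_expHom (z : ℂ) : (((expHom E M).toAddMonoidHom z).toMul : ℂ) =
    Complex.exp (2 * Real.pi * Complex.I * z) := rfl

theorem Cochain.contMDiffOn_val {U : PointedCover M} {n : ℕ} (c : Cochain (smoothSheafC E M) U n)
    (σ : Fin (n + 1) → M) :
    ContMDiffOn 𝓘(ℝ, E) 𝓘(ℝ, ℂ) ∞ (Cochain.val c σ) (U.inter σ) :=
  contMDiffOn_of_restrict (Cochain.val_mem_sec c σ)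

theorem Cochain.contMDiffOn_toMul_val {U : PointedCover M} {n : ℕ}
    (c : Cochain (smoothSheafCStar E M) U n) (σ : Fin (n + 1) → M) :
    ContMDiffOn 𝓘(ℝ, E) 𝓘(ℝ, ℂ) ∞ (fun p => ((Cochain.val c σ p).toMul : ℂ)) (U.inter σ) :=
  contMDiffOn_of_restrict (Cochain.val_mem_sec c σ)

theorem mem_inter_pair {U : PointedCover M} {n : ℕ} {σ : Fin (n + 1) → M} {p : M}
    (hp : p ∈ U.inter σ) (i j : Fin (n + 1)) : p ∈ U.inter ![σ i, σ j] :=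
  PointedCover.mem_inter.2 fun l => by fin_cases l <;> exact PointedCover.mem_inter.1 hp _

theorem mem_inter_triple {U : PointedCover M} {n : ℕ} {σ : Fin (n + 1) → M} {p : M}
    (hp : p ∈ U.inter σ) (i j k : Fin (n + 1)) : p ∈ U.inter ![σ i, σ j, σ k] :=
  PointedCover.mem_inter.2 fun l => by fin_cases l <;> exact PointedCover.mem_inter.1 hp _

theorem mem_inter_singleton {U : PointedCover M} {x p : M} :
    p ∈ U.inter ![x] ↔ p ∈ U.toOpens x := by
  rw [PointedCover.mem_inter]
  exact ⟨fun h => h 0, fun h i => by fin_cases i; exact h⟩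

/-- The connecting homomorphism of the exponential sequence is single-valued. -/
theorem IsConnecting.eq {z : CechH (smoothSheafCStar E M) 1} {k k' : CechH (constSheaf M ℤ) 2}
    (h : IsConnecting (intToSmooth E M) (expHom E M) z k)
    (h' : IsConnecting (intToSmooth E M) (expHom E M) z k') : k = k' := by
  obtain ⟨U, c, hc, b, hz, hb, rfl⟩ := h
  obtain ⟨U', c', hc', b', hz', hb', rfl⟩ := h'
  obtain ⟨W, hUW, hUW', t, ht⟩ := CechH.exists_of_mk_eq_mk (hz.trans hz'.symm)
  -- The exponentials of the lifts `c` and `c'` differ by δt with `t` nowhere vanishing. Shrinking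
  -- the member at `x` around `x` provides logarithms `g x` of the values of `t` there.
  have hloc := fun x : M => exists_log_nhds (Cochain.contMDiffOn_toMul_val t ![x]) (x := x)
    (mem_inter_singleton.2 (W.mem x)) (Units.ne_zero _)
  choose B g hxB hBW hg hgt using hloc
  let V : PointedCover M := ⟨B, hxB⟩
  have hWV : W ≤ V := fun x p hp => mem_inter_singleton.1 (hBW x hp)
  have hU : U ≤ V := hUW.trans hWV
  have hU' : U' ≤ V := hUW'.trans hWV
  -- On the finer cover c − c' − δg has trivial exponential, so it is an integral 1-cochain. Its
  -- coboundary is b − b' because δδg = 0; this is verified after embedding ℤ in ℂ.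
  have hN : ∀ σ : Fin 2 → M, ∃ n : V.inter σ → ℤ, IsLocallyConstant n ∧
      ∀ p : V.inter σ, Cochain.val c σ p - Cochain.val c' σ p - (g (σ 1) p - g (σ 0) p) = n p := by
    intro σ
    have hm : ∀ p ∈ V.inter σ, ∀ i, p ∈ B (σ i) := fun p hp => PointedCover.mem_inter.1 hp
    refine exists_int_of_exp_eq_one (X := V.inter σ) (f := fun p =>
      Cochain.val c σ p - Cochain.val c' σ p - (g (σ 1) p - g (σ 0) p)) ?_ fun p => ?_
    · have h1 := ((Cochain.contMDiffOn_val c σ).mono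
        (PointedCover.inter_mono hU σ)).continuousOn.domRestrict
      have h2 := ((Cochain.contMDiffOn_val c' σ).mono
        (PointedCover.inter_mono hU' σ)).continuousOn.domRestrict
      have h3 : ∀ i, Continuous fun p : V.inter σ => g (σ i) p := fun i =>
        ((hg (σ i)).mono fun p hp => hm p hp i).continuousOn.domRestrict
      exact (h1.sub h2).sub ((h3 1).sub (h3 0))
    · have hpW := PointedCover.inter_mono hWV σ p.2
      have h1 := congrArg (fun d => Cochain.val d σ p.1) ht
      simp only [Cochain.val_cechD_zero t hpW, Cochain.val_sub _ _ hpW] at h1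
      rw [Cochain.val_refine hUW _ hpW, Cochain.val_refine hUW' _ hpW,
        Cochain.val_onCochain _ _ (PointedCover.inter_mono hUW σ hpW),
        Cochain.val_onCochain _ _ (PointedCover.inter_mono hUW' σ hpW)] at h1
      have h2 : ∀ i, Cochain.val t ![σ i] p = (expHom E M).toAddMonoidHom (g (σ i) p) := fun i =>
        Additive.toMul.injective (Units.ext (hgt (σ i) p (hm p p.2 i)))
      rw [h2, h2, ← sub_eq_zero, ← map_sub, ← map_sub, ← map_sub, ← neg_eq_zero, ← map_neg] at h1
      rw [← toMul_expHom E M, ← neg_sub, h1]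
      rfl
  choose n hn hnc using hN
  let N : Cochain (constSheaf M ℤ) V 1 := fun σ => ⟨n σ, hn σ⟩
  have hNv : ∀ (σ : Fin 2 → M) (p : M), p ∈ V.inter σ → ((Cochain.val N σ p : ℤ) : ℂ) =
      Cochain.val c σ p - Cochain.val c' σ p - (g (σ 1) p - g (σ 0) p) := fun σ p hp => by
    rw [Cochain.val_of_mem N hp]
    exact (hnc σ ⟨p, hp⟩).symm
  refine CechH.mk_eq_mk hU hU' ⟨N, Cochain.ext_val fun σ p hp => ?_⟩
  have hpU := PointedCover.inter_mono hU σ hp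
  have hpU' := PointedCover.inter_mono hU' σ hp
  have hbv := congrArg (fun d => Cochain.val d σ p) hb
  have hbv' := congrArg (fun d => Cochain.val d σ p) hb'
  simp only [Cochain.val_onCochain _ _ hpU, Cochain.val_onCochain _ _ hpU',
    Cochain.val_cechD_one _ hpU, Cochain.val_cechD_one _ hpU'] at hbv hbv'
  change ((Cochain.val b.1 σ p : ℤ) : ℂ) = _ at hbv
  change ((Cochain.val b'.1 σ p : ℤ) : ℂ) = _ at hbv'
  rw [Cochain.val_cechD_one _ hp, Cochain.val_sub _ _ hp, Cochain.val_refine _ _ hp,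
    Cochain.val_refine _ _ hp]
  have hcast : ((Cochain.val N ![σ 1, σ 2] p - Cochain.val N ![σ 0, σ 2] p +
      Cochain.val N ![σ 0, σ 1] p : ℤ) : ℂ) =
      ((Cochain.val b.1 σ p - Cochain.val b'.1 σ p : ℤ) : ℂ) := by
    push_cast
    rw [hNv _ _ (mem_inter_pair hp 1 2), hNv _ _ (mem_inter_pair hp 0 2),
      hNv _ _ (mem_inter_pair hp 0 1), hbv, hbv']
    simp only [Matrix.cons_val]
    ring
  exact_mod_cast hcast

namespace ComplexLineBundle

variable {L : ComplexLineBundle.{u, v, w} E M}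

/-- The class of the transition functions is well defined. -/
theorem IsTransitionClass.eq {z z' : CechH (smoothSheafCStar E M) 1}
    (h : L.IsTransitionClass z) (h' : L.IsTransitionClass z') : z = z' := by
  obtain ⟨U, s, c, hs, hc, rfl⟩ := h
  obtain ⟨U', s', c', hs', hc', rfl⟩ := h'
  let W := U.inf U'
  have hU : U ≤ W := U.le_inf_left U'
  have hU' : U' ≤ W := U.le_inf_right U'
  have hg : ∀ x p, ∃ g : ℂ, p ∈ W.toOpens x → s' x p = g • s x p := fun x p => by
    by_cases hp : p ∈ W.toOpens x
    · obtain ⟨g, hg⟩ := exists_smul_eq ((hs x).2 p (hU x hp)) (s' x p)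
      exact ⟨g, fun _ => hg⟩
    · exact ⟨0, fun h => absurd h hp⟩
  choose g hg using hg
  have hg0 : ∀ x, ∀ p ∈ W.toOpens x, g x p ≠ 0 := fun x p hp h0 => by
    have h1 := hg x p hp
    rw [h0, zero_smul] at h1
    exact (hs' x).2 p (hU' x hp) h1
  have hgs : ∀ x, ContMDiffOn 𝓘(ℝ, E) 𝓘(ℝ, ℂ) ∞ (g x) (W.toOpens x) := fun x p hp => by
    refine (contMDiffAt_of_eq_smul
      ((hs x).1.contMDiffAt ((U.toOpens x).isOpen.mem_nhds (hU x hp)))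
      ((hs' x).1.contMDiffAt ((U'.toOpens x).isOpen.mem_nhds (hU' x hp)))
      ((hs x).2 p (hU x hp)) ?_).contMDiffWithinAt
    filter_upwards [(W.toOpens x).isOpen.mem_nhds hp] with q hq
    exact hg x q hq
  have hle : ∀ σ : Fin 1 → M, W.inter σ ≤ W.toOpens (σ 0) := fun σ p hp =>
    PointedCover.mem_inter.1 hp 0
  let t : Cochain (smoothSheafCStar E M) W 0 := Cochain.ofFun _ W (fun σ p => unitOf (g (σ 0) p))
    fun σ => unitOf_mem_sec ((hgs (σ 0)).mono (hle σ)) fun p hp => hg0 _ p (hle σ hp)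
  -- With g_x = s'_x / s_x the transition functions satisfy c'_{xy} g_x = g_y c_{xy}, which in
  -- additive notation is c' − c = δt; hence the primed class comes first.
  symm
  refine CechH.mk_eq_mk hU' hU ⟨t, Cochain.ext_val fun σ p hp => ?_⟩
  have hm := PointedCover.mem_inter.1 hp
  have htv : ∀ i, Cochain.val t ![σ i] p = unitOf (g (σ i) p) := fun i =>
    Cochain.val_ofFun _ (mem_inter_singleton.2 (hm i))
  rw [Cochain.val_cechD_zero _ hp, htv, htv, Cochain.val_sub _ _ hp, Cochain.val_refine _ _ hp,
    Cochain.val_refine _ _ hp]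
  refine sub_eq_sub_of_toMul ?_
  rw [toMul_unitOf (hg0 _ p (hm 1)), toMul_unitOf (hg0 _ p (hm 0))]
  obtain ⟨x, y, rfl⟩ : ∃ x y, σ = ![x, y] := ⟨σ 0, σ 1, by ext i; fin_cases i <;> rfl⟩
  have h1 := hc x y ⟨p, PointedCover.inter_mono hU _ hp⟩
  have h2 := hc' x y ⟨p, PointedCover.inter_mono hU' _ hp⟩
  rw [Cochain.val_of_mem c.1 (PointedCover.inter_mono hU _ hp),
    Cochain.val_of_mem c'.1 (PointedCover.inter_mono hU' _ hp)]
  simp only at h1 h2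
  rw [hg y p (hm 1), hg x p (hm 0), h1, smul_smul, smul_smul] at h2
  exact smul_left_injective ℂ ((hs x).2 p (hU x (hm 0))) h2

theorem IsFirstChernClass.eq {k k' : CechH (constSheaf M ℤ) 2} (h : L.IsFirstChernClass k)
    (h' : L.IsFirstChernClass k') : k = k' := by
  obtain ⟨z, hz, hk⟩ := h
  obtain ⟨z', hz', hk'⟩ := h'
  obtain rfl := hz.eq hz'
  exact hk.eq hk'

end ComplexLineBundle

end Manifold

/-! ### The Chern class of a line bundle with connection -/

section Manifold

variable {E : Type v} [NormedAddCommGroup E] [NormedSpace ℝ E]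
  {M : Type u} [TopologicalSpace M] [ChartedSpace E M] [IsManifold 𝓘(ℝ, E) ∞ M]

namespace ComplexLineBundle

variable {L : ComplexLineBundle.{u, v, w} E M}

/-- On a chart-convex open set the ratio of two frames with the same curvature is the exponential
of a primitive of the difference of the connection forms. -/
theorem Connection.exists_transition_eq_exp (D : L.Connection) {B : Opens M}
    (hB : IsChartConvex E B) {Ω : Form E M ℂ 2} {s t : ∀ x, L.Fiber x} {β θ : Form E M ℂ 1}
    (hs : IsFrameOn s B) (ht : IsFrameOn t B) (hβ : ∀ p ∈ B, β.SmoothAt p)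
    (hθ : ∀ p ∈ B, θ.SmoothAt p) (hβΩ : ∀ p ∈ B, β.d p = Ω p) (hθΩ : ∀ p ∈ B, θ.d p = Ω p)
    (hDs : ∀ p ∈ B, ∀ v : TangentSpace 𝓘(ℝ, E) p,
      D.toCovariantDerivative s p v = (2 * Real.pi * Complex.I * β p (fun _ => v)) • s p)
    (hDt : ∀ p ∈ B, ∀ v : TangentSpace 𝓘(ℝ, E) p,
      D.toCovariantDerivative t p v = (2 * Real.pi * Complex.I * θ p (fun _ => v)) • t p) :
    ∃ f : M → ℂ, ContMDiffOn 𝓘(ℝ, E) 𝓘(ℝ, ℂ) ∞ f B ∧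
      (∀ p ∈ B, ∀ v : TangentSpace 𝓘(ℝ, E) p,
        mvfderiv 𝓘(ℝ, E) f p v = θ p (fun _ => v) - β p (fun _ => v)) ∧
      ∀ p ∈ B, t p = Complex.exp (2 * Real.pi * Complex.I * f p) • s p := by
  have hg : ∀ p, ∃ g : ℂ, p ∈ B → t p = g • s p := fun p => by
    by_cases hp : p ∈ B
    · obtain ⟨g, hg⟩ := exists_smul_eq (hs.2 p hp) (t p)
      exact ⟨g, fun _ => hg⟩
    · exact ⟨0, fun h => absurd h hp⟩
  choose c hc using hg
  have hc0 : ∀ p ∈ B, c p ≠ 0 := fun p hp h0 => by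
    have h1 := hc p hp
    rw [h0, zero_smul] at h1
    exact ht.2 p hp h1
  have hce : ∀ p ∈ B, ∀ᶠ q in nhds p, t q = c q • s q := fun p hp => by
    filter_upwards [B.isOpen.mem_nhds hp] with q hq
    exact hc q hq
  have hsa := fun p (hp : p ∈ B) => hs.1.contMDiffAt (B.isOpen.mem_nhds hp)
  have hta := fun p (hp : p ∈ B) => ht.1.contMDiffAt (B.isOpen.mem_nhds hp)
  have hcs : ContMDiffOn 𝓘(ℝ, E) 𝓘(ℝ, ℂ) ∞ c B := fun p hp =>
    (contMDiffAt_of_eq_smul (hsa p hp) (hta p hp) (hs.2 p hp) (hce p hp)).contMDiffWithinAt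
  obtain ⟨f, hf, hfd⟩ := hB.exists_mvfderiv_eq (β := θ - β)
    (fun p hp => (hθ p hp).sub (hβ p hp))
    (fun p hp => by rw [Form.d_sub (hθ p hp) (hβ p hp), hθΩ p hp, hβΩ p hp, sub_self])
  obtain ⟨a, ha⟩ := hB.exists_eq_exp hcs hf hc0 fun p hp v => by
    rw [hfd p hp v]
    exact D.mvfderiv_transition (hsa p hp) (hta p hp) (hs.2 p hp) (hce p hp) (hDs p hp v)
      (hDt p hp v)
  -- The multiplicative constant left over by integration is absorbed into the primitive, which does
  -- not change its differential.
  refine ⟨f + fun _ => a, hf.add contMDiffOn_const, fun p hp v => ?_, fun p hp => ?_⟩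
  · rw [mvfderiv_add ((hf.contMDiffAt (B.isOpen.mem_nhds hp)).mdifferentiableAt (by simp))
      (contMDiffAt_const (n := 1).mdifferentiableAt (by simp)), mvfderiv_const, add_zero, hfd p hp v]
    rfl
  · rw [hc p hp, ha p hp]
    rfl

/-- The first Chern class of a line bundle with connection is represented by an integral cocycle
which also represents the Čech class of the (real) curvature form. -/
theorem exists_isFirstChernClass_and_potentials [T2Space M] [ParacompactSpace M]
    (D : L.Connection) {Ω : Form E M ℝ 2} (hD : D.IsCurvatureForm Ω.toComplex) :
    ∃ (W : PointedCover M) (α : M → Form E M ℝ 1) (f : M → M → M → ℝ) (h : Potentials Ω W α f)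
      (b : (cechD (constSheaf M ℤ) W 2).ker),
      L.IsFirstChernClass (CechH.mk W b) ∧ (intToReal M).onCocycle W 2 b = h.cocycle := by
  choose U s A hxU hs hA hDs hdA using hD
  obtain ⟨W, j, hWj, hW, hWc⟩ := PointedCover.exists_barycentric (exists_isChartConvex (E := E))
    ⟨U, hxU⟩
  -- As for potentials, when W_x and W_y meet the two frames are compared on all of the chart-convex
  -- set W_y; otherwise `F` is irrelevant and set to zero.
  have key : ∀ x y, ∃ F : M → ℂ,
      ContMDiffOn 𝓘(ℝ, E) 𝓘(ℝ, ℂ) ∞ F (W.toOpens x ∩ W.toOpens y : Set M) ∧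
      (∀ p, p ∈ W.toOpens x → p ∈ W.toOpens y → ∀ v : TangentSpace 𝓘(ℝ, E) p,
        mvfderiv 𝓘(ℝ, E) F p v = A (j y) p (fun _ => v) - A (j x) p (fun _ => v)) ∧
      ∀ p, p ∈ W.toOpens x → p ∈ W.toOpens y →
        s (j y) p = Complex.exp (2 * Real.pi * Complex.I * F p) • s (j x) p := by
    intro x y
    by_cases hxy : ∃ q, q ∈ W.toOpens x ∧ q ∈ W.toOpens y
    · obtain ⟨q, hqx, hqy⟩ := hxy
      have h1 : W.toOpens y ≤ U (j y) := hWj y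
      have h2 : W.toOpens y ≤ U (j x) := hW x y q hqx hqy
      obtain ⟨F, hF, hFd, hFe⟩ := D.exists_transition_eq_exp (hWc y)
        ⟨(hs (j x)).1.mono h2, fun p hp => (hs (j x)).2 p (h2 hp)⟩
        ⟨(hs (j y)).1.mono h1, fun p hp => (hs (j y)).2 p (h1 hp)⟩
        (fun p hp => hA (j x) p (h2 hp)) (fun p hp => hA (j y) p (h1 hp))
        (fun p hp => hdA (j x) p (h2 hp)) (fun p hp => hdA (j y) p (h1 hp))
        (fun p hp => hDs (j x) p (h2 hp)) (fun p hp => hDs (j y) p (h1 hp))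
      exact ⟨F, hF.mono Set.inter_subset_right, fun p _ hp => hFd p hp, fun p _ hp => hFe p hp⟩
    · push Not at hxy
      exact ⟨fun _ => 0, contMDiffOn_const, fun p hx hy => absurd hy (hxy p hx),
        fun p hx hy => absurd hy (hxy p hx)⟩
  choose F hF hFd hFe using key
  have hFa : ∀ x y p, p ∈ W.toOpens x → p ∈ W.toOpens y →
      ContMDiffAt 𝓘(ℝ, E) 𝓘(ℝ, ℂ) ∞ (F x y) p := fun x y p hx hy => (hF x y).contMDiffAt
    (((W.toOpens x).isOpen.inter (W.toOpens y).isOpen).mem_nhds ⟨hx, hy⟩)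
  have hs0 : ∀ x, ∀ p ∈ W.toOpens x, s (j x) p ≠ 0 := fun x p hp => (hs (j x)).2 p (hWj x hp)
  -- The ratios exp(2πi F) of nonvanishing frames multiply as a cocycle, so δF has trivial
  -- exponential and is integral by continuity.
  have hone : ∀ (σ : Fin 3 → M) (p : M), p ∈ W.inter σ →
      Complex.exp (2 * Real.pi * Complex.I *
        (F (σ 1) (σ 2) p - F (σ 0) (σ 2) p + F (σ 0) (σ 1) p)) = 1 := by
    intro σ p hp
    have hm := PointedCover.mem_inter.1 hp
    have h12 := hFe (σ 1) (σ 2) p (hm 1) (hm 2)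
    rw [hFe (σ 0) (σ 1) p (hm 0) (hm 1), hFe (σ 0) (σ 2) p (hm 0) (hm 2), smul_smul] at h12
    have h := smul_left_injective ℂ (hs0 (σ 0) p (hm 0)) h12
    rw [mul_add, mul_sub, Complex.exp_add, Complex.exp_sub, h, div_mul_eq_mul_div, div_self]
    exact mul_ne_zero (Complex.exp_ne_zero _) (Complex.exp_ne_zero _)
  have hn : ∀ σ : Fin 3 → M, ∃ n : W.inter σ → ℤ, IsLocallyConstant n ∧ ∀ p : W.inter σ,
      F (σ 1) (σ 2) p - F (σ 0) (σ 2) p + F (σ 0) (σ 1) p = n p := by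
    intro σ
    refine exists_int_of_exp_eq_one (X := W.inter σ) (f := fun p => F (σ 1) (σ 2) p -
      F (σ 0) (σ 2) p + F (σ 0) (σ 1) p) ?_ fun p => hone σ p p.2
    have h : ∀ i k, Continuous fun p : W.inter σ => F (σ i) (σ k) p := fun i k =>
      ((hF (σ i) (σ k)).mono fun p hp => ⟨PointedCover.mem_inter.1 hp i,
        PointedCover.mem_inter.1 hp k⟩).continuousOn.domRestrict
    exact ((h 1 2).sub (h 0 2)).add (h 0 1)
  choose n hnl hnF using hn
  let N : Cochain (constSheaf M ℤ) W 2 := fun σ => ⟨n σ, hnl σ⟩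
  have hNv : ∀ (σ : Fin 3 → M) (p : M), p ∈ W.inter σ → ((Cochain.val N σ p : ℤ) : ℂ) =
      F (σ 1) (σ 2) p - F (σ 0) (σ 2) p + F (σ 0) (σ 1) p := fun σ p hp => by
    rw [Cochain.val_of_mem N hp]
    exact (hnF σ ⟨p, hp⟩).symm
  have hN : N ∈ (cechD (constSheaf M ℤ) W 2).ker := by
    rw [AddMonoidHom.mem_ker]
    refine Cochain.ext_val fun σ p hp => ?_
    rw [Cochain.val_cechD_two _ hp, Cochain.val_zero]
    have hcast : ((Cochain.val N ![σ 1, σ 2, σ 3] p - Cochain.val N ![σ 0, σ 2, σ 3] p +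
        Cochain.val N ![σ 0, σ 1, σ 3] p - Cochain.val N ![σ 0, σ 1, σ 2] p : ℤ) : ℂ) = (0 : ℤ) := by
      push_cast
      rw [hNv _ _ (mem_inter_triple hp 1 2 3), hNv _ _ (mem_inter_triple hp 0 2 3),
        hNv _ _ (mem_inter_triple hp 0 1 3), hNv _ _ (mem_inter_triple hp 0 1 2)]
      simp only [Matrix.cons_val]
      ring
    exact_mod_cast hcast
  let c : Cochain (smoothSheafC E M) W 1 := Cochain.ofFun _ W (fun σ => F (σ 0) (σ 1)) fun σ =>
    ((hF (σ 0) (σ 1)).mono fun p hp => ⟨PointedCover.mem_inter.1 hp 0,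
      PointedCover.mem_inter.1 hp 1⟩ : ContMDiffOn _ _ _ _ (W.inter σ : Set M)).contMDiff_restrict
  have hcv : ∀ (σ : Fin 3 → M) (p : M), p ∈ W.inter σ → ∀ i k,
      Cochain.val c ![σ i, σ k] p = F (σ i) (σ k) p := fun σ p hp i k =>
    Cochain.val_ofFun _ (mem_inter_pair hp i k)
  have hec : (expHom E M).onCochain W 1 c ∈ (cechD (smoothSheafCStar E M) W 1).ker := by
    rw [AddMonoidHom.mem_ker, ← FunctionPresheaf.Hom.onCochain_cechD]
    refine Cochain.ext_val fun σ p hp => ?_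
    rw [Cochain.val_onCochain _ _ hp, Cochain.val_cechD_one _ hp, hcv σ p hp, hcv σ p hp,
      hcv σ p hp, Cochain.val_zero]
    exact Additive.toMul.injective (Units.ext (hone σ p hp))
  have hiN : (intToSmooth E M).onCochain W 2 N = cechD (smoothSheafC E M) W 1 c := by
    refine Cochain.ext_val fun σ p hp => ?_
    rw [Cochain.val_onCochain _ _ hp, Cochain.val_cechD_one _ hp, hcv σ p hp, hcv σ p hp,
      hcv σ p hp]
    exact hNv σ p hp
  -- The frames need not have unit length, so the connection forms and `F` are complex. Since Ω is
  -- real, their real parts are still potentials, and taking real parts does not change the integral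
  -- cocycle δF.
  have hpot : Potentials Ω W (fun x => Form.postcomp Complex.reCLM (A (j x)))
      (fun x y p => (F x y p).re) := by
    refine ⟨fun x p hp => (hA (j x) p (hWj x hp)).postcomp _, fun x p hp => ?_, fun x y => ?_,
      fun x y p hx hy v => ?_⟩
    · rw [Form.d_postcomp _ (hA (j x) p (hWj x hp)), hdA (j x) p (hWj x hp)]
      ext v
      exact Complex.ofReal_re _
    · exact Complex.reCLM.contMDiff.comp_contMDiffOn (hF x y)
    · refine Eq.trans ?_ (mvfderiv_comp_hasFDerivAt (Complex.reCLM.hasFDerivAt (x := F x y p))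
        ((hFa x y p hx hy).mdifferentiableAt (by simp)) v).symm
      rw [hFd x y p hx hy v]
      exact (Complex.sub_re _ _).symm
  -- The cochain `c` formed from `F` is a lift of the transition cocycle through the exponential,
  -- and `hiN` says that its coboundary is `N`: this is precisely a representation of the first
  -- Chern class.
  refine ⟨W, _, _, hpot, ⟨N, hN⟩, ⟨CechH.mk W ⟨_, hec⟩, ⟨W, fun x => s (j x), ⟨_, hec⟩,
    fun x => ⟨(hs (j x)).1.mono (hWj x), hs0 x⟩, fun x y p => ?_, rfl⟩,
    W, c, hec, ⟨N, hN⟩, rfl, hiN, rfl⟩, Subtype.ext (Cochain.ext_val fun σ p hp => ?_)⟩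
  · have hm := PointedCover.mem_inter.1 p.2
    exact hFe x y p (hm 0) (hm 1)
  · refine Eq.trans ?_ (hpot.val_cochain hp).symm
    refine (Cochain.val_onCochain (intToReal M) N hp).trans ?_
    have h := congrArg Complex.re (hNv σ p hp)
    rw [Complex.intCast_re, Complex.add_re, Complex.sub_re] at h
    exact h

end ComplexLineBundle

end Manifold

/-! ### Metric and covariant derivative for unitary transition functions -/

section Manifold

variable {E : Type v} [NormedAddCommGroup E] [NormedSpace ℝ E]
  {M : Type u} [TopologicalSpace M] [ChartedSpace E M]

/-- A 1-form at a point as a linear map. -/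
def Form.toCLM (η : Form E M ℝ 1) (p : M) : TangentSpace 𝓘(ℝ, E) p →L[ℝ] ℝ :=
  (ContinuousAlternatingMap.ofSubsingleton ℝ (TangentSpace 𝓘(ℝ, E) p) ℝ (0 : Fin 1)).symm (η p)

theorem exp_two_pi_I_mul_conj (t : ℝ) :
    Complex.exp (2 * Real.pi * Complex.I * t) *
      starRingEnd ℂ (Complex.exp (2 * Real.pi * Complex.I * t)) = 1 := by
  have h2 : starRingEnd ℂ 2 = 2 := map_ofNat _ 2
  rw [← Complex.exp_conj, ← Complex.exp_add]
  simp [h2]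

theorem mvfderiv_ofReal {f : M → ℝ} {p : M} (hf : MDifferentiableAt 𝓘(ℝ, E) 𝓘(ℝ, ℝ) f p)
    (v : TangentSpace 𝓘(ℝ, E) p) :
    mvfderiv 𝓘(ℝ, E) (fun q => (f q : ℂ)) p v = (mvfderiv 𝓘(ℝ, E) f p v : ℝ) :=
  mvfderiv_comp_hasFDerivAt (Complex.ofRealCLM.hasFDerivAt (x := f p)) hf v

theorem mvfderiv_conj {f : M → ℂ} {p : M} (hf : MDifferentiableAt 𝓘(ℝ, E) 𝓘(ℝ, ℂ) f p)
    (v : TangentSpace 𝓘(ℝ, E) p) :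
    mvfderiv 𝓘(ℝ, E) (fun q => starRingEnd ℂ (f q)) p v =
      starRingEnd ℂ (mvfderiv 𝓘(ℝ, E) f p v) :=
  mvfderiv_comp_hasFDerivAt (Complex.conjCLE.toContinuousLinearMap.hasFDerivAt (x := f p)) hf v

namespace ComplexLineBundle

variable (L : ComplexLineBundle.{u, v, w} E M)

/-- The preferred trivializations of the line bundle are related by the transition functions
`exp(2πi f_{xy})`. -/
structure HasTransitions (W : PointedCover M) (f : M → M → M → ℝ) : Prop where
  baseSet_eq : ∀ x, (trivializationAt ℂ L.Fiber x).baseSet = W.toOpens x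
  trivialization_eq : ∀ x y p, p ∈ W.toOpens x → p ∈ W.toOpens y → ∀ a : L.Fiber p,
    (trivializationAt ℂ L.Fiber x ⟨p, a⟩).2 =
      Complex.exp (2 * Real.pi * Complex.I * f x y p) * (trivializationAt ℂ L.Fiber y ⟨p, a⟩).2

variable {L}

/-- The coordinate of a section in the preferred trivialization at `x`. -/
def coord (s : ∀ x, L.Fiber x) (x : M) : M → ℂ := fun q =>
  (trivializationAt ℂ L.Fiber x ⟨q, s q⟩).2

theorem mem_baseSet (p : M) : p ∈ (trivializationAt ℂ L.Fiber p).baseSet :=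
  FiberBundle.mem_baseSet_trivializationAt' p

theorem trivialization_injective {x q : M} (hq : q ∈ (trivializationAt ℂ L.Fiber x).baseSet)
    {a b : L.Fiber q} (h : (trivializationAt ℂ L.Fiber x ⟨q, a⟩).2 =
      (trivializationAt ℂ L.Fiber x ⟨q, b⟩).2) : a = b :=
  ((trivializationAt ℂ L.Fiber x).continuousLinearEquivAt ℂ q hq).injective h

theorem trivialization_add {x q : M} (hq : q ∈ (trivializationAt ℂ L.Fiber x).baseSet)
    (a b : L.Fiber q) : (trivializationAt ℂ L.Fiber x ⟨q, a + b⟩).2 =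
      (trivializationAt ℂ L.Fiber x ⟨q, a⟩).2 + (trivializationAt ℂ L.Fiber x ⟨q, b⟩).2 :=
  ((trivializationAt ℂ L.Fiber x).linear ℂ hq).map_add a b

theorem trivialization_real_smul {x q : M} (hq : q ∈ (trivializationAt ℂ L.Fiber x).baseSet)
    (r : ℝ) (a : L.Fiber q) : (trivializationAt ℂ L.Fiber x ⟨q, r • a⟩).2 =
      r * (trivializationAt ℂ L.Fiber x ⟨q, a⟩).2 :=
  trivialization_smul hq (r : ℂ) a

theorem mdifferentiableAt_coord {s : ∀ x, L.Fiber x} {x p : M}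
    (hs : MDifferentiableAt 𝓘(ℝ, E) (𝓘(ℝ, E).prod 𝓘(ℝ, ℂ)) (toTotal s) p)
    (hp : p ∈ (trivializationAt ℂ L.Fiber x).baseSet) :
    MDifferentiableAt 𝓘(ℝ, E) 𝓘(ℝ, ℂ) (coord s x) p :=
  ((trivializationAt ℂ L.Fiber x).mdifferentiableAt_section_iff 𝓘(ℝ, E) s hp).1 hs

theorem contMDiffAt_coord_iff {s : ∀ x, L.Fiber x} {x p : M}
    (hp : p ∈ (trivializationAt ℂ L.Fiber x).baseSet) :
    ContMDiffAt 𝓘(ℝ, E) 𝓘(ℝ, ℂ) ∞ (coord s x) p ↔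
      ContMDiffAt 𝓘(ℝ, E) (𝓘(ℝ, E).prod 𝓘(ℝ, ℂ)) ∞ (toTotal s) p :=
  ((trivializationAt ℂ L.Fiber x).contMDiffAt_section_iff hp).symm

variable {W : PointedCover M} {f : M → M → M → ℝ}

theorem HasTransitions.mem (hL : L.HasTransitions W f) {x p : M} (hp : p ∈ W.toOpens x) :
    p ∈ (trivializationAt ℂ L.Fiber x).baseSet := by
  rw [hL.baseSet_eq]
  exact hp

section Metric

/-- Because `f` is real the transition function has modulus one and drops out of the product of one
coordinate with the conjugate of another. -/
theorem HasTransitions.mul_conj_eq (hL : L.HasTransitions W f) {x p : M} (hp : p ∈ W.toOpens x)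
    (a b : L.Fiber p) :
    (trivializationAt ℂ L.Fiber p ⟨p, a⟩).2 *
      starRingEnd ℂ (trivializationAt ℂ L.Fiber p ⟨p, b⟩).2 =
    (trivializationAt ℂ L.Fiber x ⟨p, a⟩).2 *
      starRingEnd ℂ (trivializationAt ℂ L.Fiber x ⟨p, b⟩).2 := by
  rw [hL.trivialization_eq x p p hp (W.mem p) a, hL.trivialization_eq x p p hp (W.mem p) b,
    map_mul]
  linear_combination (-(trivializationAt ℂ L.Fiber p ⟨p, a⟩).2 *
    starRingEnd ℂ (trivializationAt ℂ L.Fiber p ⟨p, b⟩).2) * exp_two_pi_I_mul_conj (f x p p)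

theorem _root_.ContMDiffAt.complex_conj {g : M → ℂ} {p : M}
    (hg : ContMDiffAt 𝓘(ℝ, E) 𝓘(ℝ, ℂ) ∞ g p) :
    ContMDiffAt 𝓘(ℝ, E) 𝓘(ℝ, ℂ) ∞ (fun q => starRingEnd ℂ (g q)) p :=
  ContDiffAt.comp_contMDiffAt (g := fun z : ℂ => starRingEnd ℂ z)
    Complex.conjCLE.contDiff.contDiffAt hg

/-- The hermitian metric on a line bundle with transition functions of modulus one. -/
def HasTransitions.metric (hL : L.HasTransitions W f) : L.HermitianMetric where
  toFun p := LinearMap.mk₂'ₛₗ (RingHom.id ℂ) (starRingEnd ℂ)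
    (fun a b => (trivializationAt ℂ L.Fiber p ⟨p, a⟩).2 *
      starRingEnd ℂ (trivializationAt ℂ L.Fiber p ⟨p, b⟩).2)
    (fun a a' b => by rw [trivialization_add (mem_baseSet p), add_mul])
    (fun c a b => by rw [trivialization_smul (mem_baseSet p), mul_assoc]; rfl)
    (fun a b b' => by rw [trivialization_add (mem_baseSet p), map_add, mul_add])
    (fun c a b => by
      rw [trivialization_smul (mem_baseSet p), map_mul, mul_left_comm]; rfl)
  conj_symm p a b := by
    simp only [LinearMap.mk₂'ₛₗ_apply, map_mul, Complex.conj_conj]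
    exact mul_comm _ _
  pos p a ha := by
    simp only [LinearMap.mk₂'ₛₗ_apply, Complex.mul_conj, Complex.ofReal_re]
    exact Complex.normSq_pos.2 (trivialization_ne_zero (mem_baseSet p) ha)
  -- The form at a point `q` is defined through the trivialization at `q`, which changes with `q`.
  -- Near `p` it is rewritten in the single trivialization at `p`, where smoothness is visible.
  smooth s t p hs ht := by
    have h := ((contMDiffAt_coord_iff (mem_baseSet p)).2 hs).complex_mul
      ((contMDiffAt_coord_iff (mem_baseSet p)).2 ht).complex_conj
    refine h.congr_of_eventuallyEq ?_
    filter_upwards [(W.toOpens p).isOpen.mem_nhds (W.mem p)] with q hq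
    exact hL.mul_conj_eq hq _ _

theorem HasTransitions.metric_apply (hL : L.HasTransitions W f) {x p : M} (hp : p ∈ W.toOpens x)
    (s t : ∀ x, L.Fiber x) :
    hL.metric.toFun p (s p) (t p) = coord s x p * starRingEnd ℂ (coord t x p) :=
  hL.mul_conj_eq hp _ _

end Metric

section Connection

/-- The covariant derivative with connection forms `αₓ` in the preferred trivializations. -/
def covariantDeriv (α : M → Form E M ℝ 1) (s : ∀ x, L.Fiber x) (p : M) :
    TangentSpace 𝓘(ℝ, E) p →L[ℝ] L.Fiber p :=
  ((trivializationAt ℂ L.Fiber p).symmL ℝ p).comp (mvfderiv 𝓘(ℝ, E) (coord s p) p +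
    ((α p).toCLM p).smulRight (2 * Real.pi * Complex.I * coord s p p))

theorem trivialization_covariantDeriv_self (α : M → Form E M ℝ 1) (s : ∀ x, L.Fiber x) (p : M)
    (v : TangentSpace 𝓘(ℝ, E) p) :
    (trivializationAt ℂ L.Fiber p ⟨p, covariantDeriv α s p v⟩).2 =
      mvfderiv 𝓘(ℝ, E) (coord s p) p v +
        2 * Real.pi * Complex.I * (α p p fun _ => v) * coord s p p := by
  have h := congrArg Prod.snd ((trivializationAt ℂ L.Fiber p).apply_mk_symm (mem_baseSet p)
    (mvfderiv 𝓘(ℝ, E) (coord s p) p v +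
      (α p).toCLM p v • (2 * Real.pi * Complex.I * coord s p p)))
  rw [Complex.real_smul] at h
  refine Eq.trans ?_ (h.trans ?_)
  · rw [← Complex.real_smul, ← Trivialization.symmL_apply (R := ℝ) _ (mem_baseSet p)]
    rfl
  · change _ + ((α p p fun _ => v : ℝ) : ℂ) * _ = _
    ring

variable {Ω : Form E M ℝ 2} {α : M → Form E M ℝ 1}

/-- Gauge invariance: the coordinate at `x` is exp(2πi f_{xp}) times the coordinate at `p`, and
differentiating the factor contributes 2πi (α_p − α_x), which turns `α p` into `α x`. So a
definition made pointwise with a varying trivialization holds in a fixed one. -/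
theorem HasTransitions.trivialization_covariantDeriv (hL : L.HasTransitions W f)
    (h : Potentials Ω W α f) {s : ∀ x, L.Fiber x} {x p : M} (hp : p ∈ W.toOpens x)
    (hs : MDifferentiableAt 𝓘(ℝ, E) (𝓘(ℝ, E).prod 𝓘(ℝ, ℂ)) (toTotal s) p)
    (v : TangentSpace 𝓘(ℝ, E) p) :
    (trivializationAt ℂ L.Fiber x ⟨p, covariantDeriv α s p v⟩).2 =
      mvfderiv 𝓘(ℝ, E) (coord s x) p v +
        2 * Real.pi * Complex.I * (α x p fun _ => v) * coord s x p := by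
  have hev : coord s x =ᶠ[nhds p] fun q =>
      Complex.exp (2 * Real.pi * Complex.I * f x p q) * coord s p q := by
    filter_upwards [(W.toOpens x).isOpen.mem_nhds hp, (W.toOpens p).isOpen.mem_nhds (W.mem p)]
      with q hqx hqp
    exact hL.trivialization_eq x p q hqx hqp _
  have hf := h.contMDiffAt hp (W.mem p)
  have hfc : ContMDiffAt 𝓘(ℝ, E) 𝓘(ℝ, ℂ) ∞ (fun q => (f x p q : ℂ)) p :=
    ContDiffAt.comp_contMDiffAt (g := fun t : ℝ => (t : ℂ)) Complex.ofRealCLM.contDiff.contDiffAt hf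
  have hd := (hev.mvfderiv_eq v).trans (mvfderiv_complex_mul
    (hfc.cexp_two_pi_I.mdifferentiableAt (by simp)) (mdifferentiableAt_coord hs (mem_baseSet p)) v)
  rw [mvfderiv_cexp_two_pi_I (hfc.mdifferentiableAt (by simp)),
    mvfderiv_ofReal (hf.mdifferentiableAt (by simp)), ← h.mvfderiv_eq x p p hp (W.mem p)] at hd
  rw [hd, hL.trivialization_eq x p p hp (W.mem p), trivialization_covariantDeriv_self,
    hev.eq_of_nhds]
  push_cast
  ring

variable [IsManifold 𝓘(ℝ, E) ∞ M]

/-- Bundle coordinates on TM are differentials of charts. This translates coordinates in the bundle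
Hom(TM, L) into chart expressions of forms. -/
theorem symmL_tangent_eq {x₀ : M} {y : E} (hy : y ∈ (extChartAt 𝓘(ℝ, E) x₀).target) (v : E) :
    (trivializationAt E (TangentSpace 𝓘(ℝ, E)) x₀).symmL ℝ ((extChartAt 𝓘(ℝ, E) x₀).symm y) v =
      mfderiv 𝓘(ℝ, E) 𝓘(ℝ, E) (extChartAt 𝓘(ℝ, E) x₀).symm y v := by
  have hs : (extChartAt 𝓘(ℝ, E) x₀).symm y ∈ (chartAt E x₀).source := by
    rw [← extChartAt_source 𝓘(ℝ, E)]
    exact (extChartAt 𝓘(ℝ, E) x₀).map_target hy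
  have h := TangentBundle.symmL_trivializationAt (I := 𝓘(ℝ, E)) hs
  have key : ∀ z, z = y → (mfderivWithin 𝓘(ℝ, E) 𝓘(ℝ, E) (extChartAt 𝓘(ℝ, E) x₀).symm
      (Set.range 𝓘(ℝ, E)) z : E →L[ℝ] E) v =
      (mfderiv 𝓘(ℝ, E) 𝓘(ℝ, E) (extChartAt 𝓘(ℝ, E) x₀).symm y : E →L[ℝ] E) v := by
    rintro z rfl
    rw [modelWithCornersSelf_coe, Set.range_id, mfderivWithin_univ]
  exact (DFunLike.congr_fun h v).trans (key _ ((extChartAt 𝓘(ℝ, E) x₀).right_inv hy))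

/-- In the coordinates of Hom(TM, L) at the fixed point `x₀`, the derivative of `s` becomes dS + 2πi
α S with `S` the local coordinate of `s` and α the chart expression of `α x₀`, and this is smooth.
Smoothness of `s` near `x₀`, not only at it, is used to apply the gauge formula at nearby points. -/
theorem HasTransitions.contMDiffAt_covariantDeriv (hL : L.HasTransitions W f)
    (h : Potentials Ω W α f) {s : ∀ x, L.Fiber x} {x₀ : M}
    (hs : ∀ᶠ p in nhds x₀, ContMDiffAt 𝓘(ℝ, E) (𝓘(ℝ, E).prod 𝓘(ℝ, ℂ)) ∞ (toTotal s) p) :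
    ContMDiffAt 𝓘(ℝ, E) (𝓘(ℝ, E).prod 𝓘(ℝ, E →L[ℝ] ℂ)) ∞
      (fun p => (⟨p, covariantDeriv α s p⟩ : TotalSpace (E →L[ℝ] ℂ)
        fun x => TangentSpace 𝓘(ℝ, E) x →L[ℝ] L.Fiber x)) x₀ := by
  refine (contMDiffAt_hom_bundle _).2 ⟨contMDiffAt_id, ?_⟩
  set φ := extChartAt 𝓘(ℝ, E) x₀ with hφ
  have hx₀ : x₀ ∈ φ.source := mem_extChartAt_source x₀
  let e := (ContinuousAlternatingMap.ofSubsingletonLIE (𝕜 := ℝ) (E := E) (F := ℝ) (0 : Fin 1)).symm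
  let S : E → ℂ := fun y => coord s x₀ (φ.symm y)
  let G : E → E →L[ℝ] ℂ := fun y => fderiv ℝ S y +
    (e ((α x₀).inChart x₀ y)).smulRight (2 * Real.pi * Complex.I * S y)
  have hφs : ContMDiffAt 𝓘(ℝ, E) 𝓘(ℝ, E) ∞ φ.symm (φ x₀) :=
    contMDiffAt_extChartAt_symm (φ.map_source hx₀)
  have hS : ContDiffAt ℝ ∞ S (φ x₀) := by
    have h1 : ContMDiffAt 𝓘(ℝ, E) 𝓘(ℝ, ℂ) ∞ (coord s x₀) (φ.symm (φ x₀)) := by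
      rw [φ.left_inv hx₀]
      exact (contMDiffAt_coord_iff (mem_baseSet x₀)).2 hs.self_of_nhds
    exact contMDiffAt_iff_contDiffAt.1 (h1.comp (φ x₀) hφs)
  have hG : ContDiffAt ℝ ∞ G (φ x₀) := by
    refine (hS.fderiv_right (by simp)).add ?_
    have h1 : ContDiffAt ℝ ∞ (fun y => e ((α x₀).inChart x₀ y)) (φ x₀) :=
      e.contDiff.contDiffAt.comp _ (h.smoothAt x₀ x₀ (W.mem x₀))
    exact h1.smulRight (contDiffAt_const.mul hS)
  have key : ∀ y ∈ φ.target, φ.symm y ∈ W.toOpens x₀ →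
      ContMDiffAt 𝓘(ℝ, E) (𝓘(ℝ, E).prod 𝓘(ℝ, ℂ)) ∞ (toTotal s) (φ.symm y) →
      ContinuousLinearMap.inCoordinates E (TangentSpace 𝓘(ℝ, E)) ℂ L.Fiber x₀ (φ.symm y) x₀
        (φ.symm y) (covariantDeriv α s (φ.symm y)) = G y := by
    intro y hy hyW hsy
    ext v
    have hsd := hsy.mdifferentiableAt (n := ∞) (by simp)
    have h1 := hL.trivialization_covariantDeriv h hyW hsd
      ((trivializationAt E (TangentSpace 𝓘(ℝ, E)) x₀).symmL ℝ (φ.symm y) v)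
    have h2 := Trivialization.continuousLinearMapAt_apply_of_mem ℝ (trivializationAt ℂ L.Fiber x₀)
      (hL.mem hyW) (covariantDeriv α s (φ.symm y)
        ((trivializationAt E (TangentSpace 𝓘(ℝ, E)) x₀).symmL ℝ (φ.symm y) v))
    refine (h2.trans h1).trans ?_
    rw [symmL_tangent_eq hy]
    have h3 := mvfderiv_comp_apply_mfderiv (mdifferentiableAt_coord hsd (hL.mem hyW))
      ((contMDiffAt_extChartAt_symm hy).mdifferentiableAt (by simp)) v
    rw [← h3]
    refine congrArg₂ (· + ·) (mvfderiv_vectorSpace v) ?_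
    change 2 * Real.pi * Complex.I * (((α x₀).inChart x₀ y fun _ => v : ℝ) : ℂ) * S y =
      ((α x₀).inChart x₀ y fun _ => v : ℝ) • (2 * Real.pi * Complex.I * S y)
    rw [Complex.real_smul]
    ring
  have hGφ : ContMDiffAt 𝓘(ℝ, E) 𝓘(ℝ, E →L[ℝ] ℂ) ∞ (fun p => G (φ p)) x₀ :=
    ContDiffAt.comp_contMDiffAt hG (contMDiffAt_extChartAt_of_mem hx₀)
  refine hGφ.congr_of_eventuallyEq ?_
  filter_upwards [hs, (isOpen_extChartAt_source x₀).mem_nhds hx₀,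
    (W.toOpens x₀).isOpen.mem_nhds (W.mem x₀)] with p hps hpφ hpW
  have hk := key (φ p) (φ.map_source hpφ)
  rw [φ.left_inv hpφ] at hk
  exact hk hpW hps

end Connection

end ComplexLineBundle

end Manifold

/-! ### The glued connection, its compatibility with the metric and its curvature -/

section Manifold

variable {E : Type v} [NormedAddCommGroup E] [NormedSpace ℝ E]
  {M : Type u} [TopologicalSpace M] [ChartedSpace E M] [IsManifold 𝓘(ℝ, E) ∞ M]

namespace ComplexLineBundle

variable {L : ComplexLineBundle.{u, v, w} E M} {W : PointedCover M} {f : M → M → M → ℝ}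
  {Ω : Form E M ℝ 2} {α : M → Form E M ℝ 1}

/-- The connection with connection forms `αₓ` in the preferred trivializations. -/
def HasTransitions.connection (hL : L.HasTransitions W f) (h : Potentials Ω W α f) :
    L.Connection where
  toCovariantDerivative :=
    { toFun := covariantDeriv α
      isCovariantDerivativeOnUniv :=
        { add := fun {s t p} hs ht _ => by
            ext v
            refine trivialization_injective (mem_baseSet p) ?_
            have hev : coord (s + t) p =ᶠ[nhds p] coord s p + coord t p := by
              filter_upwards [(trivializationAt ℂ L.Fiber p).open_baseSet.mem_nhds
                (mem_baseSet p)] with q hq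
              exact trivialization_add hq _ _
            have hd := hev.mvfderiv_eq v
            rw [mvfderiv_add (mdifferentiableAt_coord hs (mem_baseSet p))
              (mdifferentiableAt_coord ht (mem_baseSet p))] at hd
            rw [add_apply, trivialization_add (mem_baseSet p),
              trivialization_covariantDeriv_self, trivialization_covariantDeriv_self,
              trivialization_covariantDeriv_self, hd, hev.eq_of_nhds, Pi.add_apply,
              add_apply]
            ring
          leibniz := fun {s g p} hs hg _ => by
            ext v
            refine trivialization_injective (mem_baseSet p) ?_
            have hev : coord (g • s) p =ᶠ[nhds p] g • coord s p := by
              filter_upwards [(trivializationAt ℂ L.Fiber p).open_baseSet.mem_nhds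
                (mem_baseSet p)] with q hq
              exact (trivialization_real_smul hq _ _).trans (Complex.real_smul ..).symm
            have hd := hev.mvfderiv_eq v
            rw [mvfderiv_smul hg (mdifferentiableAt_coord hs (mem_baseSet p))] at hd
            rw [add_apply, trivialization_add (mem_baseSet p),
              smul_apply, ContinuousLinearMap.smulRight_apply,
              trivialization_real_smul (mem_baseSet p), trivialization_real_smul (mem_baseSet p),
              trivialization_covariantDeriv_self, trivialization_covariantDeriv_self, hd,
              hev.eq_of_nhds, add_apply, smul_apply,
              ContinuousLinearMap.smulRight_apply, Complex.real_smul, Complex.real_smul]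
            change _ + _ * ((g p : ℝ) • coord s p p) = _ + _ * coord s p p
            rw [Complex.real_smul]
            ring } }
  smooth :=
    { contMDiff :=
        { contMDiff := fun {s} hs p _ => by
            refine (hL.contMDiffAt_covariantDeriv h (s := s) ?_).contMDiffWithinAt
            exact Filter.Eventually.of_forall fun q => (hs q trivial).contMDiffAt Filter.univ_mem } }
  leibniz s g p hs hg v := by
    refine trivialization_injective (mem_baseSet p) ?_
    have hev : coord (fun y => g y • s y) p =ᶠ[nhds p] fun q => g q * coord s p q := by
      filter_upwards [(trivializationAt ℂ L.Fiber p).open_baseSet.mem_nhds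
        (mem_baseSet p)] with q hq
      exact trivialization_smul hq _ _
    have hd := (hev.mvfderiv_eq v).trans
      (mvfderiv_complex_mul hg (mdifferentiableAt_coord hs (mem_baseSet p)) v)
    rw [trivialization_add (mem_baseSet p), trivialization_smul (mem_baseSet p),
      trivialization_smul (mem_baseSet p)]
    refine (trivialization_covariantDeriv_self _ _ _ _).trans ?_
    rw [hd, hev.eq_of_nhds, trivialization_covariantDeriv_self]
    change _ = _ * coord s p p + _
    ring

/-- Since `α` is real, 2πi α is purely imaginary, and its contributions from the two arguments of
the metric cancel. -/
theorem HasTransitions.connection_isHermitian (hL : L.HasTransitions W f)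
    (h : Potentials Ω W α f) : (hL.connection h).IsHermitian hL.metric := by
  intro s t p hs ht v
  have hs' := mdifferentiableAt_coord hs (mem_baseSet p)
  have ht' := mdifferentiableAt_coord ht (mem_baseSet p)
  have hev : (fun y => hL.metric.toFun y (s y) (t y)) =ᶠ[nhds p]
      fun q => coord s p q * starRingEnd ℂ (coord t p q) := by
    filter_upwards [(W.toOpens p).isOpen.mem_nhds (W.mem p)] with q hq
    exact hL.metric_apply hq s t
  have htc : MDifferentiableAt 𝓘(ℝ, E) 𝓘(ℝ, ℂ) (fun q => starRingEnd ℂ (coord t p q)) p :=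
    (Complex.conjCLE.toContinuousLinearMap.hasFDerivAt
      (x := coord t p p)).differentiableAt.mdifferentiableAt.comp p ht'
  have hd := (hev.mvfderiv_eq v).trans (mvfderiv_complex_mul hs' htc v)
  rw [mvfderiv_conj ht'] at hd
  refine hd.trans ?_
  change _ = (trivializationAt ℂ L.Fiber p ⟨p, covariantDeriv α s p v⟩).2 *
      starRingEnd ℂ (coord t p p) + coord s p p *
      starRingEnd ℂ (trivializationAt ℂ L.Fiber p ⟨p, covariantDeriv α t p v⟩).2
  rw [trivialization_covariantDeriv_self, trivialization_covariantDeriv_self]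
  have h2 : starRingEnd ℂ 2 = 2 := map_ofNat _ 2
  simp only [map_add, map_mul, Complex.conj_I, Complex.conj_ofReal, h2]
  ring

/-- The frame with constant coordinate 1 in the trivialization at `x` has ∇s = 2πi α_x s, since the
differential of its coordinate vanishes. -/
theorem HasTransitions.connection_isCurvatureForm (hL : L.HasTransitions W f)
    (h : Potentials Ω W α f) : (hL.connection h).IsCurvatureForm Ω.toComplex := by
  intro x
  have hone : ∀ q ∈ W.toOpens x,
      coord (fun q => (trivializationAt ℂ L.Fiber x).symm q (1 : ℂ)) x q = 1 := fun q hq =>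
    congrArg Prod.snd ((trivializationAt ℂ L.Fiber x).apply_mk_symm (hL.mem hq) (1 : ℂ))
  have hsm : ∀ q ∈ W.toOpens x, ContMDiffAt 𝓘(ℝ, E) (𝓘(ℝ, E).prod 𝓘(ℝ, ℂ)) ∞
      (toTotal fun q => (trivializationAt ℂ L.Fiber x).symm q (1 : ℂ)) q := fun q hq => by
    refine (contMDiffAt_coord_iff (hL.mem hq)).1 (contMDiffAt_const (c := (1 : ℂ)) |>.congr_of_eventuallyEq ?_)
    filter_upwards [(W.toOpens x).isOpen.mem_nhds hq] with r hr
    exact hone r hr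
  refine ⟨W.toOpens x, fun q => (trivializationAt ℂ L.Fiber x).symm q (1 : ℂ), (α x).toComplex,
    W.mem x, ⟨fun q hq => (hsm q hq).contMDiffWithinAt, fun q hq h0 => ?_⟩,
    fun q hq => (h.smoothAt x q hq).postcomp Complex.ofRealCLM, fun q hq v => ?_, fun q hq => ?_⟩
  · have h1 := hone q hq
    have h2 := trivialization_smul (hL.mem hq) (0 : ℂ)
      ((trivializationAt ℂ L.Fiber x).symm q (1 : ℂ))
    rw [zero_smul, zero_mul, ← h0] at h2
    exact one_ne_zero (h1.symm.trans h2)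
  · refine trivialization_injective (hL.mem hq) ?_
    have h1 := hL.trivialization_covariantDeriv h hq ((hsm q hq).mdifferentiableAt (by simp)) v
    have hev : coord (fun q => (trivializationAt ℂ L.Fiber x).symm q (1 : ℂ)) x =ᶠ[nhds q]
        fun _ => 1 := by
      filter_upwards [(W.toOpens x).isOpen.mem_nhds hq] with r hr
      exact hone r hr
    rw [hev.mvfderiv_eq v, mvfderiv_const, hone q hq] at h1
    rw [trivialization_smul (hL.mem hq)]
    refine h1.trans ?_
    change 0 + _ = _ * coord (fun q => (trivializationAt ℂ L.Fiber x).symm q (1 : ℂ)) x q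
    rw [hone q hq, zero_add]
    rfl
  · refine (Form.d_postcomp Complex.ofRealCLM (h.smoothAt x q hq)).trans ?_
    rw [h.d_eq x q hq]
    rfl

theorem HasTransitions.hasHermitianConnectionWithCurvature (hL : L.HasTransitions W f)
    (h : Potentials Ω W α f) : L.HasHermitianConnectionWithCurvature Ω :=
  ⟨hL.metric, hL.connection h, hL.connection_isHermitian h, hL.connection_isCurvatureForm h⟩

end ComplexLineBundle

end Manifold

/-! ### The line bundle of an integral cocycle -/

section Core

variable {E : Type v} [NormedAddCommGroup E] [NormedSpace ℝ E]
  {M : Type u} [TopologicalSpace M] [ChartedSpace E M]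

variable (E) in
/-- Functions `f_{xy}` whose exponentials `exp(2πi f_{xy})` form a cocycle. -/
structure IntegralCocycle (W : PointedCover M) (f : M → M → M → ℝ) : Prop where
  contMDiffOn : ∀ x y,
    ContMDiffOn 𝓘(ℝ, E) 𝓘(ℝ, ℝ) ∞ (f x y) (W.toOpens x ∩ W.toOpens y : Set M)
  exists_int : ∀ x y z p, p ∈ W.toOpens x → p ∈ W.toOpens y → p ∈ W.toOpens z →
    ∃ n : ℤ, f y z p - f x z p + f x y p = n

namespace IntegralCocycle

variable {W : PointedCover M} {f : M → M → M → ℝ}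

theorem exp_mul_exp (h : IntegralCocycle E W f) {x y z p : M} (hx : p ∈ W.toOpens x)
    (hy : p ∈ W.toOpens y) (hz : p ∈ W.toOpens z) :
    Complex.exp (2 * Real.pi * Complex.I * f x y p) *
      Complex.exp (2 * Real.pi * Complex.I * f y z p) =
        Complex.exp (2 * Real.pi * Complex.I * f x z p) := by
  obtain ⟨n, hn⟩ := h.exists_int x y z p hx hy hz
  rw [← Complex.exp_add, Complex.exp_eq_exp_iff_exists_int]
  refine ⟨n, ?_⟩
  have hn' : (f y z p : ℂ) - f x z p + f x y p = n := by exact_mod_cast hn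
  linear_combination (2 * Real.pi * Complex.I) * hn'

theorem exp_self (h : IntegralCocycle E W f) {x p : M} (hx : p ∈ W.toOpens x) :
    Complex.exp (2 * Real.pi * Complex.I * f x x p) = 1 :=
  mul_left_cancel₀ (Complex.exp_ne_zero _) ((h.exp_mul_exp hx hx hx).trans (mul_one _).symm)

theorem contMDiffOn_exp (h : IntegralCocycle E W f) (x y : M) :
    ContMDiffOn 𝓘(ℝ, E) 𝓘(ℝ, ℂ) ∞ (fun p => Complex.exp (2 * Real.pi * Complex.I * f x y p))
      (W.toOpens x ∩ W.toOpens y : Set M) := fun p hp => by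
  have hfc : ContMDiffAt 𝓘(ℝ, E) 𝓘(ℝ, ℂ) ∞ (fun q => (f x y q : ℂ)) p :=
    ContDiffAt.comp_contMDiffAt (g := fun t : ℝ => (t : ℂ)) Complex.ofRealCLM.contDiff.contDiffAt
      ((h.contMDiffOn x y).contMDiffAt
        (((W.toOpens x).isOpen.inter (W.toOpens y).isOpen).mem_nhds hp))
  exact hfc.cexp_two_pi_I.contMDiffWithinAt

/-- The vector bundle core with transition functions `exp(2πi f_{xy})`. -/
def core (h : IntegralCocycle E W f) : VectorBundleCore ℂ M ℂ M where
  baseSet x := W.toOpens x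
  isOpen_baseSet x := (W.toOpens x).isOpen
  indexAt x := x
  mem_baseSet_at := W.mem
  -- Frames satisfy s_y = e(f_{xy}) s_x, so coordinates change the opposite way: passing from index
  -- `x` to index `y` uses f_{yx}.
  coordChange x y p := Complex.exp (2 * Real.pi * Complex.I * f y x p) •
    ContinuousLinearMap.id ℂ ℂ
  coordChange_self x p hp a := by
    rw [h.exp_self hp, one_smul]
    rfl
  continuousOn_coordChange x y := by
    have hc := (h.contMDiffOn_exp y x).continuousOn
    rw [Set.inter_comm] at hc
    exact hc.smul continuousOn_const
  coordChange_comp x y z p hp a := by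
    change Complex.exp (2 * Real.pi * Complex.I * f z y p) *
      (Complex.exp (2 * Real.pi * Complex.I * f y x p) * a) =
        Complex.exp (2 * Real.pi * Complex.I * f z x p) * a
    rw [← mul_assoc, h.exp_mul_exp hp.2 hp.1.2 hp.1.1]

theorem core_coordChange_apply (h : IntegralCocycle E W f) (x y p : M) (a : ℂ) :
    h.core.coordChange x y p a = Complex.exp (2 * Real.pi * Complex.I * f y x p) * a := rfl

instance (h : IntegralCocycle E W f) (p : M) : IsTopologicalAddGroup (h.core.Fiber p) :=
  inferInstanceAs (IsTopologicalAddGroup ℂ)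

instance (h : IntegralCocycle E W f) (p : M) : ContinuousSMul ℂ (h.core.Fiber p) :=
  inferInstanceAs (ContinuousSMul ℂ ℂ)

instance (h : IntegralCocycle E W f) (p : M) : ContinuousSMul ℝ (h.core.Fiber p) :=
  ⟨(Complex.continuous_ofReal.comp continuous_fst).smul continuous_snd⟩

/-- The core is complex, while smoothness over the real manifold `M` concerns a real vector bundle.
The same trivializations are therefore also shown to be real-linear, with smooth real coordinate
changes. -/
instance localTriv_isLinear_real (h : IntegralCocycle E W f) (i : M) :
    (h.core.localTriv i).IsLinear ℝ where
  linear _ hp :=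
    { map_add := ((h.core.localTriv i).linear ℂ hp).map_add
      map_smul := fun r a => ((h.core.localTriv i).linear ℂ hp).map_smul (r : ℂ) a }

/-- The transition functions as real-linear maps. -/
def realCoordChange (f : M → M → M → ℝ) (x y p : M) : ℂ →L[ℝ] ℂ :=
  ContinuousLinearMap.mul ℝ ℂ (Complex.exp (2 * Real.pi * Complex.I * f y x p))

theorem contMDiffOn_realCoordChange (h : IntegralCocycle E W f) (x y : M) :
    ContMDiffOn 𝓘(ℝ, E) 𝓘(ℝ, ℂ →L[ℝ] ℂ) ∞ (realCoordChange f x y)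
      (W.toOpens x ∩ W.toOpens y : Set M) := by
  rw [Set.inter_comm]
  exact (ContinuousLinearMap.mul ℝ ℂ).contMDiff.comp_contMDiffOn (h.contMDiffOn_exp y x)

theorem coordChangeL_real_apply (h : IntegralCocycle E W f) (i i' : M) {b : M}
    (hb : b ∈ (h.core.localTriv i).baseSet ∩ (h.core.localTriv i').baseSet) (a : ℂ) :
    (h.core.localTriv i).coordChangeL ℝ (h.core.localTriv i') b a = realCoordChange f i i' b a :=
  (Trivialization.coordChangeL_apply' (R := ℝ) _ _ hb a).trans
    ((Trivialization.coordChangeL_apply' (R := ℂ) (h.core.localTriv i)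
      (h.core.localTriv i') hb a).symm.trans (h.core.localTriv_coordChange_eq i i' hb a))

instance vectorBundleReal (h : IntegralCocycle E W f) : VectorBundle ℝ ℂ h.core.Fiber where
  trivialization_linear' := by
    rintro _ ⟨i, rfl⟩
    exact h.localTriv_isLinear_real i
  continuousOn_coordChange' := by
    rintro _ _ ⟨i, rfl⟩ ⟨i', rfl⟩
    refine (h.contMDiffOn_realCoordChange i i').continuousOn.congr fun b hb => ?_
    ext a
    exact h.coordChangeL_real_apply i i' hb a

instance contMDiffVectorBundle (h : IntegralCocycle E W f) :
    ContMDiffVectorBundle ∞ ℂ h.core.Fiber 𝓘(ℝ, E) where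
  contMDiffOn_coordChangeL := by
    rintro - - ⟨i, rfl⟩ ⟨i', rfl⟩
    refine (h.contMDiffOn_realCoordChange i i').congr fun b hb => ?_
    ext a
    exact h.coordChangeL_real_apply i i' hb a

/-- The complex line bundle with transition functions `exp(2πi f_{xy})`. -/
def lineBundle (h : IntegralCocycle E W f) : ComplexLineBundle.{u, v, 0} E M where
  Fiber := h.core.Fiber

/-- A vector in the fibre at `p` is its own coordinate for the index `p`, so the relation between
the coordinates at `x` and `y` is the cocycle identity for `x`, `y`, `p`. -/
theorem hasTransitions (h : IntegralCocycle E W f) : h.lineBundle.HasTransitions W f where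
  baseSet_eq _ := rfl
  trivialization_eq x y p hx hy a := by
    have key : ∀ a : ℂ, h.core.coordChange p x p a =
        Complex.exp (2 * Real.pi * Complex.I * f x y p) * h.core.coordChange p y p a := fun a => by
      rw [core_coordChange_apply, core_coordChange_apply, ← mul_assoc,
        h.exp_mul_exp hx hy (W.mem p)]
    exact key a

end IntegralCocycle

end Core

/-! ### From integral classes to integral cocycles -/

section Integrality

variable {E : Type v} [NormedAddCommGroup E] [NormedSpace ℝ E]
  {M : Type u} [TopologicalSpace M] [ChartedSpace E M] [IsManifold 𝓘(ℝ, E) ∞ M]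
  {Ω : Form E M ℝ 2} {U : PointedCover M} {α : M → Form E M ℝ 1} {f : M → M → M → ℝ}

theorem eventuallyEq_of_isLocallyConstant {g : M → ℝ} {O : Opens M}
    (hg : IsLocallyConstant fun p : O => g p) {p : M} (hp : p ∈ O) :
    g =ᶠ[nhds p] fun _ => g p := by
  have h := (IsLocallyConstant.iff_eventually_eq _).1 hg ⟨p, hp⟩
  rw [← O.isOpen.isOpenEmbedding_subtypeVal.map_nhds_eq ⟨p, hp⟩]
  exact h

/-- If the Čech class of the potentials is integral, then the primitives can be changed by locally
constant functions so that they become an integral cocycle. -/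
theorem Potentials.exists_integralCocycle (h : Potentials Ω U α f)
    (hκ : CechH.mk U h.cocycle ∈ (cechEpsilon M).range) :
    ∃ (W : PointedCover M) (f' : M → M → M → ℝ), Potentials Ω W α f' ∧ IntegralCocycle E W f' := by
  obtain ⟨k, hk⟩ := hκ
  obtain ⟨V, b, rfl⟩ := CechH.exists_mk k
  have hk' : CechH.mk U h.cocycle = CechH.mk V ((intToReal M).onCocycle V 2 b) :=
    hk.symm.trans ((intToReal M).onCechH_mk b)
  obtain ⟨W, hUW, hVW, t, ht⟩ := CechH.exists_of_mk_eq_mk hk'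
  have hW := h.mono hUW
  have hpair : ∀ {x y p : M}, p ∈ W.toOpens x → p ∈ W.toOpens y → p ∈ W.inter ![x, y] :=
    fun hx hy => PointedCover.mem_inter.2 fun l => by fin_cases l <;> assumption
  have htc : ∀ {x y p : M}, p ∈ W.toOpens x → p ∈ W.toOpens y →
      Cochain.val t ![x, y] =ᶠ[nhds p] fun _ => Cochain.val t ![x, y] p := fun hx hy =>
    eventuallyEq_of_isLocallyConstant (Cochain.val_mem_sec t _) (hpair hx hy)
  have hts : ∀ {x y p : M}, p ∈ W.toOpens x → p ∈ W.toOpens y →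
      ContMDiffAt 𝓘(ℝ, E) 𝓘(ℝ, ℝ) ∞ (Cochain.val t ![x, y]) p := fun hx hy =>
    contMDiffAt_const.congr_of_eventuallyEq (htc hx hy)
  -- The cocycle of `f` and the integral cocycle `b` differ by δt on `W`. Since `t` is locally
  -- constant, subtracting it leaves every differential unchanged and turns δf into `b`.
  have hpot : Potentials Ω W α (fun x y => f x y - Cochain.val t ![x, y]) := by
    refine ⟨hW.smoothAt, hW.d_eq, fun x y p hp =>
      ((hW.contMDiffAt hp.1 hp.2).sub (hts hp.1 hp.2)).contMDiffWithinAt, fun x y p hx hy v => ?_⟩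
    have hd := (htc hx hy).mvfderiv_eq (E := E) v
    rw [mvfderiv_const] at hd
    rw [mvfderiv_sub (hW.mdifferentiableAt hx hy) ((hts hx hy).mdifferentiableAt (by simp)),
      hW.mvfderiv_eq x y p hx hy v]
    change _ = mvfderiv 𝓘(ℝ, E) (f x y) p v - mvfderiv 𝓘(ℝ, E) (Cochain.val t ![x, y]) p v
    rw [hd]
    exact (sub_zero _).symm
  refine ⟨W, _, hpot, hpot.contMDiffOn, fun x y z p hx hy hz => ?_⟩
  have hp : p ∈ W.inter ![x, y, z] :=
    PointedCover.mem_inter.2 fun l => by fin_cases l <;> assumption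
  have hv := congrArg (fun d => Cochain.val d ![x, y, z] p) ht
  simp only [Cochain.val_cechD_one t hp, Cochain.val_sub _ _ hp] at hv
  have h1 : Cochain.val (refine (constSheaf M ℝ) hUW 2 h.cocycle.1) ![x, y, z] p =
      f y z p - f x z p + f x y p :=
    (Cochain.val_refine hUW _ hp).trans (h.val_cochain (PointedCover.inter_mono hUW _ hp))
  have h2 : Cochain.val (refine (constSheaf M ℝ) hVW 2 ((intToReal M).onCocycle V 2 b).1)
      ![x, y, z] p = (Cochain.val b.1 ![x, y, z] p : ℤ) :=
    (Cochain.val_refine hVW _ hp).trans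
      (Cochain.val_onCochain (intToReal M) b.1 (PointedCover.inter_mono hVW _ hp))
  refine ⟨Cochain.val b.1 ![x, y, z] p, ?_⟩
  rw [h1, h2] at hv
  simp only [Matrix.cons_val] at hv
  simp only [Pi.sub_apply]
  linarith

end Integrality

end LineBundles

end

/-! ### The theorem -/

theorem mainTheorem1 {E : Type v} [NormedAddCommGroup E] [NormedSpace ℝ E]
    [FiniteDimensional ℝ E] {M : Type u} [TopologicalSpace M] [T2Space M] [ParacompactSpace M]
    [ConnectedSpace M] [ChartedSpace E M] [IsManifold 𝓘(ℝ, E) ∞ M]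
    (Ω : closedForms E M 2) :
    ∃ κ : CechH (constSheaf M ℝ) 2,
      -- `κ` is the Čech class canonically associated with the de Rham class of `Ω`
      (∀ κ', IsCechClassOf κ' (DeRhamH2.mk Ω) ↔ κ' = κ) ∧
      ((∃ L : ComplexLineBundle.{u, v, 0} E M, L.HasHermitianConnectionWithCurvature Ω.1) ↔
        κ ∈ (cechEpsilon M).range) ∧
      (∀ L : ComplexLineBundle.{u, v, w} E M, L.HasHermitianConnectionWithCurvature Ω.1 →
        ∃ k : CechH (constSheaf M ℤ) 2,
          (∀ k', L.IsFirstChernClass k' ↔ k' = k) ∧ cechEpsilon M k = κ) := by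
  obtain ⟨U, α, f, h⟩ := exists_potentials Ω
  -- Any potentials of Ω, in particular those read off from a connection, represent the same class
  -- as the chosen ones.
  have hκ : ∀ {W : PointedCover M} {β : M → Form E M ℝ 1} {g : M → M → M → ℝ}
      (h' : Potentials Ω.1 W β g), CechH.mk W h'.cocycle = CechH.mk U h.cocycle := fun h' =>
    (isCechClassOf_iff.2 ⟨Ω, _, _, _, h', rfl, rfl⟩ : IsCechClassOf _ (DeRhamH2.mk Ω)).eq
      (isCechClassOf_iff.2 ⟨Ω, _, _, _, h, rfl, rfl⟩)
  refine ⟨CechH.mk U h.cocycle, fun κ' => ⟨fun h' => ?_, ?_⟩, ⟨?_, fun hk => ?_⟩, ?_⟩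
  · exact h'.eq (isCechClassOf_iff.2 ⟨Ω, _, _, _, h, rfl, rfl⟩)
  · rintro rfl
    exact isCechClassOf_iff.2 ⟨Ω, _, _, _, h, rfl, rfl⟩
  · rintro ⟨L, _, D, -, hD⟩
    obtain ⟨W, β, g, h', b, -, hb⟩ := L.exists_isFirstChernClass_and_potentials D hD
    -- The preimage of κ under ε² is the first Chern class of the given bundle.
    exact ⟨CechH.mk W b, ((intToReal M).onCechH_mk b).trans (hb ▸ hκ h')⟩
  · obtain ⟨W, f', hW, hf'⟩ := h.exists_integralCocycle hk
    exact ⟨hf'.lineBundle, hf'.hasTransitions.hasHermitianConnectionWithCurvature hW⟩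
  · rintro L ⟨_, D, -, hD⟩
    obtain ⟨W, β, g, h', b, hk, hb⟩ := L.exists_isFirstChernClass_and_potentials D hD
    exact ⟨CechH.mk W b, fun k' => ⟨fun hk' => hk'.eq hk, fun e => e ▸ hk⟩,
      ((intToReal M).onCechH_mk b).trans (hb ▸ hκ h')⟩
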